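/- **Theorem 3.5 (weak crystalline phase).** Let $(\xi_k)_{k\ge 0}$ be i.i.d. complex random variables with $\mathbb E[\xi_0]=0$, $\sigma_1^2:=\mathbb E[(\Re\xi_0)^2]<\infty$, $\sigma_2^2:=\mathbb E[(\Im\xi_0)^2]<\infty$, $\sigma^2:=\sigma_1^2+\sigma_2^2>0$ and $\mathrm{Cov}(\Re\xi_0,\Im\xi_0)=0$. Let $b:[0,\infty)\to\mathbb R$ satisfy $b(x)=x^{-1/2}\ell(x)$ for $x>0$, where $\ell$ is slowly varying at $+\infty$ (measurable, eventually positive, and $\ell(\lambda x)/\ell(x)\to1$ as $x\to+\infty$ for every $\lambda>0$), and suppose $\sum_{k\ge1}k^{-1}\ell^2(k)=+\infty$. Put $$P_n(z)=\sum_{k=0}^n b(k)\xi_kz^k,\qquad L(x)=\int_c^x b^2(t)\,dt,$$ where $c\ge0$ is any number such that $b^2$ is integrable on $(c,x)$ for all $x>c$ (one takes $c=0$ if $b^2$ is locally integrable on $[0,\infty)$). Let $W_{-1}$ be the secondary real branch of the Lambert function, that is, the inverse of $w\mapsto we^w$, $w\le-1$, and for $\psi\in\mathbb R$, $u\in\mathbb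 C$ and all sufficiently large $n$ let $$\hat z_n(\psi,u)=\exp\Big(-\frac1{2n}W_{-1}\Big(-\frac{n b^2(n)}{L(n)}\Big)+\frac un+i\psi\Big).$$ Then, for any $0\le\psi_1<\dots<\psi_m<2\pi$, as $n\to\infty$, $$\Big(\tfrac1{\sqrt{L(n)}}P_n(\hat z_n(\psi_j,u))\Big)_{u\in\mathbb C,\ 1\le j\le m}\Longrightarrow\big(\hat N_j+e^uN_j\big)_{u\in\mathbb C,\ 1\le j\le m}$$ in distribution on $\mathcal A(\mathbb C)^m$, where $\mathcal A(\mathbb C)$ is the space of entire functions with the topology of locally uniform convergence, and $(\hat N_1,\dots,\hat N_m)$ and $(N_1,\dots,N_m)$ are independent centered complex Gaussian vectors with the same law, which exists and is determined by $$\mathbb E[N_i\overline{N_j}]=\sigma^2\mathbf 1_{\{i=j\}},\qquad \mathbb E[N_iN_j]=(\sigma_1^2-\sigma_2^2)\mathbf 1_{\{\psi_i+\psi_j\in2\pi\mathbb Z\}}.$$ Moreover, the point processes of zeros (counted with multiplicity) of $u\mapsto P_n(\hat z_n(\psi_j,u))$, $1\le j\le m$, converge jointly in distribution, on the $m$-th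 power of the space of locally finite integer-valued measures on $\mathbb C$ with the vague topology, to the point processes of zeros of $u\mapsto\hat N_j+e^uN_j$, $1\le j\le m$. Almost surely, for every $j$, the zeros of $u\mapsto\hat N_j+e^uN_j$ are simple and form the lattice $\log(-\hat N_j/N_j)+2\pi i\mathbb Z$. (The identically zero function is assigned the zero measure as its point process of zeros.) -/

import Mathlib

open MeasureTheory ProbabilityTheory Filter Topology

namespace CrystallinePhase

noncomputable section

/-! ### Slowly varying functions, the Lambert function -/

/-- A measurable, eventually positive function `ℓ` with `ℓ (λ x) / ℓ x → 1` as `x → +∞` for every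
`λ > 0`. Only the values on `(0, ∞)` matter. -/
structure IsSlowlyVarying (ℓ : ℝ → ℝ) : Prop where
  measurable : Measurable ℓ
  eventually_pos : ∀ᶠ x in atTop, 0 < ℓ x
  tendsto_ratio : ∀ r : ℝ, 0 < r → Tendsto (fun x => ℓ (r * x) / ℓ x) atTop (𝓝 1)

/-- `S(γ; ℓ) = ∑_{k ≥ 1} k ^ γ * ℓ(k) ^ 2`, an element of `[0, ∞]`. -/
def seriesS (γ : ℝ) (ℓ : ℝ → ℝ) : ENNReal :=
  ∑' k : ℕ, ENNReal.ofReal (((k + 1 : ℕ) : ℝ) ^ γ * ℓ ((k + 1 : ℕ) : ℝ) ^ 2)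

/-- The secondary real branch `W₋₁` of the Lambert function: the inverse of `w ↦ w * exp w` on
`(-∞, -1]`. It is meaningful on `[-1/e, 0)`. -/
def lambertWm1 (x : ℝ) : ℝ :=
  Function.invFunOn (fun w : ℝ => w * Real.exp w) (Set.Iic (-1)) x

theorem lambertWm1_spec {x : ℝ} (h₁ : -Real.exp (-1) ≤ x) (h₂ : x < 0) :
    lambertWm1 x ≤ -1 ∧ lambertWm1 x * Real.exp (lambertWm1 x) = x := by
  have hlim : Tendsto (fun w : ℝ => w * Real.exp w) atBot (𝓝 0) := by
    have h := (Real.tendsto_pow_mul_exp_neg_atTop_nhds_zero 1).neg.comp tendsto_neg_atBot_atTop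
    simpa [Function.comp_def] using h
  obtain ⟨w₀, hw₀, hw₀'⟩ :=
    ((hlim.eventually (lt_mem_nhds h₂)).and (eventually_le_atBot (-1))).exists
  have hmem : x ∈ (fun w : ℝ => w * Real.exp w) '' Set.Icc w₀ (-1) := by
    apply intermediate_value_Icc' hw₀' (by fun_prop)
    exact ⟨by simpa using h₁, hw₀.le⟩
  obtain ⟨w, hw, hwx⟩ := hmem
  have hx : ∃ a ∈ Set.Iic (-1 : ℝ), (fun w : ℝ => w * Real.exp w) a = x := ⟨w, hw.2, hwx⟩
  exact ⟨Function.invFunOn_mem hx, Function.invFunOn_eq hx⟩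

/-! ### The space of entire functions and the space of point measures -/

/-- The space `𝒜(ℂ)` of entire functions, with the topology of locally uniform convergence
(the compact-open topology of `C(ℂ, ℂ)`). -/
abbrev Entire : Type := {f : C(ℂ, ℂ) // Differentiable ℂ f}

/-- An entire function as an element of `Entire`. -/
def Entire.of (f : ℂ → ℂ) (hf : Differentiable ℂ f) : Entire := ⟨⟨f, hf.continuous⟩, hf⟩

/-- The space `M_p(ℂ)` of locally finite integer-valued Borel measures on `ℂ`. -/
def PointMeasure : Type :=
  {μ : Measure ℂ // ∀ B : Set ℂ, MeasurableSet B → Bornology.IsBounded B → ∃ n : ℕ, μ B = n}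

/-- The vague topology: the coarsest one for which `μ ↦ ∫ φ dμ` is continuous for every continuous
compactly supported `φ : ℂ → ℝ`. -/
instance : TopologicalSpace PointMeasure :=
  TopologicalSpace.induced
    (fun (μ : PointMeasure) (φ : CompactlySupportedContinuousMap ℂ ℝ) => ∫ z, φ z ∂μ.1)
    inferInstance

/-- The zero counting measure `∑_z (order of vanishing of f at z) δ_z`. For `f ≡ 0` this is, by
convention, the zero measure. -/
def zeroMeasure (f : ℂ → ℂ) : Measure ℂ :=
  Measure.sum fun z : ℂ => ((analyticOrderNatAt f z : ℕ) : ENNReal) • Measure.dirac z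

theorem finite_support_order (f : Entire) {B : Set ℂ} (hB : Bornology.IsBounded B) :
    {z ∈ B | analyticOrderNatAt f.1 z ≠ 0}.Finite := by
  have han : AnalyticOnNhd ℂ f.1 Set.univ := fun z _ => f.2.analyticAt z
  rcases han.eqOn_zero_or_eventually_ne_zero_of_preconnected isPreconnected_univ with h | h
  · have h0 : (f.1 : ℂ → ℂ) = fun _ => 0 := funext fun z => h (Set.mem_univ z)
    have : ∀ z, analyticOrderNatAt f.1 z = 0 := by
      intro z
      have : analyticOrderAt f.1 z = ⊤ := by
        rw [analyticOrderAt_eq_top, h0]; simp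
      simp [analyticOrderNatAt, this]
    simp [this]
  · have hK : IsCompact (closure B) := hB.isCompact_closure
    have hc := hK.finite_sdiff_of_mem_codiscreteWithin
      (Filter.codiscreteWithin_mono (Set.subset_univ _) h)
    refine hc.subset fun z hz => ⟨subset_closure hz.1, fun hne => ?_⟩
    exact hz.2 (by simp [analyticOrderNatAt, (f.2.analyticAt z).analyticOrderAt_eq_zero.2 hne])

theorem zeroMeasure_bounded (f : Entire) (B : Set ℂ) (hB : MeasurableSet B)
    (hb : Bornology.IsBounded B) : ∃ n : ℕ, zeroMeasure f.1 B = n := by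
  classical
  have hfin := finite_support_order f hb
  refine ⟨∑ z ∈ hfin.toFinset, analyticOrderNatAt f.1 z, ?_⟩
  rw [zeroMeasure, Measure.sum_apply _ hB, tsum_eq_sum (s := hfin.toFinset)]
  · push_cast
    refine Finset.sum_congr rfl fun z hz => ?_
    have hz' : z ∈ B := ((Set.Finite.mem_toFinset _).1 hz).1
    simp [Measure.dirac_apply' _ hB, hz']
  · intro z hz
    by_cases hzB : z ∈ B
    · have : analyticOrderNatAt f.1 z = 0 := by
        by_contra h
        exact hz ((Set.Finite.mem_toFinset _).2 ⟨hzB, h⟩)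
      simp [this]
    · simp [Measure.dirac_apply' _ hB, hzB]

/-- The point process of zeros, counted with multiplicity, of an entire function. -/
def zerosOf (f : Entire) : PointMeasure := ⟨zeroMeasure f.1, zeroMeasure_bounded f⟩

/-! ### Convergence in distribution -/

/-- Convergence in distribution of random elements of a topological space `E` equipped with its
Borel σ-algebra. -/
def ConvergesInLaw {Ω Ω' E : Type*} [MeasurableSpace Ω] [MeasurableSpace Ω'] [TopologicalSpace E]
    (X : ℕ → Ω → E) (P : Measure Ω) [IsProbabilityMeasure P]
    (Z : Ω' → E) (P' : Measure Ω') [IsProbabilityMeasure P'] : Prop :=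
  letI : MeasurableSpace E := borel E
  haveI : BorelSpace E := ⟨rfl⟩
  TendstoInDistribution X atTop Z (fun _ => P) P'

/-! ### The random polynomials and their limits -/

/-- `L(x) = ∫_c^x b(t)² dt`. -/
def bigL (b : ℝ → ℝ) (c x : ℝ) : ℝ := ∫ t in c..x, b t ^ 2

/-- `P_n(z) = ∑_{k=0}^n b(k) ξ_k z^k` for a coefficient sequence `x = (ξ_k)`. -/
def randPoly (b : ℝ → ℝ) (x : ℕ → ℂ) (n : ℕ) (z : ℂ) : ℂ :=
  ∑ k ∈ Finset.range (n + 1), (b k : ℂ) * x k * z ^ k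

/-- The local coordinate
`ẑ_n(ψ, u) = exp (-W₋₁(-n b(n)² / L(n)) / (2 n) + u / n + i ψ)`. -/
def zHat (b : ℝ → ℝ) (c : ℝ) (n : ℕ) (ψ : ℝ) (u : ℂ) : ℂ :=
  Complex.exp (-((lambertWm1 (-(n * b n ^ 2 / bigL b c n)) : ℝ) : ℂ) / (2 * n) + u / n
    + Complex.I * ψ)

/-- The entire function `u ↦ L(n)^{-1/2} P_n(ẑ_n(ψ, u))`. -/
def scaledPoly (b : ℝ → ℝ) (c : ℝ) (x : ℕ → ℂ) (n : ℕ) (ψ : ℝ) : Entire :=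
  Entire.of (fun u => ((1 / √(bigL b c n) : ℝ) : ℂ) * randPoly b x n (zHat b c n ψ u)) (by
    unfold randPoly zHat
    fun_prop)

/-- The entire function `u ↦ p + exp u * q`. -/
def limitFunction (p q : ℂ) : Entire :=
  Entire.of (fun u => p + Complex.exp u * q) (by fun_prop)

open Classical in
/-- `N` is a centered complex Gaussian vector (real and imaginary parts of all coordinates are
jointly Gaussian, possibly degenerate) with `E[N_i conj(N_j)] = (σ₁² + σ₂²) 1{i = j}` and
`E[N_i N_j] = (σ₁² - σ₂²) 1{ψ_i + ψ_j ∈ 2πℤ}`. These data determine its law. -/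
structure IsLimitVector {Ω : Type*} [MeasurableSpace Ω] {m : ℕ} (σ₁ σ₂ : ℝ) (ψ : Fin m → ℝ)
    (N : Ω → Fin m → ℂ) (P : Measure Ω) : Prop where
  gaussian : HasGaussianLaw N P
  mean : ∀ i, ∫ ω, N ω i ∂P = 0
  cov : ∀ i j, ∫ ω, N ω i * (starRingEnd ℂ) (N ω j) ∂P =
    if i = j then ((σ₁ ^ 2 + σ₂ ^ 2 : ℝ) : ℂ) else 0
  pseudoCov : ∀ i j, ∫ ω, N ω i * N ω j ∂P =
    if ∃ k : ℤ, ψ i + ψ j = 2 * Real.pi * k then ((σ₁ ^ 2 - σ₂ ^ 2 : ℝ) : ℂ) else 0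

end

end CrystallinePhase

/-!
Write `w = w_n = -W₋₁(-n b(n)² / L(n))` for the tilt, so that `w e^{-w} = n b(n)² / L(n)`. Then
`L(n)^{-1/2} P_n(ẑ_n(ψ, u))` is the sum over `k ≤ n` of
`L(n)^{-1/2} b(k) e^{w k / (2 n)} e^{i k ψ} ξ_k e^{u k / n}`, a linear combination of independent
variables whose variances are governed by the tilted weights `b(k)² e^{w k / n} / L(n)`. Since `L` is
slowly varying, these weights have mass in two places only. The indices `k = o(n)` carry a
total mass `∑ b(k)² / L(n) → 1`, and there `e^{u k / n} ≈ 1`. The indices `k` close to `n` form the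
geometric sum `(b(n)² / L(n)) ∑ e^{w k / n} ≈ (b(n)² / L(n)) n e^w / w = 1`, by the choice of `w`, and
there `e^{u k / n} ≈ e^u`. This is why two independent copies of the same Gaussian vector appear, one
of them multiplied by `e^u`. The pointwise comparison is `eventually_tiltedWeight_sub_le`, which rests
on the uniform convergence theorem for slowly varying functions; its consequence for the sums is
`tendsto_sum_tiltedWeight`.

The same comparison shows that the total variation of the weights is `o(L(n))`
(`tendsto_variation_tiltedWeight`). Hence no single term matters, which is the Lindeberg condition,
and, by summation by parts, the weights integrated against a nontrivial character `e^{i k θ}` are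
negligible (`tendsto_oscillating_sum`): different angles decorrelate, and `E[N_i N_j]` survives only
when `ψ_i + ψ_j ∈ 2πℤ`. A Lindeberg theorem in terms of characteristic functions
(`tendsto_prod_charFun`) and Lévy's continuity theorem give the joint convergence of finitely many
Taylor coefficients at `u = 0` (`tendsto_integral_scaledDeriv`).

Because `(k / n) ^ r ≤ 1`, the Taylor coefficients have moments bounded uniformly in their order `r`,
so the Taylor series of the polynomials can be truncated locally uniformly in `u`, uniformly in large
`n`. The approximation theorem `convergesInLaw_of_approx` upgrades the convergence of the
coefficients to convergence in law in the space of entire functions (`convergesInLaw_scaledPoly`).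

For the zeros, Jensen's formula on two concentric circles shows that the number of zeros in a small
disc is locally constant (`eventually_zeroMeasure_ball_eq`), so the zero measure is a continuous
function of an entire function that does not vanish identically (`continuousAt_zerosOf`), and the
continuous mapping theorem applies (`ConvergesInLaw.zerosOf`). The coordinates of the limiting Gaussian
vectors are almost surely nonzero (`IsLimitVector.ae_ne_zero`), and then `p + e^u q` has exactly the
simple zeros `log (-p / q) + 2πiℤ` (`zeroMeasure_limitFunction`).
-/

namespace CrystallinePhase

/-! ### Slowly varying functions -/

/-- Uniform convergence theorem, additive form. The proof averages the triangle inequality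
`|h (x + u) - h x| ≤ |h (x + v) - h x| + |h (x + u + (v - u)) - h (x + u)|` over `v ∈ [U, 2U]`:
both averages are small by dominated convergence, with no uniformity in `u` needed. -/
theorem tendsto_sub_uniformly_of_tendsto_sub {h : ℝ → ℝ} (hm : Measurable h)
    (hlim : ∀ u : ℝ, Tendsto (fun x => h (x + u) - h x) atTop (𝓝 0)) {U : ℝ} (hU : 0 < U) :
    Tendsto (fun p : ℝ × ℝ => h (p.1 + p.2) - h p.1) (atTop ×ˢ 𝓟 (Set.Icc 0 U)) (𝓝 0) := by
  set Φ : ℝ → ℝ → ℝ := fun x v => min 1 |h (x + v) - h x| with hΦ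
  have hΦm : ∀ x, Measurable (Φ x) := fun x => by fun_prop
  have hΦ0 : ∀ x v, 0 ≤ Φ x v := fun x v => le_min zero_le_one (abs_nonneg _)
  have hΦ1 : ∀ x v, Φ x v ≤ 1 := fun x v => min_le_left _ _
  have hΦi : ∀ x a c, IntervalIntegrable (Φ x) volume a c := fun x a c =>
    (intervalIntegrable_const (c := (1 : ℝ))).mono_fun (hΦm x).aestronglyMeasurable
      (ae_of_all _ fun v => by simpa [abs_of_nonneg (hΦ0 x v)] using hΦ1 x v)
  set J : ℝ → ℝ := fun x => ∫ v in (0 : ℝ)..(2 * U), Φ x v with hJ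
  have hJ0 : Tendsto J atTop (𝓝 0) := by
    have := intervalIntegral.tendsto_integral_filter_of_dominated_convergence (l := atTop)
      (μ := volume) (a := 0) (b := 2 * U) (F := Φ) (f := fun _ => (0 : ℝ)) (fun _ => (1 : ℝ))
      (Eventually.of_forall fun x => (hΦm x).aestronglyMeasurable)
      (Eventually.of_forall fun x => ae_of_all _ fun v _ => by
        simpa [abs_of_nonneg (hΦ0 x v)] using hΦ1 x v)
      intervalIntegrable_const
      (ae_of_all _ fun v _ => by
        have h1 := ((tendsto_const_nhds (x := (1 : ℝ))).min ((hlim v).abs))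
        simpa [hΦ] using h1)
    simpa using this
  have hfst : Tendsto (fun p : ℝ × ℝ => p.1) (atTop ×ˢ 𝓟 (Set.Icc 0 U)) atTop := tendsto_fst
  have hmem : ∀ᶠ p : ℝ × ℝ in atTop ×ˢ 𝓟 (Set.Icc 0 U), p.2 ∈ Set.Icc 0 U :=
    tendsto_snd.eventually (eventually_principal.2 fun _ h => h)
  have hadd : Tendsto (fun p : ℝ × ℝ => p.1 + p.2) (atTop ×ˢ 𝓟 (Set.Icc 0 U)) atTop :=
    tendsto_atTop_mono' _ (hmem.mono fun p hp => by linarith [hp.1]) hfst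
  have hsum := ((hJ0.comp hfst).add (hJ0.comp hadd)).div_const U
  simp only [Function.comp_def, add_zero, zero_div] at hsum
  have hmin : Tendsto (fun p : ℝ × ℝ => min 1 |h (p.1 + p.2) - h p.1|)
      (atTop ×ˢ 𝓟 (Set.Icc 0 U)) (𝓝 0) := by
    refine squeeze_zero' (Eventually.of_forall fun p => hΦ0 p.1 p.2) ?_ hsum
    filter_upwards [hmem] with p hp
    obtain ⟨a, u⟩ := p
    simp only at hp ⊢
    rw [le_div_iff₀ hU]
    have key : ∀ v, min 1 |h (a + u) - h a| ≤ Φ a v + Φ (a + u) (v - u) := by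
      intro v
      have hv : a + u + (v - u) = a + v := by ring
      simp only [hΦ, hv]
      have h3 : |h (a + u) - h a| ≤ |h (a + v) - h a| + |h (a + v) - h (a + u)| := by
        have := abs_sub (h (a + v) - h a) (h (a + v) - h (a + u))
        rwa [show h (a + v) - h a - (h (a + v) - h (a + u)) = h (a + u) - h a by ring] at this
      rcases le_total 1 |h (a + v) - h a| with h1 | h1
      · rw [min_eq_left h1]
        have := min_le_left 1 |h (a + u) - h a|
        have : 0 ≤ min 1 |h (a + v) - h (a + u)| := le_min zero_le_one (abs_nonneg _)
        linarith
      · rcases le_total 1 |h (a + v) - h (a + u)| with h2 | h2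
        · rw [min_eq_left h2]
          have := min_le_left 1 |h (a + u) - h a|
          have : 0 ≤ min 1 |h (a + v) - h a| := le_min zero_le_one (abs_nonneg _)
          linarith
        · rw [min_eq_right h1, min_eq_right h2]
          exact (min_le_right _ _).trans h3
    have hshift : IntervalIntegrable (fun v => Φ (a + u) (v - u)) volume U (2 * U) :=
      by simpa using (hΦi (a + u) (U - u) (2 * U - u)).comp_sub_right u
    have hint : ∫ _ in U..(2 * U), min 1 |h (a + u) - h a|
        ≤ ∫ v in U..(2 * U), (Φ a v + Φ (a + u) (v - u)) :=
      intervalIntegral.integral_mono_on (by linarith) intervalIntegrable_const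
        ((hΦi a _ _).add hshift) fun v _ => key v
    rw [intervalIntegral.integral_add (hΦi a _ _) hshift, intervalIntegral.integral_const,
      intervalIntegral.integral_comp_sub_right (fun v => Φ (a + u) v)] at hint
    have e1 : ∫ v in U..(2 * U), Φ a v ≤ J a :=
      intervalIntegral.integral_mono_interval hU.le (by linarith) le_rfl
        (ae_of_all _ (hΦ0 a)) (hΦi a _ _)
    have e2 : ∫ v in (U - u)..(2 * U - u), Φ (a + u) v ≤ J (a + u) :=
      intervalIntegral.integral_mono_interval (by linarith [hp.2]) (by linarith)
        (by linarith [hp.1]) (ae_of_all _ (hΦ0 (a + u))) (hΦi (a + u) _ _)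
    simp only [smul_eq_mul] at hint
    linarith
  rw [tendsto_zero_iff_abs_tendsto_zero]
  refine (hmin.congr' ?_)
  filter_upwards [hmin.eventually (gt_mem_nhds zero_lt_one)] with p hp
  rcases min_lt_iff.1 hp with h1 | h1
  · exact absurd h1 (lt_irrefl _)
  · exact min_eq_right h1.le

/-- Uniform convergence theorem for slowly varying functions. -/
theorem IsSlowlyVarying.eventually_ratio {g : ℝ → ℝ} (hg : IsSlowlyVarying g) (A : ℝ) {δ : ℝ}
    (hδ : 0 < δ) :
    ∀ᶠ x in atTop, ∀ y, x ≤ y → y ≤ A * x → |g y / g x - 1| ≤ δ := by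
  -- in the variable `t = log x`, the function `t ↦ log (g (exp t))` has vanishing increments
  have hlim : ∀ u : ℝ, Tendsto (fun x => (fun t => Real.log (g (Real.exp t))) (x + u)
      - (fun t => Real.log (g (Real.exp t))) x) atTop (𝓝 0) := by
    intro u
    have h1 := ((hg.tendsto_ratio (Real.exp u) (Real.exp_pos u)).comp Real.tendsto_exp_atTop)
    have h2 := (Real.continuousAt_log one_ne_zero).tendsto.comp h1
    rw [Real.log_one] at h2
    refine h2.congr' ?_
    have e1 := Real.tendsto_exp_atTop.eventually hg.eventually_pos
    have e2 := (Real.tendsto_exp_atTop.comp (tendsto_atTop_add_const_right atTop u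
      tendsto_id)).eventually hg.eventually_pos
    filter_upwards [e1, e2] with x hx hx'
    simp only [Function.comp_def, id] at hx' ⊢
    rw [← Real.log_div hx'.ne' hx.ne', Real.exp_add, mul_comm]
  set U : ℝ := max 1 (Real.log A) with hU
  have hUpos : 0 < U := lt_of_lt_of_le one_pos (le_max_left _ _)
  have hu := tendsto_sub_uniformly_of_tendsto_sub
    (Real.measurable_log.comp (hg.measurable.comp Real.measurable_exp)) hlim hUpos
  have hu2 := (Real.continuous_exp.tendsto 0).comp hu
  rw [Real.exp_zero] at hu2
  have hev := hu2.eventually (Metric.closedBall_mem_nhds _ hδ)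
  rw [eventually_prod_principal_iff] at hev
  obtain ⟨X, hX⟩ := (Real.tendsto_log_atTop.eventually hev).exists_forall_of_atTop
  obtain ⟨Y, hY⟩ := hg.eventually_pos.exists_forall_of_atTop
  filter_upwards [eventually_ge_atTop X, eventually_ge_atTop Y, eventually_gt_atTop 0]
    with x hxX hxY hx0 y hxy hyA
  have hy0 : 0 < y := hx0.trans_le hxy
  have hA : 1 ≤ A := by
    by_contra hA
    nlinarith
  have hA' : y / x ≤ A := by rwa [div_le_iff₀ hx0]
  have h1 := hX x hxX (Real.log (y / x)) ⟨Real.log_nonneg (by rwa [le_div_iff₀ hx0, one_mul]),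
    (Real.log_le_log (by positivity) hA').trans (le_max_right _ _)⟩
  simp only [Function.comp_def, Real.dist_eq] at h1
  rwa [← Real.log_mul hx0.ne' (by positivity), mul_div_cancel₀ _ hx0.ne', Real.exp_log hy0,
    Real.exp_log hx0, Real.exp_sub, Real.exp_log (hY y (hxY.trans hxy)),
    Real.exp_log (hY x hxY)] at h1

theorem IsSlowlyVarying.sq {ℓ : ℝ → ℝ} (hℓ : IsSlowlyVarying ℓ) :
    IsSlowlyVarying (fun x => ℓ x ^ 2) where
  measurable := hℓ.measurable.pow_const 2
  eventually_pos := hℓ.eventually_pos.mono fun x hx => by positivity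
  tendsto_ratio r hr := by
    simpa [div_pow] using (hℓ.tendsto_ratio r hr).pow 2

/-- A crude Potter bound: `x * g x` is almost increasing. -/
theorem IsSlowlyVarying.exists_potter {g : ℝ → ℝ} (hg : IsSlowlyVarying g) :
    ∃ X : ℝ, 0 < X ∧ (∀ x, X ≤ x → 0 < g x) ∧
      ∀ x y, X ≤ x → x ≤ y → g x ≤ 2 * (y / x) * g y := by
  obtain ⟨X, hX⟩ := ((hg.eventually_ratio 2 (δ := 1 / 2) (by norm_num)).and
    (hg.eventually_pos.and (eventually_gt_atTop 0))).exists_forall_of_atTop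
  have hX0 : 0 < X := (hX X le_rfl).2.2
  have hstep : ∀ x y, X ≤ x → x ≤ y → y ≤ 2 * x → g x ≤ 2 * g y := by
    intro x y hx hxy hy
    have h1 := abs_le.1 ((hX x hx).1 y hxy hy)
    have hp := (hX x hx).2.1
    have : 1 / 2 ≤ g y / g x := by linarith
    rw [le_div_iff₀ hp] at this
    linarith
  refine ⟨X, hX0, fun x hx => (hX x hx).2.1, ?_⟩
  have main : ∀ n : ℕ, ∀ x y, X ≤ x → x ≤ y → y ≤ 2 ^ n * x → g x ≤ 2 * (y / x) * g y := by
    intro n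
    induction n with
    | zero =>
      intro x y hx hxy hy
      have hx0 := hX0.trans_le hx
      have : y = x := le_antisymm (by simpa using hy) hxy
      subst this
      have := (hX y hx).2.1
      rw [div_self hx0.ne']
      linarith
    | succ n ih =>
      intro x y hx hxy hy
      have hx0 := hX0.trans_le hx
      have hgy := (hX y (hx.trans hxy)).2.1
      rcases le_total y (2 * x) with h2 | h2
      · have h1 := hstep x y hx hxy h2
        have : 1 ≤ y / x := by rwa [le_div_iff₀ hx0, one_mul]
        nlinarith
      · have h1 := hstep x (2 * x) hx (by linarith) le_rfl
        have h3 := ih (2 * x) y (by linarith) h2 (by rw [pow_succ] at hy; linarith)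
        have h4 : y / (2 * x) = y / x / 2 := by field_simp
        rw [h4] at h3
        linarith
  intro x y hx hxy
  have hx0 := hX0.trans_le hx
  obtain ⟨n, hn⟩ := pow_unbounded_of_one_lt (y / x) (one_lt_two)
  exact main n x y hx hxy (by rw [div_lt_iff₀ hx0] at hn; exact hn.le)

/-! ### Sums and integrals of regularly varying functions of index `-1` -/

section RegularVariation

variable {b g : ℝ → ℝ}

theorem eventually_sq_sub_sq_le (hg : IsSlowlyVarying g)
    (hbg : ∀ x : ℝ, 0 < x → b x ^ 2 = g x / x) {δ : ℝ} (hδ : 0 < δ) :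
    ∀ᶠ x in atTop, ∀ y, x ≤ y → y ≤ x + 1 → |b y ^ 2 - b x ^ 2| ≤ δ * b x ^ 2 := by
  filter_upwards [hg.eventually_ratio 2 (half_pos hδ), hg.eventually_pos,
    eventually_ge_atTop (max 1 (2 / δ))] with x hx hgx hxδ y hxy hy
  have hx1 : 1 ≤ x := (le_max_left _ _).trans hxδ
  have hx0 : 0 < x := by linarith
  have hy0 : 0 < y := by linarith
  have hx2 : 1 / x ≤ δ / 2 := by
    have := (le_max_right _ _).trans hxδ
    rw [div_le_iff₀ hδ] at this
    rw [div_le_iff₀ hx0]; linarith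
  have h1 := hx y hxy (by linarith)
  set r := g y / g x with hr
  set s := x / y with hs
  have hs0 : 0 ≤ s := by positivity
  have hs1 : s ≤ 1 := by rw [hs, div_le_one hy0]; exact hxy
  have hs2 : 1 - s ≤ 1 / x := by
    rw [hs, show 1 - x / y = (y - x) / y by field_simp]
    exact div_le_div₀ zero_le_one (by linarith) hx0 hxy
  have hprod : b y ^ 2 = r * s * b x ^ 2 := by
    rw [hbg y hy0, hbg x hx0, hr, hs]; field_simp
  have hrs : |r * s - 1| ≤ δ := by
    have e : r * s - 1 = (r - 1) * s - (1 - s) := by ring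
    rw [e]
    calc |(r - 1) * s - (1 - s)| ≤ |(r - 1) * s| + |1 - s| := abs_sub _ _
      _ = |r - 1| * s + (1 - s) := by
        rw [abs_mul, abs_of_nonneg hs0, abs_of_nonneg (sub_nonneg.2 hs1)]
      _ ≤ δ / 2 * 1 + δ / 2 := by
        gcongr
        exact hs2.trans hx2
      _ = δ := by ring
  rw [hprod, show r * s * b x ^ 2 - b x ^ 2 = (r * s - 1) * b x ^ 2 by ring, abs_mul,
    abs_of_nonneg (sq_nonneg (b x))]
  gcongr

theorem eventually_nat_sq_pos (hg : IsSlowlyVarying g)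
    (hbg : ∀ x : ℝ, 0 < x → b x ^ 2 = g x / x) : ∀ᶠ k : ℕ in atTop, 0 < b k ^ 2 := by
  have h1 := tendsto_natCast_atTop_atTop (R := ℝ)
  filter_upwards [h1.eventually hg.eventually_pos, eventually_gt_atTop 0] with k hk hk0
  have : (0 : ℝ) < k := by exact_mod_cast hk0
  rw [hbg k this]
  positivity

theorem tendsto_nat_sq_ratio (hg : IsSlowlyVarying g)
    (hbg : ∀ x : ℝ, 0 < x → b x ^ 2 = g x / x) :
    Tendsto (fun k : ℕ => b (k + 1 : ℕ) ^ 2 / b k ^ 2) atTop (𝓝 1) := by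
  rw [Metric.tendsto_nhds]
  intro ε hε
  have h1 := tendsto_natCast_atTop_atTop (R := ℝ)
  filter_upwards [h1.eventually (eventually_sq_sub_sq_le hg hbg (half_pos hε)),
    eventually_nat_sq_pos hg hbg] with k hk hk0
  have h2 := hk (k + 1 : ℕ) (by push_cast; linarith) (by push_cast; linarith)
  rw [Real.dist_eq, show b (k + 1 : ℕ) ^ 2 / b k ^ 2 - 1
    = (b (k + 1 : ℕ) ^ 2 - b k ^ 2) / b k ^ 2 by rw [sub_div, div_self hk0.ne'], abs_div, abs_of_pos hk0]
  calc _ ≤ ε / 2 := by rwa [div_le_iff₀ hk0]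
    _ < ε := half_lt_self hε

variable {c : ℝ}

theorem intervalIntegrable_of_le
    (hbc : ∀ x : ℝ, c ≤ x → IntervalIntegrable (fun t => b t ^ 2) volume c x) {x y : ℝ}
    (hx : c ≤ x) (hy : c ≤ y) : IntervalIntegrable (fun t => b t ^ 2) volume x y :=
  (hbc x hx).symm.trans (hbc y hy)

/-- `g = o(L)`: the integral over `[x / A, x]` alone is at least `(log A / 2) * g x`. -/
theorem tendsto_div_bigL (hg : IsSlowlyVarying g)
    (hbg : ∀ x : ℝ, 0 < x → b x ^ 2 = g x / x)
    (hbc : ∀ x : ℝ, c ≤ x → IntervalIntegrable (fun t => b t ^ 2) volume c x) :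
    Tendsto (fun x => g x / bigL b c x) atTop (𝓝 0) := by
  have hlow : ∀ K : ℝ, 0 < K → ∀ᶠ x in atTop, 0 < g x ∧ K * g x ≤ bigL b c x := by
    intro K hK
    set A := Real.exp (2 * K) with hA
    have hA1 : 1 ≤ A := Real.one_le_exp (by positivity)
    have hA0 : 0 < A := by positivity
    obtain ⟨X, hX⟩ := ((hg.eventually_ratio A one_pos).and
      (hg.eventually_pos.and ((eventually_gt_atTop 0).and
        (eventually_ge_atTop c)))).exists_forall_of_atTop
    filter_upwards [eventually_ge_atTop (A * X), eventually_ge_atTop X] with x hx hxX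
    have hxA : X ≤ x / A := by rw [le_div_iff₀ hA0]; linarith
    have hx0 : 0 < x := (hX x hxX).2.2.1
    have hxc := (hX x hxX).2.2.2
    refine ⟨(hX x hxX).2.1, ?_⟩
    have hle : x / A ≤ x := div_le_self hx0.le hA1
    have hxA0 : 0 < x / A := by positivity
    have hxAc : c ≤ x / A := (hX _ hxA).2.2.2
    have h1 : bigL b c (x / A) + ∫ t in (x / A)..x, b t ^ 2 = bigL b c x :=
      intervalIntegral.integral_add_adjacent_intervals (hbc _ hxAc)
        (intervalIntegrable_of_le hbc hxAc hxc)
    have h2 : 0 ≤ bigL b c (x / A) :=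
      intervalIntegral.integral_nonneg hxAc fun t _ => sq_nonneg _
    have h3 : ∫ t in (x / A)..x, (g x / 2) * t⁻¹ ≤ ∫ t in (x / A)..x, b t ^ 2 := by
      refine intervalIntegral.integral_mono_on hle ?_ (intervalIntegrable_of_le hbc hxAc hxc) ?_
      · refine (intervalIntegral.intervalIntegrable_inv (fun t ht => ?_)
          continuousOn_id).const_mul _
        rw [Set.uIcc_of_le hle] at ht
        exact (hxA0.trans_le ht.1).ne'
      · intro t ht
        have ht0 := hxA0.trans_le ht.1
        have hgt := (hX t (hxA.trans ht.1)).2.1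
        have := (hX t (hxA.trans ht.1)).1 x ht.2 (by
          have := ht.1; rw [div_le_iff₀ hA0] at this; linarith)
        have h5 := (abs_le.1 this).2
        have h6 : g x / g t ≤ 2 := by linarith
        rw [div_le_iff₀ hgt] at h6
        rw [hbg t ht0, div_eq_mul_inv (g t)]
        gcongr
        linarith
    rw [intervalIntegral.integral_const_mul, integral_inv_of_pos hxA0 hx0,
      div_div_cancel₀ hx0.ne', hA, Real.log_exp] at h3
    nlinarith
  rw [Metric.tendsto_nhds]
  intro ε hε
  filter_upwards [hlow (2 / ε) (by positivity)] with x hx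
  have hL : 0 < bigL b c x := lt_of_lt_of_le (mul_pos (by positivity) hx.1) hx.2
  rw [Real.dist_eq, sub_zero, abs_of_pos (div_pos hx.1 hL), div_lt_iff₀ hL]
  have h1 : g x = ε / 2 * (2 / ε * g x) := by field_simp
  have h3 : 0 < g x := hx.1
  have h4 := hx.2
  have h2 : ε / 2 * (2 / ε * g x) ≤ ε / 2 * bigL b c x := by gcongr
  nlinarith [mul_pos hε hL]

theorem tendsto_sum_sq_atTop {ℓ : ℝ → ℝ} (hb : ∀ x : ℝ, 0 < x → b x = x ^ (-(1 / 2) : ℝ) * ℓ x)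
    (hS : seriesS (-1) ℓ = ⊤) :
    Tendsto (fun n : ℕ => ∑ k ∈ Finset.range n, b k ^ 2) atTop atTop := by
  rw [← not_summable_iff_tendsto_nat_atTop_of_nonneg (fun k => sq_nonneg _)]
  intro hs
  rw [← summable_nat_add_iff 1] at hs
  refine hs.tsum_ofReal_ne_top ?_
  rw [← hS, seriesS]
  congr 1
  ext k
  congr 1
  have hk : (0 : ℝ) < ((k + 1 : ℕ) : ℝ) := by positivity
  rw [hb _ hk, mul_pow, ← Real.rpow_natCast, ← Real.rpow_mul hk.le]
  norm_num

theorem sq_eq_div_of_eq_rpow {ℓ : ℝ → ℝ} (hb : ∀ x : ℝ, 0 < x → b x = x ^ (-(1 / 2) : ℝ) * ℓ x)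
    (x : ℝ) (hx : 0 < x) : b x ^ 2 = ℓ x ^ 2 / x := by
  rw [hb x hx, mul_pow, ← Real.rpow_natCast, ← Real.rpow_mul hx.le, div_eq_inv_mul (ℓ x ^ 2)]
  norm_num [Real.rpow_neg_one]

/-- The integral and the sum of `b²` are equivalent: on `[k, k + 1]` the relative oscillation of
`b²` tends to `0`, and the sum diverges. -/
theorem tendsto_sum_range_div_bigL (hg : IsSlowlyVarying g)
    (hbg : ∀ x : ℝ, 0 < x → b x ^ 2 = g x / x)
    (hbc : ∀ x : ℝ, c ≤ x → IntervalIntegrable (fun t => b t ^ 2) volume c x)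
    (hsum : Tendsto (fun n : ℕ => ∑ k ∈ Finset.range n, b k ^ 2) atTop atTop) :
    Tendsto (fun n : ℕ => bigL b c n / ∑ k ∈ Finset.range n, b k ^ 2) atTop (𝓝 1) := by
  set a : ℕ → ℝ := fun k => ∫ t in (k : ℝ)..((k + 1 : ℕ) : ℝ), b t ^ 2 with ha
  obtain ⟨N, hN⟩ := exists_nat_ge c
  have hint : ∀ k : ℕ, N ≤ k →
      IntervalIntegrable (fun t => b t ^ 2) volume (k : ℝ) ((k + 1 : ℕ) : ℝ) := fun k hk =>
    intervalIntegrable_of_le hbc (hN.trans (by exact_mod_cast hk))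
      (hN.trans (by exact_mod_cast hk.trans (Nat.le_succ k)))
  have h1 : (fun k => a k - b k ^ 2) =o[atTop] fun k : ℕ => b k ^ 2 := by
    rw [Asymptotics.isLittleO_iff]
    intro δ hδ
    filter_upwards [(tendsto_natCast_atTop_atTop (R := ℝ)).eventually
      (eventually_sq_sub_sq_le hg hbg hδ), eventually_ge_atTop N] with k hk hkN
    rw [Real.norm_of_nonneg (sq_nonneg (b k))]
    have e : a k - b k ^ 2 = ∫ t in (k : ℝ)..((k + 1 : ℕ) : ℝ), (b t ^ 2 - b k ^ 2) := by
      rw [intervalIntegral.integral_sub (hint k hkN) intervalIntegrable_const,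
        intervalIntegral.integral_const]
      simp [ha]
    rw [e]
    refine (intervalIntegral.norm_integral_le_of_norm_le_const (C := δ * b k ^ 2) ?_).trans ?_
    · intro t ht
      rw [Set.uIoc_of_le (by push_cast; linarith)] at ht
      exact hk t ht.1.le (by have := ht.2; push_cast at this; exact this)
    · push_cast; simp
  have h2 := h1.sum_range (fun k => sq_nonneg _) hsum
  have h3 := h2.add ((Asymptotics.isLittleO_const_left (c := bigL b c N - ∑ k ∈ Finset.range N, a k)).2
    (Or.inr (tendsto_norm_atTop_atTop.comp hsum)))
  have h4 := h3.tendsto_div_nhds_zero.add_const 1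
  rw [zero_add] at h4
  refine h4.congr' ?_
  filter_upwards [eventually_ge_atTop N, hsum.eventually_gt_atTop 0] with n hn hn0
  have hL : bigL b c n = bigL b c N + ∑ k ∈ Finset.Ico N n, a k := by
    rw [intervalIntegral.sum_integral_adjacent_intervals_Ico hn
      (fun k hk => hint k hk.1)]
    exact (intervalIntegral.integral_add_adjacent_intervals (hbc _ hN)
      (intervalIntegrable_of_le hbc hN (hN.trans (by exact_mod_cast hn)))).symm
  rw [Finset.sum_Ico_eq_sub _ hn] at hL
  rw [Finset.sum_sub_distrib, hL]
  field_simp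
  ring

theorem tendsto_bigL_atTop (hg : IsSlowlyVarying g)
    (hbg : ∀ x : ℝ, 0 < x → b x ^ 2 = g x / x)
    (hbc : ∀ x : ℝ, c ≤ x → IntervalIntegrable (fun t => b t ^ 2) volume c x)
    (hsum : Tendsto (fun n : ℕ => ∑ k ∈ Finset.range n, b k ^ 2) atTop atTop) :
    Tendsto (fun n : ℕ => bigL b c n) atTop atTop := by
  refine (hsum.atTop_mul_pos one_pos (tendsto_sum_range_div_bigL hg hbg hbc hsum)).congr' ?_
  filter_upwards [hsum.eventually_gt_atTop 0] with n hn
  field_simp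

theorem tendsto_sum_div_bigL (hg : IsSlowlyVarying g)
    (hbg : ∀ x : ℝ, 0 < x → b x ^ 2 = g x / x)
    (hbc : ∀ x : ℝ, c ≤ x → IntervalIntegrable (fun t => b t ^ 2) volume c x)
    (hsum : Tendsto (fun n : ℕ => ∑ k ∈ Finset.range n, b k ^ 2) atTop atTop) :
    Tendsto (fun n : ℕ => (∑ k ∈ Finset.range (n + 1), b k ^ 2) / bigL b c n) atTop (𝓝 1) := by
  have h1 := (tendsto_sum_range_div_bigL hg hbg hbc hsum).inv₀ one_ne_zero
  have h2 := (tendsto_div_bigL hg hbg hbc).comp (tendsto_natCast_atTop_atTop (R := ℝ))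
  have h3 := h1.add (h2.mul tendsto_one_div_atTop_nhds_zero_nat)
  rw [inv_one, zero_mul, add_zero] at h3
  refine h3.congr' ?_
  filter_upwards [eventually_gt_atTop 0] with n hn
  have hn' : (0 : ℝ) < n := by exact_mod_cast hn
  rw [Finset.sum_range_succ, add_div, inv_div, hbg n hn']
  simp only [Function.comp_def]
  ring

end RegularVariation

/-! ### Exponentially tilted sums -/

/-- The standing analytic hypotheses, in terms of `g = ℓ ^ 2`: `b ^ 2` is regularly varying of
index `-1` with divergent sum, and `L` is well defined. -/
structure IsCriticalWeight (b g : ℝ → ℝ) (c : ℝ) : Prop where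
  slowlyVarying : IsSlowlyVarying g
  sq_eq : ∀ x : ℝ, 0 < x → b x ^ 2 = g x / x
  intervalIntegrable : ∀ x : ℝ, c ≤ x → IntervalIntegrable (fun t => b t ^ 2) volume c x
  tendsto_sum : Tendsto (fun n : ℕ => ∑ k ∈ Finset.range n, b k ^ 2) atTop atTop

/-- The tilt `w_n = -W₋₁(-n b(n)² / L(n))`. -/
noncomputable def tilt (b : ℝ → ℝ) (c : ℝ) (n : ℕ) : ℝ :=
  -lambertWm1 (-(n * b n ^ 2 / bigL b c n))

/-- The tilted weight `b(k)² exp(w_n k / n) (k / n) ^ p`. -/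
noncomputable def tiltedWeight (b : ℝ → ℝ) (c : ℝ) (p n k : ℕ) : ℝ :=
  b k ^ 2 * Real.exp (tilt b c n * (k / n)) * ((k : ℝ) / n) ^ p

theorem tiltedWeight_nonneg (b : ℝ → ℝ) (c : ℝ) (p n k : ℕ) : 0 ≤ tiltedWeight b c p n k := by
  unfold tiltedWeight; positivity

section Tilt

variable {b g : ℝ → ℝ} {c : ℝ}

/-- Since `n b(n)² / L(n) → 0`, the argument of the Lambert function eventually lies in
`[-1/e, 0)`, where `W₋₁` is meaningful. -/
theorem tilt_spec (h : IsCriticalWeight b g c) :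
    ∀ᶠ n : ℕ in atTop, 0 < g n ∧ 0 < bigL b c n ∧ 1 ≤ tilt b c n ∧
      g n / bigL b c n = tilt b c n * Real.exp (-tilt b c n) := by
  have hcast := tendsto_natCast_atTop_atTop (R := ℝ)
  have hL := tendsto_bigL_atTop h.slowlyVarying h.sq_eq h.intervalIntegrable h.tendsto_sum
  have he := (tendsto_div_bigL h.slowlyVarying h.sq_eq h.intervalIntegrable).comp hcast
  filter_upwards [hcast.eventually h.slowlyVarying.eventually_pos, hL.eventually_gt_atTop 0,
    eventually_gt_atTop 0, he.eventually (gt_mem_nhds (Real.exp_pos (-1)))] with n hg hL hn hlt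
  have hn' : (0 : ℝ) < n := by exact_mod_cast hn
  have e : (n : ℝ) * b n ^ 2 / bigL b c n = g n / bigL b c n := by
    rw [h.sq_eq n hn']; field_simp
  have hpos : 0 < g n / bigL b c n := div_pos hg hL
  obtain ⟨h1, h2⟩ := lambertWm1_spec (x := -(g n / bigL b c n)) (neg_le_neg hlt.le)
    (neg_lt_zero.2 hpos)
  refine ⟨hg, hL, ?_, ?_⟩
  · rw [tilt, e]; linarith
  · rw [tilt, e, neg_neg, neg_mul, h2, neg_neg]

theorem tendsto_tilt (h : IsCriticalWeight b g c) : Tendsto (tilt b c) atTop atTop := by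
  have hcast := tendsto_natCast_atTop_atTop (R := ℝ)
  have he := (tendsto_div_bigL h.slowlyVarying h.sq_eq h.intervalIntegrable).comp hcast
  rw [tendsto_atTop]
  intro A
  filter_upwards [tilt_spec h, he.eventually (gt_mem_nhds (Real.exp_pos (-A)))] with n hn hlt
  by_contra hA
  have h1 := hn.2.2.2
  have h2 : Real.exp (-A) ≤ Real.exp (-tilt b c n) := Real.exp_le_exp.2 (by linarith)
  have h3 := Real.exp_pos (-tilt b c n)
  simp only [Function.comp_def] at hlt
  nlinarith [hn.2.2.1]

/-- The tilt grows at most logarithmically, since `L(n) / g(n)` grows at most polynomially. -/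
theorem exists_exp_half_tilt_le (h : IsCriticalWeight b g c) :
    ∃ C : ℝ, 0 < C ∧ ∀ᶠ n : ℕ in atTop, Real.exp (tilt b c n / 2) ≤ C * n ^ 2 := by
  obtain ⟨X, hX0, hXpos, hX⟩ := h.slowlyVarying.exists_potter
  obtain ⟨N, hN⟩ := exists_nat_ge X
  have hS := tendsto_sum_div_bigL h.slowlyVarying h.sq_eq h.intervalIntegrable h.tendsto_sum
  have hL := tendsto_bigL_atTop h.slowlyVarying h.sq_eq h.intervalIntegrable h.tendsto_sum
  set C₀ := ∑ k ∈ Finset.range N, b k ^ 2 with hC₀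
  refine ⟨2 * (4 * (4 / X ^ 2)), by positivity, ?_⟩
  filter_upwards [tilt_spec h, hS.eventually (lt_mem_nhds (show (1 / 2 : ℝ) < 1 by norm_num)),
    hL.eventually_ge_atTop (4 * C₀), eventually_ge_atTop (N + 1)] with n hn hSn hLn hnN
  obtain ⟨hg, hL0, hw, hspec⟩ := hn
  set w := tilt b c n
  have hn1 : (1 : ℝ) ≤ n := by exact_mod_cast (by omega : 1 ≤ n)
  rw [lt_div_iff₀ hL0, ← Finset.sum_range_add_sum_Ico _ (by omega : N ≤ n + 1)] at hSn
  have hIco : ∑ k ∈ Finset.Ico N (n + 1), b k ^ 2 ≤ (n + 1) * (2 * n * g n / X ^ 2) := by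
    have : ∀ k ∈ Finset.Ico N (n + 1), b k ^ 2 ≤ 2 * n * g n / X ^ 2 := by
      intro k hk
      rw [Finset.mem_Ico] at hk
      have hkX : X ≤ k := hN.trans (by exact_mod_cast hk.1)
      have hk0 := hX0.trans_le hkX
      have h1 := hX k n hkX (by exact_mod_cast (by omega : k ≤ n))
      rw [h.sq_eq k hk0, div_le_div_iff₀ hk0 (by positivity)]
      calc g k * X ^ 2 ≤ (2 * (n / k) * g n) * (k * k) := by
            gcongr
            nlinarith
        _ = 2 * n * g n * k := by field_simp
    calc _ ≤ ∑ k ∈ Finset.Ico N (n + 1), 2 * n * g n / X ^ 2 := Finset.sum_le_sum this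
      _ = (Finset.Ico N (n + 1)).card * (2 * n * g n / X ^ 2) := by
        rw [Finset.sum_const, nsmul_eq_mul]
      _ ≤ _ := by
        have : ((Finset.Ico N (n + 1)).card : ℝ) ≤ n + 1 := by
          rw [Nat.card_Ico]; exact_mod_cast Nat.sub_le _ _
        gcongr
  have hLg : bigL b c n ≤ 4 * ((n + 1) * (2 * n * g n / X ^ 2)) := by
    have : C₀ ≤ bigL b c n / 4 := by linarith
    linarith
  have hLg2 : bigL b c n ≤ 4 * (4 / X ^ 2) * n ^ 2 * g n := by
    refine hLg.trans ?_
    have : (n : ℝ) + 1 ≤ 2 * n := by linarith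
    calc 4 * (((n : ℝ) + 1) * (2 * n * g n / X ^ 2)) ≤ 4 * ((2 * n) * (2 * n * g n / X ^ 2)) := by
          gcongr
      _ = _ := by ring
  have hexp : Real.exp (w / 2) * g n ≤ 2 * bigL b c n := by
    rw [div_eq_iff hL0.ne'] at hspec
    have e1 : Real.exp (-w) = (Real.exp (w / 2))⁻¹ * (Real.exp (w / 2))⁻¹ := by
      rw [← Real.exp_neg, ← Real.exp_add]; ring_nf
    have h1 := Real.add_one_le_exp (w / 2)
    have hp := Real.exp_pos (w / 2)
    rw [hspec, e1]
    calc Real.exp (w / 2) * (w * ((Real.exp (w / 2))⁻¹ * (Real.exp (w / 2))⁻¹) * bigL b c n)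
        = (w / Real.exp (w / 2)) * bigL b c n := by field_simp
      _ ≤ 2 * bigL b c n := by
        gcongr
        rw [div_le_iff₀ hp]; linarith
  have : Real.exp (w / 2) * g n ≤ (2 * (4 * (4 / X ^ 2)) * n ^ 2) * g n := by linarith
  exact le_of_mul_le_mul_right this hg

theorem tendsto_tilt_sq_div (h : IsCriticalWeight b g c) :
    Tendsto (fun n : ℕ => tilt b c n ^ 2 / n) atTop (𝓝 0) := by
  obtain ⟨C, hC, hev⟩ := exists_exp_half_tilt_le h
  have hcast := tendsto_natCast_atTop_atTop (R := ℝ)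
  have h0 : Tendsto (fun x : ℝ => (2 * Real.log C + 4 * Real.log x) ^ 2 / x) atTop (𝓝 0) := by
    have h1 := (Real.isLittleO_pow_log_id_atTop (n := 1)).tendsto_div_nhds_zero
    have h2 := (Real.isLittleO_pow_log_id_atTop (n := 2)).tendsto_div_nhds_zero
    have h3 := ((tendsto_inv_atTop_zero.const_mul (4 * Real.log C ^ 2)).add
      (h1.const_mul (16 * Real.log C))).add (h2.const_mul 16)
    simp only [mul_zero, add_zero] at h3
    refine h3.congr fun x => ?_
    simp only [id]
    ring
  refine squeeze_zero' ?_ ?_ (h0.comp hcast)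
  · exact Eventually.of_forall fun n => by positivity
  · filter_upwards [hev, tilt_spec h, eventually_gt_atTop 0] with n hn hs hn0
    have hn' : (0 : ℝ) < n := by exact_mod_cast hn0
    have h1 := (Real.le_log_iff_exp_le (by positivity)).2 hn
    rw [Real.log_mul hC.ne' (by positivity), Real.log_pow] at h1
    push_cast at h1
    simp only [Function.comp_def]
    have := hs.2.2.1
    gcongr
    linarith

theorem tendsto_tilt_div (h : IsCriticalWeight b g c) :
    Tendsto (fun n : ℕ => tilt b c n / n) atTop (𝓝 0) := by
  refine squeeze_zero' ?_ ?_ (tendsto_tilt_sq_div h)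
  · filter_upwards [tilt_spec h] with n hn
    have := hn.2.2.1
    positivity
  · filter_upwards [tilt_spec h] with n hn
    have := hn.2.2.1
    gcongr
    nlinarith

/-- The geometric sum produced by the indices `k` close to `n`. -/
theorem tendsto_geometric (h : IsCriticalWeight b g c) :
    Tendsto (fun n : ℕ => (∑ k ∈ Finset.range (n + 1),
      g n / n * Real.exp (tilt b c n * (k / n))) / bigL b c n) atTop (𝓝 1) := by
  have hw := tendsto_tilt_div h
  have hexp : Tendsto (fun x : ℝ => x⁻¹ * (Real.exp x - 1)) (𝓝[≠] 0) (𝓝 1) := by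
    have := (Real.hasDerivAt_exp 0).tendsto_slope_zero
    simpa using this
  have hw' : Tendsto (fun n : ℕ => tilt b c n / n) atTop (𝓝[≠] 0) := by
    refine tendsto_nhdsWithin_iff.2 ⟨hw, ?_⟩
    filter_upwards [tilt_spec h, eventually_gt_atTop 0] with n hn hn0
    have h1 := hn.2.2.1
    have hn' : (0 : ℝ) < n := by exact_mod_cast hn0
    have : 0 < tilt b c n / n := by positivity
    exact this.ne'
  have h1 := (hexp.comp hw').inv₀ one_ne_zero
  have h2 := (Real.continuous_exp.tendsto 0).comp hw
  have h3 := (Real.tendsto_exp_neg_atTop_nhds_zero).comp (tendsto_tilt h)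
  have h4 := h1.mul (h2.sub h3)
  rw [Real.exp_zero, inv_one, one_mul, sub_zero] at h4
  refine h4.congr' ?_
  filter_upwards [tilt_spec h, eventually_gt_atTop 0] with n hn hn0
  obtain ⟨hg, hL, h1, hspec⟩ := hn
  have hn' : (0 : ℝ) < n := by exact_mod_cast hn0
  have hx : 0 < tilt b c n / n := by positivity
  simp only [Function.comp_def]
  set w := tilt b c n
  have hne : Real.exp (w / n) ≠ 1 := by
    rw [Ne, Real.exp_eq_one_iff]; exact hx.ne'
  have hterm : ∀ k : ℕ, Real.exp (w * (k / n)) = Real.exp (w / n) ^ k := by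
    intro k
    rw [← Real.exp_nat_mul]; congr 1; ring
  simp_rw [hterm]
  rw [← Finset.mul_sum, geom_sum_eq hne, pow_succ, ← Real.exp_nat_mul,
    mul_div_cancel₀ _ hn'.ne']
  have hsub : Real.exp (w / n) - 1 ≠ 0 := sub_ne_zero.2 hne
  have e : g n / n * ((Real.exp w * Real.exp (w / n) - 1) / (Real.exp (w / n) - 1)) / bigL b c n
    = (g n / bigL b c n) / n * ((Real.exp w * Real.exp (w / n) - 1) / (Real.exp (w / n) - 1)) := by
    ring
  rw [e, hspec, Real.exp_neg]
  have hp := (Real.exp_pos w).ne'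
  field_simp

theorem tendsto_pow_mul_exp_neg_sqrt :
    Tendsto (fun x : ℝ => 5 * x ^ 5 * Real.exp (-√x)) atTop (𝓝 0) := by
  have h1 := (Real.tendsto_pow_mul_exp_neg_atTop_nhds_zero 10).comp Real.tendsto_sqrt_atTop
  have h2 := h1.const_mul 5
  rw [mul_zero] at h2
  refine h2.congr' ?_
  filter_upwards [eventually_ge_atTop 0] with x hx
  simp only [Function.comp_def]
  rw [show √x ^ 10 = (√x ^ 2) ^ 5 by ring, Real.sq_sqrt hx]
  ring

set_option maxHeartbeats 1000000 in
/-- The pointwise comparison behind the variance asymptotics. Up to a small error, the weight is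
that of the untilted sum for `k ≤ n / w²` and that of a geometric progression for
`k > n (1 - 1 / √w)`; in between both are negligible by the Potter bound. -/
theorem eventually_tiltedWeight_sub_le (h : IsCriticalWeight b g c) (p : ℕ) {δ : ℝ} (hδ : 0 < δ) :
    ∀ᶠ n : ℕ in atTop, ∀ k ≤ n,
      |tiltedWeight b c p n k - (if p = 0 then 1 else 0) * b k ^ 2
          - g n / n * Real.exp (tilt b c n * (k / n))|
        ≤ δ * (b k ^ 2 + g n / n * Real.exp (tilt b c n * (k / n)) + bigL b c n / n) := by
  obtain ⟨X, hX0, hXpos, hX⟩ := h.slowlyVarying.exists_potter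
  have hcast := tendsto_natCast_atTop_atTop (R := ℝ)
  have hw := tendsto_tilt h
  -- a neighbourhood of `(1, 1)` on which `r * s ^ p / s` is close to `1`
  have hcont : ContinuousAt (fun q : ℝ × ℝ => q.1 * q.2 ^ p / q.2) (1, 1) := by
    fun_prop (disch := simp)
  have hnear := hcont.eventually (Metric.closedBall_mem_nhds _ hδ)
  obtain ⟨η, hη, hball⟩ := Metric.eventually_nhds_iff.1 hnear
  obtain ⟨X₂, hX₂⟩ := (h.slowlyVarying.eventually_ratio 2
    (show 0 < min (η / 4) (1 / 2) by positivity)).exists_forall_of_atTop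
  have hw1 : ∀ᶠ n : ℕ in atTop, Real.exp (1 / tilt b c n) - 1 ≤ δ := by
    have h0 : Tendsto (fun n => 1 / tilt b c n) atTop (𝓝 0) := by
      simp_rw [one_div]
      exact tendsto_inv_atTop_zero.comp hw
    have h1 : Tendsto (fun n => Real.exp (1 / tilt b c n) - 1) atTop (𝓝 (Real.exp 0 - 1)) :=
      ((Real.continuous_exp.tendsto 0).comp h0).sub_const 1
    rw [Real.exp_zero, sub_self] at h1
    exact (h1.eventually (gt_mem_nhds hδ)).mono fun n hn => hn.le
  have hw2 : ∀ᶠ n : ℕ in atTop, Real.exp 1 * (1 / tilt b c n ^ 2) ≤ δ := by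
    have h1 := ((tendsto_inv_atTop_zero.comp hw).pow 2).const_mul (Real.exp 1)
    simp only [Function.comp_def, ne_eq, OfNat.ofNat_ne_zero, not_false_eq_true, zero_pow,
      mul_zero] at h1
    refine (h1.eventually (gt_mem_nhds hδ)).mono fun n hn => ?_
    rw [one_div, ← inv_pow]; exact hn.le
  have hw3 := (tendsto_pow_mul_exp_neg_sqrt.comp hw).eventually (gt_mem_nhds hδ)
  have hw4 : ∀ᶠ n : ℕ in atTop, 1 / √(tilt b c n) < min (η / 2) (1 / 2) := by
    have h1 := tendsto_inv_atTop_zero.comp (Real.tendsto_sqrt_atTop.comp hw)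
    refine (h1.eventually (gt_mem_nhds (show 0 < min (η / 2) (1 / 2) by positivity))).mono
      fun n hn => ?_
    rw [one_div]; exact hn
  have hw5 : ∀ᶠ n : ℕ in atTop, g n / bigL b c n < δ / Real.exp 1 :=
    ((tendsto_div_bigL h.slowlyVarying h.sq_eq h.intervalIntegrable).comp hcast).eventually
      (gt_mem_nhds (by positivity))
  have hw6 : ∀ᶠ n : ℕ in atTop, tilt b c n ^ 2 / n < 1 / X :=
    (tendsto_tilt_sq_div h).eventually (gt_mem_nhds (by positivity))
  filter_upwards [tilt_spec h, hw1, hw2, hw3, hw4, hw5, hw6,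
    hcast.eventually_ge_atTop (2 * max X₂ 1), eventually_gt_atTop 0]
    with n hn hw1 hw2 hw3 hw4 hw5 hw6 hnX₂ hn0 k hk
  obtain ⟨hg, hL, h1, hspec⟩ := hn
  have hn' : (0 : ℝ) < n := by exact_mod_cast hn0
  set w := tilt b c n
  set L := bigL b c n
  have hw0 : 0 < w := by linarith
  have hgL : g n = w * Real.exp (-w) * L := by rwa [div_eq_iff hL.ne'] at hspec
  set s : ℝ := (k : ℝ) / n with hs
  have hs0 : 0 ≤ s := by positivity
  have hs1 : s ≤ 1 := by rw [hs, div_le_one hn']; exact_mod_cast hk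
  set E := Real.exp (w * s) with hE
  have hE0 : 0 < E := Real.exp_pos _
  have hT : tiltedWeight b c p n k = b k ^ 2 * E * s ^ p := rfl
  set f := b k ^ 2 with hf
  have hf0 : 0 ≤ f := sq_nonneg _
  have hsp0 : 0 ≤ s ^ p := by positivity
  have hsp1 : s ^ p ≤ 1 := pow_le_one₀ hs0 hs1
  rw [hT]
  rcases le_or_gt s (1 / w ^ 2) with hA | hA
  · -- small `k`
    have hws : w * s ≤ 1 / w := by
      calc w * s ≤ w * (1 / w ^ 2) := by gcongr
        _ = 1 / w := by field_simp
    have hw1' : 1 / w ≤ 1 := by rw [div_le_one hw0]; exact h1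
    have hE1 : 1 ≤ E := Real.one_le_exp (by positivity)
    have hEle : E ≤ Real.exp (1 / w) := Real.exp_le_exp.2 hws
    have hEe : E ≤ Real.exp 1 := Real.exp_le_exp.2 (hws.trans hw1')
    have hmain : |E * s ^ p - (if p = 0 then 1 else 0)| ≤ δ := by
      split_ifs with hp
      · subst hp
        rw [pow_zero, mul_one, abs_of_nonneg (by linarith)]
        linarith
      · rw [sub_zero, abs_of_nonneg (by positivity)]
        calc E * s ^ p ≤ Real.exp 1 * s := by
              gcongr
              exact pow_le_of_le_one hs0 hs1 hp
          _ ≤ Real.exp 1 * (1 / w ^ 2) := by gcongr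
          _ ≤ δ := hw2
    have hgE : g n / n * E ≤ δ * (L / n) := by
      rw [div_lt_iff₀ hL, div_mul_eq_mul_div, lt_div_iff₀ (Real.exp_pos 1)] at hw5
      calc g n / n * E ≤ g n / n * Real.exp 1 := by gcongr
        _ = g n * Real.exp 1 / n := by ring
        _ ≤ δ * L / n := by gcongr
        _ = δ * (L / n) := by ring
    have hgE0 : 0 ≤ g n / n * E := by positivity
    calc |f * E * s ^ p - (if p = 0 then 1 else 0) * f - g n / n * E|
        = |f * (E * s ^ p - (if p = 0 then 1 else 0)) - g n / n * E| := by ring_nf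
      _ ≤ |f * (E * s ^ p - (if p = 0 then 1 else 0))| + |g n / n * E| := abs_sub _ _
      _ ≤ f * δ + δ * (L / n) := by
        rw [abs_mul, abs_of_nonneg hf0, abs_of_nonneg hgE0]
        gcongr
      _ ≤ _ := by nlinarith [mul_nonneg hδ.le hgE0]
  · have hkn : n / w ^ 2 < k := by
      rw [hs, lt_div_iff₀ hn'] at hA
      rwa [one_div_mul_eq_div] at hA
    have hXk : X ≤ k := by
      rw [div_lt_div_iff₀ hn' hX0] at hw6
      have : X ≤ n / w ^ 2 := by rw [le_div_iff₀ (by positivity)]; linarith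
      linarith
    have hk0 := hX0.trans_le hXk
    have hs0' : 0 < s := by positivity
    have hpot := hX k n hXk (by exact_mod_cast hk)
    have hfs : f = g k / n / s := by
      rw [hf, h.sq_eq k hk0, hs]; field_simp
    have hfle : f ≤ 2 * w ^ 4 * g n / n := by
      have e1 : (n : ℝ) / k = 1 / s := by rw [hs]; field_simp
      rw [e1] at hpot
      have e2 : 1 / s ≤ w ^ 2 := by
        rw [div_le_iff₀ hs0']
        rw [div_lt_iff₀ (by positivity)] at hA
        linarith
      calc f = g k / n * (1 / s) := by rw [hfs]; ring
        _ ≤ (2 * (1 / s) * g n) / n * (1 / s) := by gcongr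
        _ ≤ (2 * w ^ 2 * g n) / n * w ^ 2 := by gcongr
        _ = _ := by ring
    have hsqw : √w ≤ w := by
      rw [Real.sqrt_le_left hw0.le]; nlinarith
    have hsmall : 5 * w ^ 5 * Real.exp (-√w) ≤ δ := hw3.le
    have hfL : f ≤ 2 * w ^ 5 * Real.exp (-w) * (L / n) := by
      refine hfle.trans (le_of_eq ?_)
      rw [hgL]; ring
    have hexpw : Real.exp (-w) ≤ Real.exp (-√w) := Real.exp_le_exp.2 (by linarith)
    have hLn : 0 ≤ L / n := by positivity
    have hifle : |(if p = 0 then (1 : ℝ) else 0) * f| ≤ 2 * w ^ 5 * Real.exp (-√w) * (L / n) := by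
      rw [abs_mul, abs_of_nonneg hf0]
      calc _ ≤ 1 * f := by
            gcongr
            split_ifs <;> simp
        _ ≤ 2 * w ^ 5 * Real.exp (-w) * (L / n) := by rw [one_mul]; exact hfL
        _ ≤ _ := by gcongr
    rcases le_or_gt s (1 - 1 / √w) with hB | hB
    · -- intermediate `k`
      have hEw : Real.exp (-w) * E ≤ Real.exp (-√w) := by
        rw [hE, ← Real.exp_add]
        apply Real.exp_le_exp.2
        have : w * s ≤ w * (1 - 1 / √w) := by gcongr
        have e : w * (1 / √w) = √w := by
          rw [mul_one_div]; exact Real.div_sqrt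
        nlinarith
      have hb1 : |f * E * s ^ p| ≤ 2 * w ^ 5 * Real.exp (-√w) * (L / n) := by
        rw [abs_of_nonneg (by positivity)]
        calc f * E * s ^ p ≤ (2 * w ^ 5 * Real.exp (-w) * (L / n)) * E * 1 := by gcongr
          _ = 2 * w ^ 5 * (Real.exp (-w) * E) * (L / n) := by ring
          _ ≤ _ := by gcongr
      have hb2 : |g n / n * E| ≤ w ^ 5 * Real.exp (-√w) * (L / n) := by
        rw [abs_of_nonneg (by positivity)]
        calc g n / n * E = w * (Real.exp (-w) * E) * (L / n) := by rw [hgL]; ring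
          _ ≤ w ^ 5 * Real.exp (-√w) * (L / n) := by
            gcongr
            exact le_self_pow₀ h1 (by norm_num)
      calc |f * E * s ^ p - (if p = 0 then 1 else 0) * f - g n / n * E|
          ≤ |f * E * s ^ p| + |(if p = 0 then 1 else 0) * f| + |g n / n * E| :=
            (abs_sub _ _).trans (by gcongr; exact abs_sub _ _)
        _ ≤ (5 * w ^ 5 * Real.exp (-√w)) * (L / n) := by linarith
        _ ≤ δ * (L / n) := by gcongr
        _ ≤ _ := by
          gcongr
          have : 0 ≤ g n / n * E := by positivity
          linarith
    · -- `k` close to `n`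
      have hsη : |s - 1| < η := by
        rw [abs_sub_comm, abs_of_nonneg (by linarith)]
        have := lt_min_iff.1 hw4
        linarith [this.1]
      have hs2 : 1 / 2 < s := by
        have := (lt_min_iff.1 hw4).2
        linarith
      have hkn2 : (n : ℝ) ≤ 2 * k := by
        rw [hs, lt_div_iff₀ hn'] at hs2; linarith
      have hgk : 0 < g k := hXpos k hXk
      have hX₂k : X₂ ≤ k := by
        have := le_max_left X₂ 1
        linarith
      have hrat := hX₂ k hX₂k n (by exact_mod_cast hk) hkn2
      have hrat1 := abs_le.1 (hrat.trans (min_le_right _ _))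
      have hrat2 := hrat.trans (min_le_left _ _)
      have hr : |g k / g n - 1| < η := by
        have e : g k / g n - 1 = -(g n / g k - 1) * (g k / g n) := by field_simp; ring
        have h2 : g k / g n ≤ 2 := by
          rw [div_le_iff₀ hg]
          have : 1 / 2 ≤ g n / g k := by linarith
          rw [le_div_iff₀ hgk] at this
          linarith
        rw [e, abs_mul, abs_neg, abs_of_nonneg (show 0 ≤ g k / g n by positivity)]
        calc _ ≤ η / 4 * 2 := by gcongr
          _ < η := by linarith
      have hnear' := hball (y := (g k / g n, s)) (by
        rw [Prod.dist_eq]; exact max_lt hr hsη)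
      simp only [Real.dist_eq, one_pow, mul_one, div_one] at hnear'
      have e1 : f * E * s ^ p = (g n / n * E) * (g k / g n * s ^ p / s) := by
        rw [hfs]; field_simp
      have hgE0 : 0 ≤ g n / n * E := by positivity
      have hw5' : 2 * w ^ 5 * Real.exp (-√w) ≤ δ := by
        have : 0 ≤ w ^ 5 * Real.exp (-√w) := by positivity
        linarith
      calc |f * E * s ^ p - (if p = 0 then 1 else 0) * f - g n / n * E|
          = |(g n / n * E) * (g k / g n * s ^ p / s - 1) - (if p = 0 then 1 else 0) * f| := by
            rw [e1]; ring_nf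
        _ ≤ |(g n / n * E) * (g k / g n * s ^ p / s - 1)| + |(if p = 0 then 1 else 0) * f| :=
            abs_sub _ _
        _ ≤ (g n / n * E) * δ + δ * (L / n) := by
            rw [abs_mul, abs_of_nonneg hgE0]
            gcongr
            exact hifle.trans (by gcongr)
        _ ≤ _ := by nlinarith [mul_nonneg hδ.le hf0]

end Tilt

section TiltedSums

variable {b g : ℝ → ℝ} {c : ℝ}

/-- The total tilted weight is asymptotic to `L(n)` for `p ≥ 1`, and to `2 L(n)` for `p = 0`: one
unit comes from the indices close to `n`, the other one, for `p = 0` only, from those which are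
`o(n)`. -/
theorem tendsto_sum_tiltedWeight (h : IsCriticalWeight b g c) (p : ℕ) :
    Tendsto (fun n : ℕ => (∑ k ∈ Finset.range (n + 1), tiltedWeight b c p n k) / bigL b c n) atTop
      (𝓝 ((if p = 0 then 1 else 0) + 1)) := by
  have hS := tendsto_sum_div_bigL h.slowlyVarying h.sq_eq h.intervalIntegrable h.tendsto_sum
  have hG := tendsto_geometric h
  set ind : ℝ := if p = 0 then 1 else 0 with hind
  set T : ℕ → ℝ := fun n => ∑ k ∈ Finset.range (n + 1), tiltedWeight b c p n k
  set S : ℕ → ℝ := fun n => ∑ k ∈ Finset.range (n + 1), b k ^ 2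
  set G : ℕ → ℝ := fun n => ∑ k ∈ Finset.range (n + 1),
    g n / n * Real.exp (tilt b c n * (k / n))
  have hdiff : Tendsto (fun n : ℕ => (T n - ind * S n - G n) / bigL b c n) atTop (𝓝 0) := by
    rw [Metric.tendsto_nhds]
    intro ε hε
    filter_upwards [eventually_tiltedWeight_sub_le h p (δ := ε / 8) (by positivity), tilt_spec h,
      hS.eventually (gt_mem_nhds one_lt_two), hG.eventually (gt_mem_nhds one_lt_two),
      eventually_gt_atTop 0] with n hn hs hS2 hG2 hn0
    obtain ⟨hg, hL, h1, hspec⟩ := hs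
    have hn' : (1 : ℝ) ≤ n := by exact_mod_cast hn0
    rw [div_lt_iff₀ hL] at hS2 hG2
    rw [Real.dist_eq, sub_zero, abs_div, abs_of_pos hL, div_lt_iff₀ hL]
    have e : T n - ind * S n - G n = ∑ k ∈ Finset.range (n + 1), (tiltedWeight b c p n k
        - ind * b k ^ 2 - g n / n * Real.exp (tilt b c n * (k / n))) := by
      simp only [T, S, G, Finset.sum_sub_distrib, Finset.mul_sum]
    rw [e]
    calc _ ≤ ∑ k ∈ Finset.range (n + 1), ε / 8 * (b k ^ 2
          + g n / n * Real.exp (tilt b c n * (k / n)) + bigL b c n / n) :=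
          (Finset.abs_sum_le_sum_abs _ _).trans (Finset.sum_le_sum fun k hk =>
            hn k (Nat.lt_succ_iff.1 (Finset.mem_range.1 hk)))
      _ = ε / 8 * (S n + G n + (n + 1) / n * bigL b c n) := by
          simp only [S, G]
          rw [← Finset.mul_sum, Finset.sum_add_distrib, Finset.sum_add_distrib, Finset.sum_const,
            Finset.card_range, nsmul_eq_mul]
          push_cast
          ring
      _ < ε * bigL b c n := by
          have : ((n : ℝ) + 1) / n ≤ 2 := by rw [div_le_iff₀ (by linarith)]; linarith
          have : ((n : ℝ) + 1) / n * bigL b c n ≤ 2 * bigL b c n := by gcongr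
          have : S n + G n + (n + 1) / n * bigL b c n < 6 * bigL b c n := by linarith
          calc _ < ε / 8 * (6 * bigL b c n) := by gcongr
            _ ≤ ε * bigL b c n := by nlinarith [mul_pos hε hL]
  have := (hdiff.add (hS.const_mul ind)).add hG
  rw [zero_add, mul_one] at this
  refine this.congr fun n => ?_
  ring

/-- For fixed `k`, the tilted weight is bounded in `n`. -/
theorem eventually_tiltedWeight_le (h : IsCriticalWeight b g c) (p k : ℕ) :
    ∀ᶠ n : ℕ in atTop, tiltedWeight b c p n k ≤ 3 * b k ^ 2 := by
  have h1 : Tendsto (fun n : ℕ => Real.exp (tilt b c n * (k / n))) atTop (𝓝 (Real.exp 0)) := by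
    refine (Real.continuous_exp.tendsto 0).comp ?_
    have := (tendsto_tilt_div h).mul_const (k : ℝ)
    rw [zero_mul] at this
    exact this.congr fun n => by ring
  rw [Real.exp_zero] at h1
  filter_upwards [h1.eventually (gt_mem_nhds (show (1 : ℝ) < 3 by norm_num)),
    eventually_ge_atTop k, eventually_gt_atTop 0] with n hn hk hn0
  have hn' : (0 : ℝ) < n := by exact_mod_cast hn0
  have hkn : (k : ℝ) / n ≤ 1 := by rw [div_le_one hn']; exact_mod_cast hk
  unfold tiltedWeight
  calc b k ^ 2 * Real.exp (tilt b c n * (k / n)) * ((k : ℝ) / n) ^ p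
      ≤ b k ^ 2 * 3 * 1 := by
        gcongr
        exact pow_le_one₀ (by positivity) hkn
    _ = _ := by ring

/-- The tilted weights vary slowly in `k`: their total variation is `o(L(n))`. -/
theorem tendsto_variation_tiltedWeight (h : IsCriticalWeight b g c) (p : ℕ) :
    Tendsto (fun n : ℕ => (∑ k ∈ Finset.range n,
      |tiltedWeight b c p n (k + 1) - tiltedWeight b c p n k|) / bigL b c n) atTop (𝓝 0) := by
  rw [Metric.tendsto_nhds]
  intro ε hε
  have hcast := tendsto_natCast_atTop_atTop (R := ℝ)
  have hL := tendsto_bigL_atTop h.slowlyVarying h.sq_eq h.intervalIntegrable h.tendsto_sum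
  have hT := tendsto_sum_tiltedWeight h p
  have hT3 : ∀ᶠ n : ℕ in atTop,
      (∑ k ∈ Finset.range (n + 1), tiltedWeight b c p n k) / bigL b c n < 3 :=
    hT.eventually (gt_mem_nhds (by split_ifs <;> norm_num))
  -- the ratio of consecutive weights is close to `1`, uniformly
  have hratio : ∃ K : ℕ, ∀ᶠ n : ℕ in atTop, ∀ k, K ≤ k →
      |tiltedWeight b c p n (k + 1) - tiltedWeight b c p n k|
        ≤ ε / 6 * tiltedWeight b c p n k := by
    have hlim : Tendsto (fun q : ℕ × ℕ => b (q.2 + 1 : ℕ) ^ 2 / b q.2 ^ 2 *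
        Real.exp (tilt b c q.1 / q.1) * (((q.2 + 1 : ℕ) : ℝ) / q.2) ^ p) (atTop ×ˢ atTop)
        (𝓝 (1 * Real.exp 0 * 1 ^ p)) := by
      refine (((tendsto_nat_sq_ratio h.slowlyVarying h.sq_eq).comp tendsto_snd).mul
        (((Real.continuous_exp.tendsto 0).comp (tendsto_tilt_div h)).comp tendsto_fst)).mul
        (Tendsto.pow ?_ p)
      have h1 : Tendsto (fun k : ℕ => ((k + 1 : ℕ) : ℝ) / k) atTop (𝓝 1) := by
        have := tendsto_one_div_atTop_nhds_zero_nat (𝕜 := ℝ) |>.const_add 1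
        rw [add_zero] at this
        refine this.congr' ?_
        filter_upwards [eventually_gt_atTop 0] with k hk
        have hk' : (k : ℝ) ≠ 0 := by exact_mod_cast hk.ne'
        push_cast
        field_simp
      exact h1.comp tendsto_snd
    rw [Real.exp_zero, one_pow, one_mul, one_mul] at hlim
    have hev := hlim.eventually (Metric.closedBall_mem_nhds 1 (show 0 < ε / 6 by positivity))
    obtain ⟨pa, hpa, pb, hpb, hab⟩ := eventually_prod_iff.1 hev
    obtain ⟨K, hK⟩ := ((hpb.and (eventually_nat_sq_pos h.slowlyVarying h.sq_eq)).and
      (eventually_gt_atTop 0)).exists_forall_of_atTop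
    refine ⟨K, ?_⟩
    filter_upwards [hpa, eventually_gt_atTop 0] with n hn hn0 k hk
    have h1 := hab hn (hK k hk).1.1
    have hb0 := (hK k hk).1.2
    have hk0 : (k : ℝ) ≠ 0 := by exact_mod_cast (hK k hk).2.ne'
    have hn' : (n : ℝ) ≠ 0 := by exact_mod_cast hn0.ne'
    have hbk : b k ≠ 0 := fun h0 => by simp [h0] at hb0
    rw [Real.dist_eq] at h1
    have e : tiltedWeight b c p n (k + 1) = (b (k + 1 : ℕ) ^ 2 / b k ^ 2 *
        Real.exp (tilt b c n / n) * (((k + 1 : ℕ) : ℝ) / k) ^ p) * tiltedWeight b c p n k := by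
      unfold tiltedWeight
      rw [show tilt b c n * (((k + 1 : ℕ) : ℝ) / n) = tilt b c n / n + tilt b c n * (k / n) by
        push_cast; ring, Real.exp_add,
        show ((k + 1 : ℕ) : ℝ) / n = ((k + 1 : ℕ) : ℝ) / k * (k / n) by field_simp, mul_pow]
      field_simp
    have hnn := tiltedWeight_nonneg b c p n k
    rw [e, ← sub_one_mul, abs_mul, abs_of_nonneg hnn]
    gcongr
  obtain ⟨K, hK⟩ := hratio
  have hsmall : ∀ᶠ n : ℕ in atTop, ∀ k ∈ Finset.range (K + 1),
      tiltedWeight b c p n k ≤ 3 * b k ^ 2 :=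
    (Finset.eventually_all _).2 fun k _ => eventually_tiltedWeight_le h p k
  set C := ∑ k ∈ Finset.range K, (3 * b (k + 1 : ℕ) ^ 2 + 3 * b k ^ 2) with hC
  filter_upwards [hK, hsmall, hT3, hL.eventually_gt_atTop 0, hL.eventually_gt_atTop (4 * C / ε),
    eventually_ge_atTop K] with n hn hs hT hL0 hLC hKn
  have hvn : 0 ≤ ∑ k ∈ Finset.range n,
      |tiltedWeight b c p n (k + 1) - tiltedWeight b c p n k| :=
    Finset.sum_nonneg fun _ _ => abs_nonneg _
  rw [Real.dist_eq, sub_zero, abs_of_nonneg (div_nonneg hvn hL0.le), div_lt_iff₀ hL0,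
    ← Finset.sum_range_add_sum_Ico _ hKn]
  have h1 : ∑ k ∈ Finset.range K, |tiltedWeight b c p n (k + 1) - tiltedWeight b c p n k| ≤ C := by
    refine Finset.sum_le_sum fun k hk => ?_
    rw [Finset.mem_range] at hk
    refine (abs_sub _ _).trans ?_
    rw [abs_of_nonneg (tiltedWeight_nonneg b c p n _), abs_of_nonneg (tiltedWeight_nonneg b c p n _)]
    exact add_le_add (hs (k + 1) (Finset.mem_range.2 (by omega)))
      (hs k (Finset.mem_range.2 (by omega)))
  have h2 : ∑ k ∈ Finset.Ico K n, |tiltedWeight b c p n (k + 1) - tiltedWeight b c p n k|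
      ≤ ε / 6 * ∑ k ∈ Finset.range (n + 1), tiltedWeight b c p n k := by
    rw [Finset.mul_sum]
    refine (Finset.sum_le_sum fun k hk => hn k (Finset.mem_Ico.1 hk).1).trans ?_
    refine Finset.sum_le_sum_of_subset_of_nonneg ?_ fun k _ _ =>
      mul_nonneg (by positivity) (tiltedWeight_nonneg b c p n k)
    intro k hk
    rw [Finset.mem_Ico] at hk
    exact Finset.mem_range.2 (by omega)
  rw [div_lt_iff₀ hL0] at hT
  rw [div_lt_iff₀ hε] at hLC
  have h3 : ε / 6 * ∑ k ∈ Finset.range (n + 1), tiltedWeight b c p n k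
      ≤ ε / 6 * (3 * bigL b c n) := by gcongr
  nlinarith

theorem tiltedWeight_le_add_variation (p n k : ℕ) (hk : k ≤ n) :
    tiltedWeight b c p n k ≤ tiltedWeight b c p n 0 + ∑ j ∈ Finset.range n,
      |tiltedWeight b c p n (j + 1) - tiltedWeight b c p n j| := by
  have h1 := Finset.sum_range_sub (tiltedWeight b c p n) k
  have h2 : ∑ j ∈ Finset.range k, (tiltedWeight b c p n (j + 1) - tiltedWeight b c p n j)
      ≤ ∑ j ∈ Finset.range n, |tiltedWeight b c p n (j + 1) - tiltedWeight b c p n j| :=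
    (Finset.sum_le_sum fun j _ => le_abs_self _).trans
      (Finset.sum_le_sum_of_subset_of_nonneg (Finset.range_mono hk) fun _ _ _ => abs_nonneg _)
  linarith

/-- No single weight contributes on the scale `L(n)`. -/
theorem eventually_tiltedWeight_le_mul_bigL (h : IsCriticalWeight b g c) (p : ℕ) {ε : ℝ}
    (hε : 0 < ε) :
    ∀ᶠ n : ℕ in atTop, ∀ k ≤ n, tiltedWeight b c p n k ≤ ε * bigL b c n := by
  have hL := tendsto_bigL_atTop h.slowlyVarying h.sq_eq h.intervalIntegrable h.tendsto_sum
  filter_upwards [(tendsto_variation_tiltedWeight h p).eventually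
    (gt_mem_nhds (half_pos hε)), eventually_tiltedWeight_le h p 0, hL.eventually_gt_atTop 0,
    hL.eventually_gt_atTop (3 * b (0 : ℕ) ^ 2 / (ε / 2))] with n hV h0 hL0 hLC k hk
  rw [div_lt_iff₀ hL0] at hV
  rw [div_lt_iff₀ (half_pos hε)] at hLC
  have h1 := tiltedWeight_le_add_variation (b := b) (c := c) p n k hk
  have h2 := h0.trans hLC.le
  linarith

/-- Summation by parts: `(1 - z) ∑ a_k z^k` is bounded by the boundary terms and the variation. -/
theorem norm_one_sub_mul_sum_le (a : ℕ → ℝ) {z : ℂ} (hz : ‖z‖ = 1) (n : ℕ) :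
    ‖(1 - z) * ∑ k ∈ Finset.range (n + 1), (a k : ℂ) * z ^ k‖
      ≤ |a 0| + |a n| + ∑ k ∈ Finset.range n, |a (k + 1) - a k| := by
  have e : (1 - z) * ∑ k ∈ Finset.range (n + 1), (a k : ℂ) * z ^ k
      = a 0 - a n * z ^ (n + 1)
        + ∑ k ∈ Finset.range n, ((a (k + 1) - a k : ℝ) : ℂ) * z ^ (k + 1) := by
    induction n with
    | zero => simp; ring
    | succ n ih =>
      rw [Finset.sum_range_succ, mul_add, ih, Finset.sum_range_succ _ n]
      push_cast
      ring
  rw [e]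
  refine (norm_add_le _ _).trans (add_le_add ((norm_sub_le _ _).trans ?_)
    ((norm_sum_le _ _).trans ?_))
  · simp [hz]
  · refine Finset.sum_le_sum fun k _ => ?_
    rw [norm_mul, norm_pow, hz, one_pow, mul_one, Complex.norm_real, Real.norm_eq_abs]

open Classical in
/-- Asymptotics of the oscillating sums that make up the covariances: resonance at
`θ ∈ 2πℤ`, and cancellation otherwise. -/
theorem tendsto_oscillating_sum (h : IsCriticalWeight b g c) (p : ℕ) (θ : ℝ) :
    Tendsto (fun n : ℕ => (∑ k ∈ Finset.range (n + 1),
        (tiltedWeight b c p n k : ℂ) * Complex.exp (Complex.I * θ) ^ k) / (bigL b c n : ℂ)) atTop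
      (𝓝 (if ∃ j : ℤ, θ = 2 * Real.pi * j then ((if p = 0 then 1 else 0) + 1 : ℂ) else 0)) := by
  by_cases hθ : ∃ j : ℤ, θ = 2 * Real.pi * j
  · rw [if_pos hθ]
    obtain ⟨j, rfl⟩ := hθ
    have hz : Complex.exp (Complex.I * ((2 * Real.pi * j : ℝ) : ℂ)) = 1 := by
      rw [Complex.exp_eq_one_iff]
      exact ⟨j, by push_cast; ring⟩
    have h1 := (Complex.continuous_ofReal.tendsto _).comp (tendsto_sum_tiltedWeight h p)
    simp only [hz, one_pow, mul_one]
    convert h1 using 2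
    · simp
    · split_ifs <;> simp
  · rw [if_neg hθ]
    have hne : Complex.exp (Complex.I * θ) ≠ 1 := by
      intro h1
      rw [Complex.exp_eq_one_iff] at h1
      obtain ⟨j, hj⟩ := h1
      refine hθ ⟨j, ?_⟩
      have h2 := congrArg Complex.im hj
      simpa [mul_comm] using h2
    have hnorm : ‖Complex.exp (Complex.I * θ)‖ = 1 := by
      rw [mul_comm]; exact Complex.norm_exp_ofReal_mul_I θ
    set z := Complex.exp (Complex.I * θ)
    have hz0 : 0 < ‖1 - z‖ := norm_pos_iff.2 (sub_ne_zero.2 hne.symm)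
    have hL := tendsto_bigL_atTop h.slowlyVarying h.sq_eq h.intervalIntegrable h.tendsto_sum
    rw [Metric.tendsto_nhds]
    intro ε hε
    filter_upwards [(tendsto_variation_tiltedWeight h p).eventually
      (gt_mem_nhds (show 0 < ε * ‖1 - z‖ / 4 by positivity)),
      eventually_tiltedWeight_le_mul_bigL h p (show 0 < ε * ‖1 - z‖ / 4 by positivity),
      hL.eventually_gt_atTop 0] with n hV hmax hL0
    have h1 := norm_one_sub_mul_sum_le (tiltedWeight b c p n) hnorm n
    rw [norm_mul, abs_of_nonneg (tiltedWeight_nonneg b c p n _),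
      abs_of_nonneg (tiltedWeight_nonneg b c p n _)] at h1
    rw [div_lt_iff₀ hL0] at hV
    have h2 := hmax 0 (Nat.zero_le n)
    have h3 := hmax n le_rfl
    rw [dist_zero_right, norm_div, Complex.norm_real, Real.norm_of_nonneg hL0.le,
      div_lt_iff₀ hL0]
    have h4 : ‖1 - z‖ * ‖∑ k ∈ Finset.range (n + 1), (tiltedWeight b c p n k : ℂ) * z ^ k‖
        < ‖1 - z‖ * (ε * bigL b c n) := by
      nlinarith [mul_pos (mul_pos hε hz0) hL0]
    exact lt_of_mul_lt_mul_left h4 hz0.le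

end TiltedSums

/-! ### A central limit theorem for weighted sums -/

theorem norm_prod_sub_prod_le {ι : Type*} (s : Finset ι) (x y : ι → ℂ)
    (hx : ∀ i ∈ s, ‖x i‖ ≤ 1) (hy : ∀ i ∈ s, ‖y i‖ ≤ 1) :
    ‖∏ i ∈ s, x i - ∏ i ∈ s, y i‖ ≤ ∑ i ∈ s, ‖x i - y i‖ := by
  classical
  induction s using Finset.induction_on with
  | empty => simp
  | insert a s ha ih =>
    have ih' := ih (fun i hi => hx i (Finset.mem_insert_of_mem hi))
      (fun i hi => hy i (Finset.mem_insert_of_mem hi))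
    have hxs : ‖∏ i ∈ s, x i‖ ≤ 1 := by
      rw [norm_prod]
      exact Finset.prod_le_one (fun _ _ => norm_nonneg _)
        fun i hi => hx i (Finset.mem_insert_of_mem hi)
    rw [Finset.prod_insert ha, Finset.prod_insert ha, Finset.sum_insert ha]
    calc ‖x a * ∏ i ∈ s, x i - y a * ∏ i ∈ s, y i‖
        = ‖(x a - y a) * ∏ i ∈ s, x i + y a * (∏ i ∈ s, x i - ∏ i ∈ s, y i)‖ := by
          congr 1; ring
      _ ≤ ‖x a - y a‖ * ‖∏ i ∈ s, x i‖ + ‖y a‖ * ‖∏ i ∈ s, x i - ∏ i ∈ s, y i‖ := by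
          refine (norm_add_le _ _).trans ?_
          rw [norm_mul, norm_mul]
      _ ≤ ‖x a - y a‖ * 1 + 1 * ∑ i ∈ s, ‖x i - y i‖ := by
          gcongr
          exact hy a (Finset.mem_insert_self a s)
      _ = _ := by ring

theorem norm_exp_I_mul_sub_le (x : ℝ) :
    ‖Complex.exp (x * Complex.I) - (1 + x * Complex.I - x ^ 2 / 2)‖ ≤ 4 * x ^ 2 * min |x| 1 := by
  have hnx : ‖(x : ℂ) * Complex.I‖ = |x| := by simp
  rcases le_total |x| 1 with h | h
  · have h1 := Complex.norm_exp_sub_sum_le_norm_mul_exp (x * Complex.I) 3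
    rw [hnx] at h1
    have e : ∑ m ∈ Finset.range 3, ((x : ℂ) * Complex.I) ^ m / m.factorial
        = 1 + x * Complex.I - x ^ 2 / 2 := by
      simp [Finset.sum_range_succ, Nat.factorial, mul_pow]
      ring
    rw [e] at h1
    refine h1.trans ?_
    rw [min_eq_left h]
    have h2 : Real.exp |x| ≤ 4 := by
      have := Real.exp_le_exp.2 h
      have := Real.exp_one_lt_d9
      linarith
    calc |x| ^ 3 * Real.exp |x| ≤ |x| ^ 3 * 4 := by gcongr
      _ = 4 * |x| ^ 2 * |x| := by ring
      _ = _ := by rw [sq_abs]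
  · rw [min_eq_right h, mul_one]
    have h1 : ‖Complex.exp (x * Complex.I)‖ = 1 := Complex.norm_exp_ofReal_mul_I x
    have h2 : ‖(1 : ℂ) + x * Complex.I - x ^ 2 / 2‖ ≤ 1 + |x| + |x| ^ 2 / 2 := by
      refine (norm_sub_le _ _).trans (add_le_add ((norm_add_le _ _).trans (by simp)) ?_)
      simp
    refine (norm_sub_le _ _).trans ?_
    rw [h1, ← sq_abs x]
    nlinarith

section CLT

variable {Ω : Type*} [MeasurableSpace Ω] {P : Measure Ω} [IsProbabilityMeasure P] {X : Ω → ℂ}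

/-- The truncated second moment `E[|X|² min(t |X|, 1)]`. -/
noncomputable def truncatedMoment (P : Measure Ω) (X : Ω → ℂ) (t : ℝ) : ℝ :=
  ∫ ω, ‖X ω‖ ^ 2 * min (t * ‖X ω‖) 1 ∂P

omit [IsProbabilityMeasure P] in
theorem integrable_truncated (hX : MemLp X 2 P) {t : ℝ} (ht : 0 ≤ t) :
    Integrable (fun ω => ‖X ω‖ ^ 2 * min (t * ‖X ω‖) 1) P := by
  have hm := hX.aestronglyMeasurable.norm
  refine hX.norm.integrable_sq.mono ?_ (ae_of_all _ fun ω => ?_)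
  · exact (hm.pow 2).mul ((hm.const_mul t).inf aestronglyMeasurable_const)
  · have h0 : 0 ≤ min (t * ‖X ω‖) 1 := le_min (by positivity) zero_le_one
    rw [norm_mul, Real.norm_of_nonneg h0]
    exact mul_le_of_le_one_right (norm_nonneg _) (min_le_right _ _)

omit [IsProbabilityMeasure P] in
theorem tendsto_truncatedMoment (hX : MemLp X 2 P) :
    Tendsto (truncatedMoment P X) (𝓝[≥] 0) (𝓝 0) := by
  have hm := hX.aestronglyMeasurable.norm
  have := tendsto_integral_filter_of_dominated_convergence (μ := P) (l := 𝓝[≥] (0 : ℝ))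
    (F := fun t ω => ‖X ω‖ ^ 2 * min (t * ‖X ω‖) 1) (f := fun _ => (0 : ℝ))
    (fun ω => ‖X ω‖ ^ 2)
    (Eventually.of_forall fun t =>
      (hm.pow 2).mul ((hm.const_mul t).inf aestronglyMeasurable_const))
    (by
      filter_upwards [self_mem_nhdsWithin] with t ht
      refine ae_of_all _ fun ω => ?_
      have ht' : (0 : ℝ) ≤ t := ht
      have h0 : 0 ≤ min (t * ‖X ω‖) 1 := le_min (by positivity) zero_le_one
      rw [Real.norm_of_nonneg (by positivity)]
      exact mul_le_of_le_one_right (by positivity) (min_le_right _ _))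
    hX.norm.integrable_sq
    (ae_of_all _ fun ω => by
      have : Continuous fun t : ℝ => ‖X ω‖ ^ 2 * min (t * ‖X ω‖) 1 := by fun_prop
      have h1 := (this.tendsto 0).mono_left (nhdsWithin_le_nhds (s := Set.Ici 0))
      simpa using h1)
  rw [integral_zero] at this
  exact this

omit [IsProbabilityMeasure P] in
theorem memLp_re_mul (hX : MemLp X 2 P) (c : ℂ) : MemLp (fun ω => (c * X ω).re) 2 P :=
  (hX.const_mul c).re

omit [IsProbabilityMeasure P] in
theorem integral_re_mul_sq_le (hX : MemLp X 2 P) (c : ℂ) :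
    ∫ ω, (c * X ω).re ^ 2 ∂P ≤ ‖c‖ ^ 2 * ∫ ω, ‖X ω‖ ^ 2 ∂P := by
  rw [← integral_const_mul]
  refine integral_mono (memLp_re_mul hX c).integrable_sq
    (hX.norm.integrable_sq.const_mul _) fun ω => ?_
  simp only
  rw [← mul_pow, ← norm_mul, ← sq_abs]
  gcongr
  exact Complex.abs_re_le_norm _

/-- Second order expansion of the characteristic function of a centered complex variable, with a
remainder that is uniform in the direction. -/
theorem norm_charFun_sub_le (hX : MemLp X 2 P) (h0 : ∫ ω, X ω ∂P = 0) (c : ℂ) :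
    ‖∫ ω, Complex.exp ((c * X ω).re * Complex.I) ∂P
        - (1 - ((∫ ω, (c * X ω).re ^ 2 ∂P : ℝ) : ℂ) / 2)‖
      ≤ 4 * ‖c‖ ^ 2 * truncatedMoment P X ‖c‖ := by
  have hre := memLp_re_mul hX c
  have hint := hX.integrable one_le_two
  have hre1 : Integrable (fun ω => (((c * X ω).re : ℝ) : ℂ) * Complex.I) P :=
    ((hre.integrable one_le_two).ofReal).mul_const _
  have hre2 : Integrable (fun ω => (((c * X ω).re : ℝ) : ℂ) ^ 2 / 2) P := by
    have := (hre.integrable_sq.ofReal (𝕜 := ℂ)).div_const 2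
    refine this.congr (ae_of_all _ fun ω => by simp)
  have hexp : Integrable (fun ω => Complex.exp ((c * X ω).re * Complex.I)) P := by
    refine Integrable.of_bound ?_ 1 (ae_of_all _ fun ω =>
      (Complex.norm_exp_ofReal_mul_I _).le)
    exact Complex.continuous_exp.comp_aestronglyMeasurable hre1.aestronglyMeasurable
  have hmean : ∫ ω, (((c * X ω).re : ℝ) : ℂ) * Complex.I ∂P = 0 := by
    rw [integral_mul_const, integral_complex_ofReal]
    have h1 : ∫ ω, (c * X ω).re ∂P = (∫ ω, c * X ω ∂P).re := integral_re (hint.const_mul c)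
    rw [h1, integral_const_mul, h0]
    simp
  have e : ∫ ω, Complex.exp ((c * X ω).re * Complex.I) ∂P
        - (1 - ((∫ ω, (c * X ω).re ^ 2 ∂P : ℝ) : ℂ) / 2)
      = ∫ ω, (Complex.exp ((c * X ω).re * Complex.I)
        - (1 + (c * X ω).re * Complex.I - ((c * X ω).re : ℂ) ^ 2 / 2)) ∂P := by
    have hone : Integrable (fun _ : Ω => (1 : ℂ)) P := integrable_const _
    have e1 := integral_add hone hre1
    have e2 := integral_sub (hone.add hre1) hre2
    have e3 := integral_sub hexp ((hone.add hre1).sub hre2)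
    simp only [Pi.add_apply, Pi.sub_apply] at e2 e3
    rw [e3, e2, e1, hmean, integral_div]
    simp [← integral_complex_ofReal]
  rw [e]
  refine (norm_integral_le_integral_norm _).trans ?_
  rw [truncatedMoment, ← integral_const_mul]
  refine integral_mono (hexp.sub (((integrable_const _).add hre1).sub hre2)).norm
    ((integrable_truncated hX (norm_nonneg c)).const_mul _) fun ω => ?_
  refine (norm_exp_I_mul_sub_le _).trans ?_
  have h1 : |(c * X ω).re| ≤ ‖c‖ * ‖X ω‖ := by
    rw [← norm_mul]; exact Complex.abs_re_le_norm _
  calc 4 * (c * X ω).re ^ 2 * min |(c * X ω).re| 1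
      = 4 * |(c * X ω).re| ^ 2 * min |(c * X ω).re| 1 := by rw [sq_abs]
    _ ≤ 4 * (‖c‖ * ‖X ω‖) ^ 2 * min (‖c‖ * ‖X ω‖) 1 := by gcongr
    _ = _ := by ring

/-- Lindeberg central limit theorem for a triangular array of weighted copies of a centered
complex random variable, in terms of characteristic functions. -/
theorem tendsto_prod_charFun (hX : MemLp X 2 P) (h0 : ∫ ω, X ω ∂P = 0) {a : ℕ → ℕ → ℂ} {s C : ℝ}
    (hmax : ∀ ε > 0, ∀ᶠ n : ℕ in atTop, ∀ k ≤ n, ‖a n k‖ ≤ ε)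
    (hbd : ∀ᶠ n : ℕ in atTop, ∑ k ∈ Finset.range (n + 1), ‖a n k‖ ^ 2 ≤ C)
    (hv : Tendsto (fun n : ℕ => ∑ k ∈ Finset.range (n + 1), ∫ ω, (a n k * X ω).re ^ 2 ∂P) atTop
      (𝓝 s)) :
    Tendsto (fun n : ℕ => ∏ k ∈ Finset.range (n + 1),
      ∫ ω, Complex.exp ((a n k * X ω).re * Complex.I) ∂P) atTop (𝓝 (Complex.exp (-s / 2))) := by
  set M : ℝ := ∫ ω, ‖X ω‖ ^ 2 ∂P with hM
  have hM0 : 0 ≤ M := integral_nonneg fun ω => by positivity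
  set φ : ℂ → ℂ := fun c => ∫ ω, Complex.exp ((c * X ω).re * Complex.I) ∂P with hφ
  set v : ℂ → ℝ := fun c => ∫ ω, (c * X ω).re ^ 2 ∂P with hv'
  have hv0 : ∀ c, 0 ≤ v c := fun c => integral_nonneg fun ω => sq_nonneg _
  have hvle : ∀ c, v c ≤ ‖c‖ ^ 2 * M := fun c => integral_re_mul_sq_le hX c
  have hφ1 : ∀ c, ‖φ c‖ ≤ 1 := fun c => by
    refine (norm_integral_le_integral_norm _).trans ?_
    simp_rw [Complex.norm_exp_ofReal_mul_I]
    simp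
  have hmain : Tendsto (fun n : ℕ => ∏ k ∈ Finset.range (n + 1),
      Complex.exp (((-(v (a n k) / 2) : ℝ)) : ℂ)) atTop (𝓝 (Complex.exp (-s / 2))) := by
    have h1 : Tendsto (fun n : ℕ => Complex.exp
        (((-(∑ k ∈ Finset.range (n + 1), v (a n k)) / 2 : ℝ)) : ℂ)) atTop
        (𝓝 (Complex.exp ((-s / 2 : ℝ) : ℂ))) :=
      (Complex.continuous_exp.tendsto _).comp
        ((Complex.continuous_ofReal.tendsto _).comp (hv.neg.div_const 2))
    push_cast at h1
    refine h1.congr fun n => ?_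
    rw [← Complex.exp_sum]
    congr 1
    push_cast
    rw [Finset.sum_neg_distrib, neg_div, Finset.sum_div]
  have hdiff : Tendsto (fun n : ℕ => ∏ k ∈ Finset.range (n + 1), φ (a n k)
      - ∏ k ∈ Finset.range (n + 1), Complex.exp (((-(v (a n k) / 2) : ℝ)) : ℂ)) atTop (𝓝 0) := by
    rw [Metric.tendsto_nhds]
    intro δ hδ
    set C' := max C 0 with hC'
    have hC0 : 0 ≤ C' := le_max_right _ _
    have hη : 0 < δ / (2 * (4 + 1) * (C' + 1)) := by positivity
    set η := δ / (2 * (4 + 1) * (C' + 1)) with hηdef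
    have hG := (tendsto_truncatedMoment hX).eventually (gt_mem_nhds hη)
    obtain ⟨ρ, hρ, hGρ⟩ := (nhdsGE_basis_Ico (0 : ℝ)).eventually_iff.1 hG
    set ε := min (ρ / 2) (min (1 / (M + 1)) (η / (M ^ 2 + 1))) with hε
    have hε0 : 0 < ε := by positivity
    have hε1 : ε ≤ 1 / (M + 1) := (min_le_right _ _).trans (min_le_left _ _)
    have hε2 : ε ≤ η / (M ^ 2 + 1) := (min_le_right _ _).trans (min_le_right _ _)
    have hερ : ε < ρ := (min_le_left _ _).trans_lt (by linarith)
    have hε3 : ε ≤ 1 := hε1.trans (by rw [div_le_one (by positivity)]; linarith)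
    filter_upwards [hmax ε hε0, hbd] with n hn hbd
    -- each factor is compared with that of a Gaussian variable of the same variance
    have hterm : ∀ k ∈ Finset.range (n + 1), ‖φ (a n k)
        - Complex.exp (((-(v (a n k) / 2) : ℝ)) : ℂ)‖ ≤ 5 * η * ‖a n k‖ ^ 2 := by
      intro k hk
      have hc := hn k (Nat.lt_succ_iff.1 (Finset.mem_range.1 hk))
      set c := a n k
      have h1 := norm_charFun_sub_le hX h0 c
      have hGc : truncatedMoment P X ‖c‖ ≤ η :=
        (hGρ ⟨norm_nonneg c, hc.trans_lt hερ⟩).le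
      have hvc : v c / 2 ≤ 1 := by
        have h2 : ‖c‖ ^ 2 * M ≤ 1 := by
          calc ‖c‖ ^ 2 * M ≤ ε ^ 2 * M := by gcongr
            _ ≤ ε * (M + 1) := by
                have : ε ^ 2 ≤ ε := by nlinarith
                have : ε ^ 2 * M ≤ ε * M := by gcongr
                linarith
            _ ≤ 1 / (M + 1) * (M + 1) := by gcongr
            _ = 1 := by field_simp
        linarith [hvle c]
      have h2 := Real.norm_exp_sub_one_sub_id_le (x := -(v c / 2)) (by
        rw [norm_neg, Real.norm_of_nonneg (by linarith [hv0 c])]; exact hvc)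
      have h3 : ‖Complex.exp (((-(v c / 2) : ℝ)) : ℂ) - (1 - (v c : ℂ) / 2)‖ ≤ η * ‖c‖ ^ 2 := by
        have e : Complex.exp (((-(v c / 2) : ℝ)) : ℂ) - (1 - (v c : ℂ) / 2)
            = ((Real.exp (-(v c / 2)) - 1 - -(v c / 2) : ℝ) : ℂ) := by
          push_cast; ring
        rw [e, Complex.norm_real]
        refine h2.trans ?_
        rw [norm_neg, Real.norm_of_nonneg (by linarith [hv0 c])]
        calc (v c / 2) ^ 2 ≤ (‖c‖ ^ 2 * M) ^ 2 := by
              have := hv0 c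
              have := hvle c
              gcongr
              linarith
          _ = M ^ 2 * ‖c‖ ^ 2 * ‖c‖ ^ 2 := by ring
          _ ≤ η * ‖c‖ ^ 2 := by
              gcongr
              calc M ^ 2 * ‖c‖ ^ 2 ≤ (M ^ 2 + 1) * ε := by
                    have h4 : ‖c‖ ^ 2 ≤ ε := by nlinarith [norm_nonneg c]
                    gcongr
                    linarith
                _ ≤ (M ^ 2 + 1) * (η / (M ^ 2 + 1)) := by gcongr
                _ = η := by field_simp
      calc ‖φ c - Complex.exp (((-(v c / 2) : ℝ)) : ℂ)‖
          = ‖(φ c - (1 - (v c : ℂ) / 2))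
            - (Complex.exp (((-(v c / 2) : ℝ)) : ℂ) - (1 - (v c : ℂ) / 2))‖ := by
              congr 1; ring
        _ ≤ 4 * ‖c‖ ^ 2 * truncatedMoment P X ‖c‖ + η * ‖c‖ ^ 2 :=
            (norm_sub_le _ _).trans (add_le_add h1 h3)
        _ ≤ 4 * ‖c‖ ^ 2 * η + η * ‖c‖ ^ 2 := by gcongr
        _ = _ := by ring
    rw [dist_zero_right]
    refine (norm_prod_sub_prod_le _ _ _ (fun k _ => hφ1 _) (fun k _ => ?_)).trans_lt ?_
    · rw [Complex.norm_exp, Complex.ofReal_re]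
      exact Real.exp_le_one_iff.2 (by linarith [hv0 (a n k)])
    · refine (Finset.sum_le_sum hterm).trans_lt ?_
      rw [← Finset.mul_sum]
      calc _ ≤ 5 * η * (C' + 1) := by
            gcongr
            have := le_max_left C 0
            linarith
        _ = δ / 2 := by rw [hηdef]; field_simp; norm_num
        _ < δ := half_lt_self hδ
  have := hdiff.add hmain
  rw [zero_add] at this
  refine this.congr fun n => by ring

omit [IsProbabilityMeasure P] in
/-- Characteristic function of a weighted sum of independent copies. -/
theorem integral_exp_weighted_sum {ξ : ℕ → Ω → ℂ} (hξ_meas : ∀ k, Measurable (ξ k))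
    (hξ_indep : iIndepFun ξ P) (hξ_ident : ∀ k, IdentDistrib (ξ k) (ξ 0) P P) (a : ℕ → ℂ) (n : ℕ) :
    ∫ ω, Complex.exp ((∑ k ∈ Finset.range n, a k * ξ k ω).re * Complex.I) ∂P
      = ∏ k ∈ Finset.range n, ∫ ω, Complex.exp ((a k * ξ 0 ω).re * Complex.I) ∂P := by
  set f : ℕ → ℂ → ℂ := fun k z => Complex.exp ((a k * z).re * Complex.I) with hf
  have hfm : ∀ k, Measurable (f k) := fun k => by fun_prop
  have h1 := (hξ_indep.comp f hfm).precomp (g := fun i : Fin n => (i : ℕ)) Fin.val_injective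
  have h2 := h1.integral_fun_prod_eq_prod_integral
    (fun i => ((hfm _).comp (hξ_meas _)).aestronglyMeasurable)
  simp only [Function.comp_def] at h2
  have h3 : ∀ k, ∫ ω, f k (ξ k ω) ∂P = ∫ ω, f k (ξ 0 ω) ∂P := fun k =>
    ((hξ_ident k).comp (hfm k)).integral_eq
  simp only [h3] at h2
  rw [Finset.prod_range, ← h2]
  refine integral_congr_ae (ae_of_all _ fun ω => ?_)
  simp only [hf]
  rw [← Complex.exp_sum, ← Finset.sum_mul, Finset.sum_range, Complex.re_sum]
  push_cast
  rfl

end CLT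

/-! ### Second moments of real parts -/

theorem re_sq_eq (y : ℂ) : y.re ^ 2 = (y * (starRingEnd ℂ) y + y * y).re / 2 := by
  simp [Complex.mul_re]
  ring

theorem sum_mul_conj_add_sum_mul_self {A : Type*} [Fintype A] (t z : A → ℂ) (s d : ℂ) :
    s * ((∑ a, t a * z a) * (starRingEnd ℂ) (∑ a, t a * z a))
        + d * ((∑ a, t a * z a) * ∑ a, t a * z a)
      = ∑ a, ∑ b, (t a * (starRingEnd ℂ) (t b) * (s * (z a * (starRingEnd ℂ) (z b)))
          + t a * t b * (d * (z a * z b))) := by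
  rw [map_sum, Finset.sum_mul_sum, Finset.sum_mul_sum, Finset.mul_sum, Finset.mul_sum,
    ← Finset.sum_add_distrib]
  refine Finset.sum_congr rfl fun a _ => ?_
  rw [Finset.mul_sum, Finset.mul_sum, ← Finset.sum_add_distrib]
  refine Finset.sum_congr rfl fun b _ => ?_
  rw [map_mul]
  ring

theorem integral_sq_re_sum {Ω : Type*} [MeasurableSpace Ω] {P : Measure Ω} {A : Type*} [Fintype A]
    {Z : A → Ω → ℂ} (hZ : ∀ a, MemLp (Z a) 2 P) (t : A → ℂ) :
    ∫ ω, (∑ a, t a * Z a ω).re ^ 2 ∂P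
      = (∑ a, ∑ b, (t a * (starRingEnd ℂ) (t b) * ∫ ω, Z a ω * (starRingEnd ℂ) (Z b ω) ∂P
          + t a * t b * ∫ ω, Z a ω * Z b ω ∂P)).re / 2 := by
  have h1 : ∀ a b, Integrable (fun ω => Z a ω * (starRingEnd ℂ) (Z b ω)) P := fun a b =>
    (hZ a).integrable_mul ((hZ b).star)
  have h2 : ∀ a b, Integrable (fun ω => Z a ω * Z b ω) P := fun a b =>
    (hZ a).integrable_mul (hZ b)
  have h3 : ∀ a b, Integrable (fun ω => t a * (starRingEnd ℂ) (t b) * (Z a ω *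
      (starRingEnd ℂ) (Z b ω)) + t a * t b * (Z a ω * Z b ω)) P := fun a b =>
    ((h1 a b).const_mul _).add ((h2 a b).const_mul _)
  have h4 : ∀ ω, (∑ a, t a * Z a ω).re ^ 2 = (∑ a, ∑ b, (t a * (starRingEnd ℂ) (t b) * (Z a ω *
      (starRingEnd ℂ) (Z b ω)) + t a * t b * (Z a ω * Z b ω))).re / 2 := by
    intro ω
    have := sum_mul_conj_add_sum_mul_self t (fun a => Z a ω) 1 1
    simp only [one_mul] at this
    rw [re_sq_eq, this]
  simp_rw [h4]
  rw [integral_div]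
  have h5 : ∫ ω, (∑ a, ∑ b, (t a * (starRingEnd ℂ) (t b) * (Z a ω *
      (starRingEnd ℂ) (Z b ω)) + t a * t b * (Z a ω * Z b ω))).re ∂P
      = (∫ ω, ∑ a, ∑ b, (t a * (starRingEnd ℂ) (t b) * (Z a ω *
      (starRingEnd ℂ) (Z b ω)) + t a * t b * (Z a ω * Z b ω)) ∂P).re :=
    integral_re (integrable_finsetSum _ fun a _ => integrable_finsetSum _ fun b _ => h3 a b)
  rw [h5, integral_finsetSum _ fun a _ => integrable_finsetSum _ fun b _ => h3 a b]
  congr 2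
  refine Finset.sum_congr rfl fun a _ => ?_
  rw [integral_finsetSum _ fun b _ => h3 a b]
  refine Finset.sum_congr rfl fun b _ => ?_
  rw [integral_add ((h1 a b).const_mul _) ((h2 a b).const_mul _), integral_const_mul,
    integral_const_mul]

theorem integral_sq_re_mul {Ω : Type*} [MeasurableSpace Ω] {P : Measure Ω} [IsProbabilityMeasure P]
    {X : Ω → ℂ} {σ₁ σ₂ : ℝ} (h_re : MemLp (fun ω => (X ω).re) 2 P)
    (h_im : MemLp (fun ω => (X ω).im) 2 P) (h_mean : ∫ ω, X ω ∂P = 0)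
    (hσ₁ : ∫ ω, (X ω).re ^ 2 ∂P = σ₁ ^ 2) (hσ₂ : ∫ ω, (X ω).im ^ 2 ∂P = σ₂ ^ 2)
    (h_cov : covariance (fun ω => (X ω).re) (fun ω => (X ω).im) P = 0) (c : ℂ) :
    ∫ ω, (c * X ω).re ^ 2 ∂P = (((σ₁ ^ 2 + σ₂ ^ 2 : ℝ) : ℂ) * (c * (starRingEnd ℂ) c)
      + ((σ₁ ^ 2 - σ₂ ^ 2 : ℝ) : ℂ) * (c * c)).re / 2 := by
  have hX : Integrable X P := by
    have := (h_re.integrable one_le_two).ofReal (𝕜 := ℂ) |>.add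
      (((h_im.integrable one_le_two).ofReal (𝕜 := ℂ)).mul_const Complex.I)
    refine this.congr (ae_of_all _ fun ω => ?_)
    simp
  have hre0 : ∫ ω, (X ω).re ∂P = 0 := by
    have : ∫ ω, (X ω).re ∂P = (∫ ω, X ω ∂P).re := integral_re hX
    rw [this, h_mean]; rfl
  have hmix : ∫ ω, (X ω).re * (X ω).im ∂P = 0 := by
    rw [covariance_eq_sub h_re h_im, hre0, zero_mul, sub_zero] at h_cov
    exact h_cov
  have e : ∀ ω, (c * X ω).re ^ 2 = c.re ^ 2 * (X ω).re ^ 2 + c.im ^ 2 * (X ω).im ^ 2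
      - 2 * c.re * c.im * ((X ω).re * (X ω).im) := by
    intro ω
    rw [Complex.mul_re]; ring
  simp_rw [e]
  have i1 := h_re.integrable_sq.const_mul (c.re ^ 2)
  have i2 := h_im.integrable_sq.const_mul (c.im ^ 2)
  have i3 := (h_re.integrable_mul h_im).const_mul (2 * c.re * c.im)
  have e1 := integral_sub (i1.add i2) i3
  simp only [Pi.add_apply, Pi.mul_apply] at e1
  rw [e1, integral_add i1 i2, integral_const_mul, integral_const_mul, integral_const_mul, hσ₁, hσ₂,
    hmix]
  simp only [Complex.mul_re, Complex.mul_im, Complex.add_re, Complex.ofReal_re, Complex.ofReal_im,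
    Complex.conj_re, Complex.conj_im]
  ring

theorem memLp_of_re_im {Ω : Type*} [MeasurableSpace Ω] {P : Measure Ω} {X : Ω → ℂ}
    (h_re : MemLp (fun ω => (X ω).re) 2 P) (h_im : MemLp (fun ω => (X ω).im) 2 P) :
    MemLp X 2 P := by
  have h1 := (h_re.ofReal (K := ℂ)).add ((h_im.ofReal (K := ℂ)).mul_const Complex.I)
  refine h1.ae_eq (ae_of_all _ fun ω => ?_)
  simp

/-! ### The limiting Gaussian vector -/

section Existence

variable {m : ℕ}

theorem exists_sub_eq_two_pi_iff {ψ : Fin m → ℝ} (hψ_mono : StrictMono ψ)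
    (hψ : ∀ i, ψ i ∈ Set.Ico 0 (2 * Real.pi)) (i j : Fin m) :
    (∃ k : ℤ, ψ i - ψ j = 2 * Real.pi * k) ↔ i = j := by
  refine ⟨?_, fun h => ⟨0, by simp [h]⟩⟩
  rintro ⟨k, hk⟩
  have hi := hψ i
  have hj := hψ j
  have hpi := Real.pi_pos
  have h1 : (k : ℝ) < 1 := by
    by_contra hc
    push Not at hc
    nlinarith [hi.2, hj.1]
  have h2 : (-1 : ℝ) < k := by
    by_contra hc
    push Not at hc
    nlinarith [hi.1, hj.2]
  have hk0 : k = 0 := by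
    have : k < 1 := by exact_mod_cast h1
    have : -1 < k := by exact_mod_cast h2
    omega
  rw [hk0] at hk
  exact hψ_mono.injective (by simpa [sub_eq_zero] using hk)

/-- Complex linear images of a standard Gaussian vector. -/
theorem gaussian_linear_image {S : Type*} [Fintype S] (C : Fin m → S → ℂ) :
    let Q : Measure (S → ℝ) := Measure.pi fun _ => gaussianReal 0 1
    let Y : (S → ℝ) → Fin m → ℂ := fun x i => ∑ s, C i s * x s
    HasGaussianLaw Y Q ∧ (∀ i, ∫ x, Y x i ∂Q = 0) ∧
      (∀ i j, ∫ x, Y x i * (starRingEnd ℂ) (Y x j) ∂Q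
        = ∑ s, C i s * (starRingEnd ℂ) (C j s)) ∧
      ∀ i j, ∫ x, Y x i * Y x j ∂Q = ∑ s, C i s * C j s := by
  classical
  intro Q Y
  have hind : iIndepFun (fun (s : S) (x : S → ℝ) => x s) Q :=
    iIndepFun_pi (X := fun _ y => y) fun _ => aemeasurable_id
  have hmap : ∀ s : S, Q.map (fun x => x s) = gaussianReal 0 1 := fun s =>
    (measurePreserving_eval (fun _ : S => gaussianReal 0 1) s).map_eq
  have hlaw : ∀ s : S, HasGaussianLaw (fun x : S → ℝ => x s) Q := fun s =>
    ⟨by rw [hmap s]; infer_instance⟩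
  have hG : HasGaussianLaw (fun x : S → ℝ => fun s => x s) Q := hind.hasGaussianLaw hlaw
  have hmean : ∀ s : S, ∫ x, x s ∂Q = 0 := fun s => by
    have := integral_map (μ := Q) (φ := fun x => x s) (measurable_pi_apply s).aemeasurable
      (f := fun y : ℝ => y) aestronglyMeasurable_id
    rw [← this, hmap s, integral_id_gaussianReal]
  have hLp : ∀ s : S, MemLp (fun x : S → ℝ => x s) 2 Q := fun s => (hlaw s).memLp_two
  have hcov : ∀ s r : S, ∫ x, ((x s : ℝ) : ℂ) * (x r : ℂ) ∂Q = if s = r then 1 else 0 := by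
    intro s r
    have e : ∫ x, ((x s : ℝ) : ℂ) * (x r : ℂ) ∂Q = ((∫ x, x s * x r ∂Q : ℝ) : ℂ) := by
      rw [← integral_complex_ofReal]
      simp
    rw [e]
    split_ifs with hsr
    · subst hsr
      have h1 : Var[fun x : S → ℝ => x s; Q] = 1 := by
        have := variance_map (μ := Q) (Y := fun x : S → ℝ => x s) (X := id) aemeasurable_id
          (measurable_pi_apply s).aemeasurable
        rw [hmap s, variance_id_gaussianReal] at this
        simpa [Function.comp_def] using this.symm
      rw [variance_eq_sub (hLp s), hmean s] at h1
      simp only [Pi.pow_apply] at h1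
      have h2 : ∫ x, x s * x s ∂Q = 1 := by
        rw [← h1]; simp [sq]
      rw [h2]; simp
    · have := (hind.indepFun hsr).integral_fun_mul_eq_mul_integral
        (hLp s).aestronglyMeasurable (hLp r).aestronglyMeasurable
      rw [this, hmean s]; simp
  have hint : ∀ s r : S, Integrable (fun x : S → ℝ => ((x s : ℝ) : ℂ) * (x r : ℂ)) Q := fun s r => by
    refine (((hLp s).integrable_mul (hLp r)).ofReal (𝕜 := ℂ)).congr (ae_of_all _ fun x => ?_)
    simp
  have hbil : ∀ c d : S → ℂ, ∫ x, (∑ s, c s * ((x s : ℝ) : ℂ)) * (∑ r, d r * (x r : ℂ)) ∂Q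
      = ∑ s, c s * d s := by
    intro c d
    have e : ∀ x : S → ℝ, (∑ s, c s * ((x s : ℝ) : ℂ)) * (∑ r, d r * (x r : ℂ))
        = ∑ s, ∑ r, c s * d r * (((x s : ℝ) : ℂ) * (x r : ℂ)) := by
      intro x
      rw [Finset.sum_mul_sum]
      refine Finset.sum_congr rfl fun s _ => Finset.sum_congr rfl fun r _ => by ring
    simp_rw [e]
    rw [integral_finsetSum _ fun s _ => integrable_finsetSum _ fun r _ => (hint s r).const_mul _]
    refine Finset.sum_congr rfl fun s _ => ?_
    rw [integral_finsetSum _ fun r _ => (hint s r).const_mul _]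
    simp_rw [integral_const_mul, hcov]
    simp
  refine ⟨?_, fun i => ?_, fun i j => ?_, fun i j => hbil _ _⟩
  · have hL : IsLinearMap ℝ Y := by
      constructor
      · intro x y; ext i
        simp [Y, mul_add, Finset.sum_add_distrib]
      · intro a x; ext i
        simp only [Y, Pi.smul_apply, smul_eq_mul, Complex.ofReal_mul, Complex.real_smul,
          Finset.mul_sum]
        exact Finset.sum_congr rfl fun s _ => by ring
    exact hG.map (LinearMap.toContinuousLinearMap hL.mk')
  · simp only [Y]
    have hi : ∀ s ∈ Finset.univ, Integrable (fun x : S → ℝ => C i s * ((x s : ℝ) : ℂ)) Q :=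
      fun s _ => (((hLp s).integrable one_le_two).ofReal (𝕜 := ℂ)).const_mul _
    rw [integral_finsetSum _ hi]
    refine Finset.sum_eq_zero fun s _ => ?_
    have h1 : ∫ x : S → ℝ, ((x s : ℝ) : ℂ) ∂Q = 0 := by
      rw [integral_complex_ofReal, hmean s, Complex.ofReal_zero]
    have := integral_const_mul (μ := Q) (C i s) (fun x : S → ℝ => ((x s : ℝ) : ℂ))
    rw [h1, mul_zero] at this
    exact this
  · rw [← hbil (C i) (fun s => (starRingEnd ℂ) (C j s))]
    simp [Y, map_sum, map_mul]

/-- The limiting Gaussian law exists. It is realised as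
`N_i = α G(ψ_i) + β conj G(-ψ_i)`, where `G` is a family of independent standard circular complex
Gaussian variables indexed by angles modulo `2π`, with `α, β = (σ₁ ± σ₂) / √2`. -/
theorem exists_isLimitVector (σ₁ σ₂ : ℝ) (ψ : Fin m → ℝ) (hψ_mono : StrictMono ψ)
    (hψ : ∀ i, ψ i ∈ Set.Ico 0 (2 * Real.pi)) :
    ∃ γ : Measure (Fin m → ℂ), IsLimitVector σ₁ σ₂ ψ (fun x => x) γ := by
  classical
  set θ : Fin m → Real.Angle := fun i => (ψ i : Real.Angle) with hθ
  set T : Finset Real.Angle := Finset.univ.image θ ∪ Finset.univ.image (fun i => -θ i) with hT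
  have hmem : ∀ i, θ i ∈ T := fun i => by simp [hT]
  have hmem' : ∀ i, -θ i ∈ T := fun i => by simp [hT]
  have hθinj : ∀ i j, θ i = θ j ↔ i = j := fun i j =>
    Real.Angle.angle_eq_iff_two_pi_dvd_sub.trans (exists_sub_eq_two_pi_iff hψ_mono hψ i j)
  set α : ℝ := (σ₁ + σ₂) / 2 with hα
  set β : ℝ := (σ₁ - σ₂) / 2 with hβ
  -- the coefficients of `N_i` on the real and imaginary parts of `√2 G(t)`
  set e : Fin m → T → ℝ := fun i t => if θ i = (t : Real.Angle) then 1 else 0 with he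
  set e' : Fin m → T → ℝ := fun i t => if -θ i = (t : Real.Angle) then 1 else 0 with he'
  set C : Fin m → T × Bool → ℂ := fun i s =>
    if s.2 then ((α * e i s.1 + β * e' i s.1 : ℝ) : ℂ)
    else Complex.I * ((α * e i s.1 - β * e' i s.1 : ℝ) : ℂ) with hC
  have hsum : ∀ x y : Real.Angle, x ∈ T → ∑ t : T, (if x = (t : Real.Angle) then (1 : ℝ) else 0)
      * (if y = (t : Real.Angle) then (1 : ℝ) else 0) = if x = y then 1 else 0 := by
    intro x y hx
    rw [Finset.sum_eq_single ⟨x, hx⟩]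
    · simp [eq_comm]
    · intro t _ ht
      have : x ≠ t := fun h => ht (Subtype.ext h.symm)
      simp [this]
    · simp
  obtain ⟨hG, hmean, hcov, hpseudo⟩ := gaussian_linear_image C
  set Q : Measure (T × Bool → ℝ) := Measure.pi fun _ => gaussianReal 0 1
  set Y : (T × Bool → ℝ) → Fin m → ℂ := fun x i => ∑ s, C i s * x s
  have hYm : Measurable Y := by fun_prop
  refine ⟨Q.map Y, ⟨?_, fun i => ?_, fun i j => ?_, fun i j => ?_⟩⟩
  · exact ⟨by rw [Measure.map_id']; exact hG.isGaussian_map⟩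
  · rw [integral_map hYm.aemeasurable (measurable_pi_apply i).aestronglyMeasurable]
    exact hmean i
  · rw [integral_map hYm.aemeasurable (by fun_prop)]
    refine (hcov i j).trans ?_
    have h1 : ∑ s, C i s * (starRingEnd ℂ) (C j s)
        = ((2 * α ^ 2 * ∑ t, e i t * e j t + 2 * β ^ 2 * ∑ t, e' i t * e' j t : ℝ) : ℂ) := by
      rw [Fintype.sum_prod_type]
      simp only [Fintype.sum_bool, hC]
      push_cast
      rw [Finset.mul_sum, Finset.mul_sum, ← Finset.sum_add_distrib]
      refine Finset.sum_congr rfl fun t _ => ?_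
      simp only [map_mul, map_add, map_sub, Complex.conj_I,
        Complex.conj_ofReal]
      linear_combination (-(α * e i t - β * e' i t) * (α * e j t - β * e' j t) : ℂ) * Complex.I_sq
    rw [h1, hsum _ _ (hmem i), hsum _ _ (hmem' i)]
    simp only [neg_inj, hθinj]
    split_ifs
    · congr 1; rw [hα, hβ]; ring
    · simp
  · rw [integral_map hYm.aemeasurable (by fun_prop)]
    refine (hpseudo i j).trans ?_
    have h1 : ∑ s, C i s * C j s
        = ((2 * α * β * (∑ t, e i t * e' j t + ∑ t, e' i t * e j t) : ℝ) : ℂ) := by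
      rw [Fintype.sum_prod_type]
      simp only [Fintype.sum_bool, hC]
      push_cast
      rw [← Finset.sum_add_distrib, Finset.mul_sum]
      refine Finset.sum_congr rfl fun t _ => ?_
      linear_combination ((α * e i t - β * e' i t) * (α * e j t - β * e' j t) : ℂ) * Complex.I_sq
    rw [h1, hsum _ _ (hmem i), hsum _ _ (hmem' i)]
    have h2 : (∃ k : ℤ, ψ i + ψ j = 2 * Real.pi * k) ↔ θ i = -θ j := by
      rw [hθ, ← Real.Angle.coe_neg, Real.Angle.angle_eq_iff_two_pi_dvd_sub]
      simp only [sub_neg_eq_add]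
    have h3 : -θ i = θ j ↔ θ i = -θ j := neg_eq_iff_eq_neg
    simp only [h2, h3]
    split_ifs
    · congr 1; rw [hα, hβ]; ring
    · simp

end Existence

/-! ### Convergence of the Taylor coefficients -/

/-- The coefficient of `ξ_k` in the `r`-th derivative at `u = 0` of
`u ↦ L(n)^{-1/2} P_n(ẑ_n(θ, u))`. -/
noncomputable def arrayCoeff (b : ℝ → ℝ) (c θ : ℝ) (r n k : ℕ) : ℂ :=
  ((1 / √(bigL b c n) * b k * Real.exp (tilt b c n * (k / n) / 2) * ((k : ℝ) / n) ^ r : ℝ) : ℂ)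
    * Complex.exp (Complex.I * θ) ^ k

section Array

variable {b g : ℝ → ℝ} {c : ℝ}

theorem ofReal_arrayCoeff_mul (r s n k : ℕ) (hL : 0 ≤ bigL b c n) :
    (1 / √(bigL b c n) * b k * Real.exp (tilt b c n * (k / n) / 2) * ((k : ℝ) / n) ^ r)
      * (1 / √(bigL b c n) * b k * Real.exp (tilt b c n * (k / n) / 2) * ((k : ℝ) / n) ^ s)
      = tiltedWeight b c (r + s) n k / bigL b c n := by
  have h1 : Real.exp (tilt b c n * (k / n)) = Real.exp (tilt b c n * (k / n) / 2)
      * Real.exp (tilt b c n * (k / n) / 2) := by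
    rw [← Real.exp_add]; ring_nf
  have h2 : 1 / bigL b c n = 1 / √(bigL b c n) * (1 / √(bigL b c n)) := by
    rw [div_mul_div_comm, one_mul, Real.mul_self_sqrt hL]
  rw [tiltedWeight, h1, div_eq_mul_one_div _ (bigL b c n), h2, pow_add]
  ring

theorem norm_arrayCoeff_sq (θ : ℝ) (r n k : ℕ) (hL : 0 ≤ bigL b c n) :
    ‖arrayCoeff b c θ r n k‖ ^ 2 = tiltedWeight b c (2 * r) n k / bigL b c n := by
  have h1 : ‖Complex.exp (Complex.I * θ)‖ = 1 := by
    rw [mul_comm]; exact Complex.norm_exp_ofReal_mul_I θ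
  rw [arrayCoeff, norm_mul, norm_pow, h1, one_pow, mul_one, Complex.norm_real, Real.norm_eq_abs,
    sq_abs, sq, ofReal_arrayCoeff_mul r r n k hL, two_mul]

theorem arrayCoeff_mul (θ η : ℝ) (r s n k : ℕ) (hL : 0 ≤ bigL b c n) :
    arrayCoeff b c θ r n k * arrayCoeff b c η s n k
      = (tiltedWeight b c (r + s) n k : ℂ) * Complex.exp (Complex.I * (θ + η : ℝ)) ^ k
        / (bigL b c n : ℂ) := by
  have h1 := congrArg (fun x : ℝ => (x : ℂ)) (ofReal_arrayCoeff_mul (b := b) (c := c) r s n k hL)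
  simp only [Complex.ofReal_mul _ (1 / √(bigL b c n) * b k *
    Real.exp (tilt b c n * (k / n) / 2) * ((k : ℝ) / n) ^ s)] at h1
  rw [Complex.ofReal_add, mul_add, Complex.exp_add, mul_pow, mul_div_right_comm,
    ← Complex.ofReal_div, ← h1, arrayCoeff, arrayCoeff]
  ring

theorem conj_arrayCoeff (θ : ℝ) (r n k : ℕ) :
    (starRingEnd ℂ) (arrayCoeff b c θ r n k) = arrayCoeff b c (-θ) r n k := by
  rw [arrayCoeff, arrayCoeff, map_mul, map_pow, Complex.conj_ofReal, ← Complex.exp_conj, map_mul,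
    Complex.conj_I, Complex.conj_ofReal, Complex.ofReal_neg, mul_neg, neg_mul]

open Classical in
theorem tendsto_sum_arrayCoeff_mul (h : IsCriticalWeight b g c) (θ η : ℝ) (r s : ℕ) :
    Tendsto (fun n : ℕ => ∑ k ∈ Finset.range (n + 1),
        arrayCoeff b c θ r n k * arrayCoeff b c η s n k) atTop
      (𝓝 (if ∃ j : ℤ, θ + η = 2 * Real.pi * j then ((if r + s = 0 then 1 else 0) + 1 : ℂ)
        else 0)) := by
  refine (tendsto_oscillating_sum h (r + s) (θ + η)).congr' ?_
  filter_upwards [tilt_spec h] with n hn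
  rw [Finset.sum_div]
  exact Finset.sum_congr rfl fun k _ => (arrayCoeff_mul θ η r s n k hn.2.1.le).symm

theorem eventually_sum_norm_arrayCoeff_sq_le (h : IsCriticalWeight b g c) (θ : ℝ) (r : ℕ) :
    ∀ᶠ n : ℕ in atTop, ∑ k ∈ Finset.range (n + 1), ‖arrayCoeff b c θ r n k‖ ^ 2 ≤ 3 := by
  have hT : ∀ᶠ n : ℕ in atTop,
      (∑ k ∈ Finset.range (n + 1), tiltedWeight b c (2 * r) n k) / bigL b c n < 3 :=
    (tendsto_sum_tiltedWeight h (2 * r)).eventually (gt_mem_nhds (by split_ifs <;> norm_num))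
  filter_upwards [hT, tilt_spec h] with n hn hs
  rw [Finset.sum_div] at hn
  exact (Finset.sum_congr rfl fun k _ => norm_arrayCoeff_sq θ r n k hs.2.1.le).trans_le hn.le

theorem eventually_norm_arrayCoeff_le (h : IsCriticalWeight b g c) (θ : ℝ) (r : ℕ) {ε : ℝ}
    (hε : 0 < ε) : ∀ᶠ n : ℕ in atTop, ∀ k ≤ n, ‖arrayCoeff b c θ r n k‖ ≤ ε := by
  filter_upwards [eventually_tiltedWeight_le_mul_bigL h (2 * r) (show 0 < ε ^ 2 by positivity),
    tilt_spec h] with n hn hs k hk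
  refine le_of_sq_le_sq ?_ hε.le
  rw [norm_arrayCoeff_sq θ r n k hs.2.1.le, div_le_iff₀ hs.2.1]
  exact hn k hk

end Array

/-- `r`-th derivative at `u = 0` of `u ↦ L(n)^{-1/2} P_n(ẑ_n(θ, u))`. -/
noncomputable def scaledDeriv (b : ℝ → ℝ) (c θ : ℝ) (r n : ℕ) (x : ℕ → ℂ) : ℂ :=
  ∑ k ∈ Finset.range (n + 1), arrayCoeff b c θ r n k * x k

section FiniteDimensional

variable {Ω : Type*} [MeasurableSpace Ω] {P : Measure Ω} [IsProbabilityMeasure P]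
  {ξ : ℕ → Ω → ℂ} {σ₁ σ₂ : ℝ} {b g : ℝ → ℝ} {c : ℝ} {m : ℕ} {ψ : Fin m → ℝ}
  {Ω' : Type*} [MeasurableSpace Ω'] {P' : Measure Ω'} [IsProbabilityMeasure P']
  {Nhat N : Ω' → Fin m → ℂ}

/-- `r`-th derivative at `u = 0` of the limit `u ↦ p + exp u * q`. -/
noncomputable def limitDeriv (p q : ℂ) (r : ℕ) : ℂ := (if r = 0 then p else 0) + q

open Classical in
/-- The limiting covariance structure of the Taylor coefficients. -/
noncomputable def limitVariance (σ₁ σ₂ : ℝ) (ψ : Fin m → ℝ) {A : Type*} [Fintype A]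
    (j : A → Fin m) (r : A → ℕ) (t : A → ℂ) : ℝ :=
  (∑ a, ∑ a', (t a * (starRingEnd ℂ) (t a') * (((σ₁ ^ 2 + σ₂ ^ 2 : ℝ) : ℂ) *
      (if j a = j a' then ((if r a + r a' = 0 then 1 else 0) + 1 : ℂ) else 0))
    + t a * t a' * (((σ₁ ^ 2 - σ₂ ^ 2 : ℝ) : ℂ) *
      (if ∃ k : ℤ, ψ (j a) + ψ (j a') = 2 * Real.pi * k then
        ((if r a + r a' = 0 then 1 else 0) + 1 : ℂ) else 0)))).re / 2

omit [IsProbabilityMeasure P'] in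
/-- Variances of linear combinations of the limiting Taylor coefficients. -/
theorem integral_sq_re_sum_limitDeriv (hNhat : IsLimitVector σ₁ σ₂ ψ Nhat P')
    (hN : IsLimitVector σ₁ σ₂ ψ N P') (hind : IndepFun Nhat N P') {A : Type*} [Fintype A]
    (j : A → Fin m) (r : A → ℕ) (t : A → ℂ) :
    ∫ ω, (∑ a, t a * limitDeriv (Nhat ω (j a)) (N ω (j a)) (r a)).re ^ 2 ∂P'
      = limitVariance σ₁ σ₂ ψ j r t := by
  have hLN : ∀ i, MemLp (fun ω => N ω i) 2 P' := fun i => (hN.gaussian.eval i).memLp_two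
  have hLh : ∀ i, MemLp (fun ω => Nhat ω i) 2 P' := fun i => (hNhat.gaussian.eval i).memLp_two
  have hLh' : ∀ i (s : ℕ), MemLp (fun ω => if s = 0 then Nhat ω i else 0) 2 P' := fun i s => by
    split_ifs
    · exact hLh i
    · exact MemLp.zero'
  have hL : ∀ i s, MemLp (fun ω => limitDeriv (Nhat ω i) (N ω i) s) 2 P' := fun i s =>
    (hLh' i s).add (hLN i)
  rw [integral_sq_re_sum fun a => hL (j a) (r a), limitVariance]
  -- cross terms vanish by independence
  have hcross : ∀ (f : ℂ → ℂ) (i i' : Fin m), Measurable f →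
      ∫ ω, Nhat ω i * f (N ω i') ∂P' = 0 := by
    intro f i i' hf
    have h1 : IndepFun (fun ω => Nhat ω i) (fun ω => f (N ω i')) P' :=
      hind.comp (measurable_pi_apply i) (hf.comp (measurable_pi_apply i'))
    rw [h1.integral_fun_mul_eq_mul_integral (hLh i).aestronglyMeasurable
      (hf.comp_aemeasurable (hLN i').aestronglyMeasurable.aemeasurable).aestronglyMeasurable,
      hNhat.mean i, zero_mul]
  have hcross' : ∀ (f : ℂ → ℂ) (i i' : Fin m), Measurable f →
      ∫ ω, N ω i * f (Nhat ω i') ∂P' = 0 := by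
    intro f i i' hf
    have h1 : IndepFun (fun ω => N ω i) (fun ω => f (Nhat ω i')) P' :=
      hind.symm.comp (measurable_pi_apply i) (hf.comp (measurable_pi_apply i'))
    rw [h1.integral_fun_mul_eq_mul_integral (hLN i).aestronglyMeasurable
      (hf.comp_aemeasurable (hLh i').aestronglyMeasurable.aemeasurable).aestronglyMeasurable,
      hN.mean i, zero_mul]
  -- a common computation for `f = conj` and `f = id`
  have hcomp : ∀ (f : ℂ → ℂ), Measurable f → (∀ x y, f (x + y) = f x + f y) → f 0 = 0 →
      (∀ Z : Ω' → ℂ, MemLp Z 2 P' → MemLp (fun ω => f (Z ω)) 2 P') → ∀ i i' s s',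
      ∫ ω, limitDeriv (Nhat ω i) (N ω i) s * f (limitDeriv (Nhat ω i') (N ω i') s') ∂P'
        = (if s + s' = 0 then 1 else 0) * (∫ ω, Nhat ω i * f (Nhat ω i') ∂P')
          + ∫ ω, N ω i * f (N ω i') ∂P' := by
    intro f hfm hfa hf0 hfL i i' s s'
    have e : ∀ ω, limitDeriv (Nhat ω i) (N ω i) s * f (limitDeriv (Nhat ω i') (N ω i') s')
        = ((if s + s' = 0 then 1 else 0) * (Nhat ω i * f (Nhat ω i'))
          + (if s = 0 then 1 else 0) * (Nhat ω i * f (N ω i')))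
          + ((if s' = 0 then 1 else 0) * (N ω i * f (Nhat ω i')) + N ω i * f (N ω i')) := by
      intro ω
      rw [limitDeriv, limitDeriv, hfa]
      by_cases hs : s = 0 <;> by_cases hs' : s' = 0 <;> simp [hs, hs', hf0] <;> ring
    simp_rw [e]
    have i1 := ((hLh i).integrable_mul (hfL _ (hLh i'))).const_mul
      (if s + s' = 0 then (1 : ℂ) else 0)
    have i2 := ((hLh i).integrable_mul (hfL _ (hLN i'))).const_mul (if s = 0 then (1 : ℂ) else 0)
    have i3 := ((hLN i).integrable_mul (hfL _ (hLh i'))).const_mul (if s' = 0 then (1 : ℂ) else 0)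
    have i4 : Integrable (fun ω => N ω i * f (N ω i')) P' :=
      (hLN i).integrable_mul (hfL _ (hLN i'))
    have e1 := integral_add (i1.add i2) (i3.add i4)
    simp only [Pi.add_apply, Pi.mul_apply] at e1 i1 i2 i3 i4
    rw [e1, integral_add i1 i2, integral_add i3 i4, integral_const_mul, integral_const_mul,
      integral_const_mul, hcross f i i' hfm, hcross' f i i' hfm]
    ring
  have hconj := hcomp (starRingEnd ℂ) Complex.continuous_conj.measurable (map_add _) (map_zero _)
    (fun Z hZ => hZ.star)
  have hid := hcomp (fun x => x) measurable_id (fun _ _ => rfl) rfl (fun Z hZ => hZ)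
  congr 2
  refine Finset.sum_congr rfl fun a _ => Finset.sum_congr rfl fun a' _ => ?_
  rw [hconj, hid, hNhat.cov, hN.cov, hNhat.pseudoCov, hN.pseudoCov]
  congr 2
  · split_ifs <;> simp <;> ring
  · split_ifs <;> simp <;> ring

/-- Characteristic function of the limiting Taylor coefficients. -/
theorem integral_exp_limitDeriv (hNhat : IsLimitVector σ₁ σ₂ ψ Nhat P')
    (hN : IsLimitVector σ₁ σ₂ ψ N P') (hind : IndepFun Nhat N P') {A : Type*} [Fintype A]
    (j : A → Fin m) (r : A → ℕ) (t : A → ℂ) :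
    ∫ ω, Complex.exp ((∑ a, t a * limitDeriv (Nhat ω (j a)) (N ω (j a)) (r a)).re
        * Complex.I) ∂P' = Complex.exp (-(limitVariance σ₁ σ₂ ψ j r t : ℝ) / 2) := by
  set L : (Fin m → ℂ) × (Fin m → ℂ) → ℝ := fun p =>
    (∑ a, t a * limitDeriv (p.1 (j a)) (p.2 (j a)) (r a)).re with hL
  have hlin : IsLinearMap ℝ L := by
    constructor
    · intro p q
      simp only [hL]
      rw [← Complex.add_re, ← Finset.sum_add_distrib]
      congr 1
      refine Finset.sum_congr rfl fun a _ => ?_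
      simp only [limitDeriv, Prod.fst_add, Prod.snd_add, Pi.add_apply]
      split_ifs <;> ring
    · intro x p
      simp only [hL]
      rw [smul_eq_mul, ← Complex.re_ofReal_mul, Finset.mul_sum]
      congr 1
      refine Finset.sum_congr rfl fun a _ => ?_
      simp only [limitDeriv, Prod.smul_fst, Prod.smul_snd, Pi.smul_apply, Complex.real_smul]
      split_ifs <;> ring
  have hG : HasGaussianLaw (fun ω => L (Nhat ω, N ω)) P' :=
    (hind.hasGaussianLaw hNhat.gaussian hN.gaussian).map_fun
      (LinearMap.toContinuousLinearMap hlin.mk')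
  have hmean : ∫ ω, L (Nhat ω, N ω) ∂P' = 0 := by
    have hi : ∀ a ∈ Finset.univ, Integrable
        (fun ω => t a * limitDeriv (Nhat ω (j a)) (N ω (j a)) (r a)) P' := by
      intro a _
      refine Integrable.const_mul (Integrable.add ?_ (hN.gaussian.eval _).integrable) _
      split_ifs
      · exact (hNhat.gaussian.eval _).integrable
      · exact integrable_zero _ _ _
    have h1 : ∫ ω, L (Nhat ω, N ω) ∂P'
        = (∫ ω, ∑ a, t a * limitDeriv (Nhat ω (j a)) (N ω (j a)) (r a) ∂P').re :=
      integral_re (integrable_finsetSum _ hi)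
    rw [h1, integral_finsetSum _ hi]
    have h2 : ∀ a, ∫ ω, t a * limitDeriv (Nhat ω (j a)) (N ω (j a)) (r a) ∂P' = 0 := by
      intro a
      rw [integral_const_mul]
      have h3 : ∫ ω, limitDeriv (Nhat ω (j a)) (N ω (j a)) (r a) ∂P' = 0 := by
        simp only [limitDeriv]
        split_ifs
        · rw [integral_add (hNhat.gaussian.eval _).integrable (hN.gaussian.eval _).integrable,
            hNhat.mean, hN.mean, add_zero]
        · simp only [zero_add]; exact hN.mean _
      rw [h3, mul_zero]
    simp [h2]
  have hvar : Var[fun ω => L (Nhat ω, N ω); P'] = limitVariance σ₁ σ₂ ψ j r t := by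
    rw [variance_of_integral_eq_zero hG.aemeasurable hmean]
    exact integral_sq_re_sum_limitDeriv hNhat hN hind j r t
  have h1 := hG.charFun_map_eq (1 : ℝ)
  have h2 : ∀ x : ℝ, inner ℝ (1 : ℝ) x = x := fun x => by simp
  have h3 : ∀ x : ℝ, inner ℝ x (1 : ℝ) = x := fun x => by simp
  simp only [h2] at h1
  rw [hmean, hvar, charFun_apply, integral_map hG.aemeasurable (by fun_prop)] at h1
  simp only [h3, Complex.ofReal_zero, zero_mul, zero_sub] at h1
  rw [neg_div]
  exact h1

/-- Characteristic functions of the Taylor coefficients of the scaled polynomials converge. -/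
theorem tendsto_integral_exp_scaledDeriv (hξ_meas : ∀ k, Measurable (ξ k))
    (hξ_indep : iIndepFun ξ P) (hξ_ident : ∀ k, IdentDistrib (ξ k) (ξ 0) P P)
    (h_re : MemLp (fun ω => (ξ 0 ω).re) 2 P) (h_im : MemLp (fun ω => (ξ 0 ω).im) 2 P)
    (h_mean : ∫ ω, ξ 0 ω ∂P = 0)
    (hσ₁ : ∫ ω, (ξ 0 ω).re ^ 2 ∂P = σ₁ ^ 2) (hσ₂ : ∫ ω, (ξ 0 ω).im ^ 2 ∂P = σ₂ ^ 2)
    (h_cov : covariance (fun ω => (ξ 0 ω).re) (fun ω => (ξ 0 ω).im) P = 0)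
    (h : IsCriticalWeight b g c) (hψ_mono : StrictMono ψ)
    (hψ : ∀ i, ψ i ∈ Set.Ico 0 (2 * Real.pi)) {A : Type*} [Fintype A]
    (j : A → Fin m) (r : A → ℕ) (t : A → ℂ) :
    Tendsto (fun n : ℕ => ∫ ω, Complex.exp ((∑ a, t a *
        scaledDeriv b c (ψ (j a)) (r a) n (fun k => ξ k ω)).re * Complex.I) ∂P) atTop
      (𝓝 (Complex.exp (-(limitVariance σ₁ σ₂ ψ j r t : ℝ) / 2))) := by
  have hX : MemLp (ξ 0) 2 P := memLp_of_re_im h_re h_im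
  set α : ℕ → ℕ → ℂ := fun n k => ∑ a, t a * arrayCoeff b c (ψ (j a)) (r a) n k with hα
  have hswap : ∀ n ω, ∑ a, t a * scaledDeriv b c (ψ (j a)) (r a) n (fun k => ξ k ω)
      = ∑ k ∈ Finset.range (n + 1), α n k * ξ k ω := by
    intro n ω
    simp only [scaledDeriv, hα, Finset.mul_sum, Finset.sum_mul]
    rw [Finset.sum_comm]
    exact Finset.sum_congr rfl fun k _ => Finset.sum_congr rfl fun a _ => by ring
  simp_rw [hswap]
  have hprod := fun n => integral_exp_weighted_sum hξ_meas hξ_indep hξ_ident (α n) (n + 1)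
  simp_rw [hprod]
  set τ : ℝ := ∑ a, ‖t a‖ with hτ
  have hτ0 : 0 ≤ τ := Finset.sum_nonneg fun _ _ => norm_nonneg _
  refine tendsto_prod_charFun hX h_mean (C := ∑ a : A, ∑ a' : A, ‖t a'‖ ^ 2 * 3) ?_ ?_ ?_
  · intro ε hε
    have h1 : ∀ᶠ n : ℕ in atTop, ∀ a ∈ Finset.univ, ∀ k ≤ n,
        ‖arrayCoeff b c (ψ (j a)) (r a) n k‖ ≤ ε / (τ + 1) :=
      (Finset.eventually_all _).2 fun a _ =>
        eventually_norm_arrayCoeff_le h (ψ (j a)) (r a) (by positivity)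
    filter_upwards [h1] with n hn k hk
    calc ‖α n k‖ ≤ ∑ a, ‖t a‖ * (ε / (τ + 1)) := by
          refine (norm_sum_le _ _).trans (Finset.sum_le_sum fun a ha => ?_)
          rw [norm_mul]
          gcongr
          exact hn a ha k hk
      _ = τ / (τ + 1) * ε := by rw [← Finset.sum_mul]; ring
      _ ≤ 1 * ε := by
          gcongr
          rw [div_le_one (by positivity)]; linarith
      _ = ε := one_mul ε
  · have h1 : ∀ᶠ n : ℕ in atTop, ∀ a ∈ Finset.univ,
        ∑ k ∈ Finset.range (n + 1), ‖arrayCoeff b c (ψ (j a)) (r a) n k‖ ^ 2 ≤ 3 :=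
      (Finset.eventually_all _).2 fun a _ =>
        eventually_sum_norm_arrayCoeff_sq_le h (ψ (j a)) (r a)
    filter_upwards [h1] with n hn
    calc ∑ k ∈ Finset.range (n + 1), ‖α n k‖ ^ 2
        ≤ ∑ k ∈ Finset.range (n + 1), ∑ _a : A, ∑ a' : A,
          ‖t a'‖ ^ 2 * ‖arrayCoeff b c (ψ (j a')) (r a') n k‖ ^ 2 := by
          refine Finset.sum_le_sum fun k _ => ?_
          have h2 : ‖α n k‖ ≤ ∑ a, ‖t a * arrayCoeff b c (ψ (j a)) (r a) n k‖ := norm_sum_le _ _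
          calc ‖α n k‖ ^ 2 ≤ (∑ a, ‖t a * arrayCoeff b c (ψ (j a)) (r a) n k‖) ^ 2 := by gcongr
            _ ≤ (Finset.univ : Finset A).card
                * ∑ a, ‖t a * arrayCoeff b c (ψ (j a)) (r a) n k‖ ^ 2 := sq_sum_le_card_mul_sum_sq
            _ = _ := by
                rw [Finset.sum_const, nsmul_eq_mul]
                simp_rw [norm_mul, mul_pow]
      _ = ∑ _a : A, ∑ a' : A, ‖t a'‖ ^ 2 * ∑ k ∈ Finset.range (n + 1),
          ‖arrayCoeff b c (ψ (j a')) (r a') n k‖ ^ 2 := by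
          rw [Finset.sum_comm]
          refine Finset.sum_congr rfl fun a _ => ?_
          rw [Finset.sum_comm]
          exact Finset.sum_congr rfl fun a' _ => by rw [Finset.mul_sum]
      _ ≤ _ := by
          refine Finset.sum_le_sum fun a _ => Finset.sum_le_sum fun a' ha' => ?_
          gcongr
          exact hn a' ha'
  · simp_rw [integral_sq_re_mul h_re h_im h_mean hσ₁ hσ₂ h_cov]
    have e : ∀ n : ℕ, ∑ k ∈ Finset.range (n + 1), (((σ₁ ^ 2 + σ₂ ^ 2 : ℝ) : ℂ)
          * (α n k * (starRingEnd ℂ) (α n k))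
          + ((σ₁ ^ 2 - σ₂ ^ 2 : ℝ) : ℂ) * (α n k * α n k)).re / 2
        = (∑ a, ∑ a', (t a * (starRingEnd ℂ) (t a') * (((σ₁ ^ 2 + σ₂ ^ 2 : ℝ) : ℂ) *
          ∑ k ∈ Finset.range (n + 1), arrayCoeff b c (ψ (j a)) (r a) n k
            * arrayCoeff b c (-ψ (j a')) (r a') n k)
          + t a * t a' * (((σ₁ ^ 2 - σ₂ ^ 2 : ℝ) : ℂ) *
          ∑ k ∈ Finset.range (n + 1), arrayCoeff b c (ψ (j a)) (r a) n k
            * arrayCoeff b c (ψ (j a')) (r a') n k))).re / 2 := by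
      intro n
      rw [← Finset.sum_div, ← Complex.re_sum]
      congr 2
      simp only [hα, sum_mul_conj_add_sum_mul_self, conj_arrayCoeff]
      rw [Finset.sum_comm]
      refine Finset.sum_congr rfl fun a _ => ?_
      rw [Finset.sum_comm]
      refine Finset.sum_congr rfl fun a' _ => ?_
      rw [Finset.sum_add_distrib]
      simp only [Finset.mul_sum]
    simp_rw [e]
    refine ((Complex.continuous_re.tendsto _).comp ?_).div_const 2
    refine tendsto_finsetSum _ fun a _ => tendsto_finsetSum _ fun a' _ => ?_
    refine (Tendsto.const_mul _ (Tendsto.const_mul _ ?_)).add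
      (Tendsto.const_mul _ (Tendsto.const_mul _ ?_))
    · have h1 := tendsto_sum_arrayCoeff_mul h (ψ (j a)) (-ψ (j a')) (r a) (r a')
      simp only [← sub_eq_add_neg, exists_sub_eq_two_pi_iff hψ_mono hψ] at h1
      exact h1
    · exact tendsto_sum_arrayCoeff_mul h (ψ (j a)) (ψ (j a')) (r a) (r a')

omit [IsProbabilityMeasure P] in
theorem measurable_scaledDeriv (hξ_meas : ∀ k, Measurable (ξ k)) (θ : ℝ) (r n : ℕ) :
    Measurable fun ω => scaledDeriv b c θ r n (fun k => ξ k ω) := by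
  unfold scaledDeriv
  fun_prop

/-- Finitely many Taylor coefficients of the scaled polynomials converge jointly in law. -/
theorem tendsto_integral_scaledDeriv (hξ_meas : ∀ k, Measurable (ξ k))
    (hξ_indep : iIndepFun ξ P) (hξ_ident : ∀ k, IdentDistrib (ξ k) (ξ 0) P P)
    (h_re : MemLp (fun ω => (ξ 0 ω).re) 2 P) (h_im : MemLp (fun ω => (ξ 0 ω).im) 2 P)
    (h_mean : ∫ ω, ξ 0 ω ∂P = 0)
    (hσ₁ : ∫ ω, (ξ 0 ω).re ^ 2 ∂P = σ₁ ^ 2) (hσ₂ : ∫ ω, (ξ 0 ω).im ^ 2 ∂P = σ₂ ^ 2)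
    (h_cov : covariance (fun ω => (ξ 0 ω).re) (fun ω => (ξ 0 ω).im) P = 0)
    (h : IsCriticalWeight b g c) (hψ_mono : StrictMono ψ)
    (hψ : ∀ i, ψ i ∈ Set.Ico 0 (2 * Real.pi))
    (hNhat : IsLimitVector σ₁ σ₂ ψ Nhat P')
    (hN : IsLimitVector σ₁ σ₂ ψ N P') (hind : IndepFun Nhat N P') {A : Type*} [Fintype A]
    (j : A → Fin m) (r : A → ℕ) {F : (A → ℂ) → ℝ} (hF : Continuous F) {C : ℝ}
    (hFC : ∀ x, |F x| ≤ C) :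
    Tendsto (fun n : ℕ => ∫ ω, F (fun a => scaledDeriv b c (ψ (j a)) (r a) n (fun k => ξ k ω)) ∂P)
      atTop (𝓝 (∫ ω, F (fun a => limitDeriv (Nhat ω (j a)) (N ω (j a)) (r a)) ∂P')) := by
  set V : ℕ → Ω → EuclideanSpace ℂ A := fun n ω =>
    WithLp.toLp 2 fun a => scaledDeriv b c (ψ (j a)) (r a) n (fun k => ξ k ω) with hV
  set Z : Ω' → EuclideanSpace ℂ A := fun ω =>
    WithLp.toLp 2 fun a => limitDeriv (Nhat ω (j a)) (N ω (j a)) (r a) with hZ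
  have hVm : ∀ n, AEMeasurable (V n) P := fun n =>
    ((WithLp.measurable_toLp 2 _).comp
      (measurable_pi_lambda _ fun a => measurable_scaledDeriv hξ_meas _ _ _)).aemeasurable
  have hZm : AEMeasurable Z P' := by
    refine (WithLp.measurable_toLp 2 _).comp_aemeasurable (aemeasurable_pi_lambda _ fun a => ?_)
    simp only [limitDeriv]
    have h1 := (hN.gaussian.eval (j a)).aemeasurable
    have h2 := (hNhat.gaussian.eval (j a)).aemeasurable
    split_ifs
    · exact h2.add h1
    · simpa using h1
  let μ : ℕ → ProbabilityMeasure (EuclideanSpace ℂ A) := fun n =>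
    ⟨P.map (V n), Measure.isProbabilityMeasure_map (hVm n)⟩
  let μ₀ : ProbabilityMeasure (EuclideanSpace ℂ A) :=
    ⟨P'.map Z, Measure.isProbabilityMeasure_map hZm⟩
  have hchar : Tendsto μ atTop (𝓝 μ₀) := by
    refine ProbabilityMeasure.tendsto_of_tendsto_charFun fun t => ?_
    have hinner : ∀ x : A → ℂ, inner ℝ (WithLp.toLp 2 x : EuclideanSpace ℂ A) t
        = (∑ a, (starRingEnd ℂ) (t a) * x a).re := by
      intro x
      rw [PiLp.inner_apply, Complex.re_sum]
      refine Finset.sum_congr rfl fun a _ => ?_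
      rw [Complex.inner]
      simp [Complex.mul_re]
    have e1 : ∀ n, charFun (μ n : Measure (EuclideanSpace ℂ A)) t
        = ∫ ω, Complex.exp ((∑ a, (starRingEnd ℂ) (t a) *
          scaledDeriv b c (ψ (j a)) (r a) n (fun k => ξ k ω)).re * Complex.I) ∂P := by
      intro n
      rw [charFun_apply]
      simp only [μ, ProbabilityMeasure.coe_mk]
      rw [integral_map (hVm n) (by fun_prop)]
      simp only [hV, hinner]
    have e2 : charFun (μ₀ : Measure (EuclideanSpace ℂ A)) t
        = Complex.exp (-(limitVariance σ₁ σ₂ ψ j r fun a => (starRingEnd ℂ) (t a) : ℝ) / 2) := by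
      rw [charFun_apply]
      simp only [μ₀, ProbabilityMeasure.coe_mk]
      rw [integral_map hZm (by fun_prop)]
      simp only [hZ, hinner]
      exact integral_exp_limitDeriv hNhat hN hind j r _
    rw [e2]
    simp_rw [e1]
    exact tendsto_integral_exp_scaledDeriv hξ_meas hξ_indep hξ_ident h_re h_im h_mean hσ₁ hσ₂ h_cov
      h hψ_mono hψ j r _
  rw [ProbabilityMeasure.tendsto_iff_forall_integral_tendsto] at hchar
  have hFc : Continuous fun x : EuclideanSpace ℂ A => F (WithLp.ofLp x) := by fun_prop
  have := hchar (BoundedContinuousFunction.ofNormedAddCommGroup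
    (fun x : EuclideanSpace ℂ A => F (WithLp.ofLp x)) hFc C fun x => hFC _)
  simp only [μ, μ₀, ProbabilityMeasure.coe_mk,
    BoundedContinuousFunction.coe_ofNormedAddCommGroup] at this
  rw [integral_map hZm hFc.aestronglyMeasurable] at this
  refine this.congr fun n => ?_
  rw [integral_map (hVm n) hFc.aestronglyMeasurable]

end FiniteDimensional

/-! ### Convergence in law by approximation -/

open scoped Uniformity in
/-- Approximation of random elements of a uniform space: if `Y M n` converges in law to `W M` as
`n → ∞`, `W M → Z` almost surely, and `X n` is close to `Y M n` in probability for large `M`,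
uniformly in large `n`, then `X n` converges in law to `Z`. -/
theorem convergesInLaw_of_approx {Ω Ω' E : Type*} [MeasurableSpace Ω] [MeasurableSpace Ω']
    {P : Measure Ω} [IsProbabilityMeasure P] {P' : Measure Ω'} [IsProbabilityMeasure P']
    [UniformSpace E] [IsCountablyGenerated (𝓤 E)]
    {X : ℕ → Ω → E} {Y : ℕ → ℕ → Ω → E} {W : ℕ → Ω' → E} {Z : Ω' → E}
    (hX : ∀ n, @AEMeasurable _ _ (borel E) _ (X n) P)
    (hY : ∀ M n, @AEMeasurable _ _ (borel E) _ (Y M n) P)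
    (hW : ∀ M, @AEMeasurable _ _ (borel E) _ (W M) P')
    (hZ : @AEMeasurable _ _ (borel E) _ Z P')
    (hYW : ∀ M (f : E → ℝ) (C : ℝ), Continuous f → (∀ x, |f x| ≤ C) →
      Tendsto (fun n => ∫ ω, f (Y M n ω) ∂P) atTop (𝓝 (∫ ω, f (W M ω) ∂P')))
    (hWZ : ∀ᵐ ω ∂P', Tendsto (fun M => W M ω) atTop (𝓝 (Z ω)))
    (happ : ∀ V ∈ 𝓤 E, ∀ η : ℝ, 0 < η → ∀ᶠ M : ℕ in atTop, ∀ᶠ n : ℕ in atTop,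
      P.real {ω | (X n ω, Y M n ω) ∉ V} ≤ η) :
    ConvergesInLaw X P Z P' := by
  let _ : MeasurableSpace E := borel E
  have _ : BorelSpace E := ⟨rfl⟩
  let _ : PseudoMetricSpace E := UniformSpace.pseudoMetricSpace E
  refine ⟨hX, hZ, ?_⟩
  refine tendsto_iff_forall_lipschitz_integral_tendsto.2 ?_
  rintro f ⟨C, hC⟩ ⟨K, hK⟩
  have hfc : Continuous f := hK.continuous
  have hfm : Measurable f := hfc.measurable
  rcases isEmpty_or_nonempty Ω' with hE | ⟨⟨ω₀⟩⟩
  · exact absurd (Measure.eq_zero_of_isEmpty P') (IsProbabilityMeasure.ne_zero P')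
  have hB : ∀ x, |f x| ≤ C + |f (Z ω₀)| := fun x => by
    have := hC x (Z ω₀)
    rw [Real.dist_eq] at this
    have h2 := abs_add_le (f x - f (Z ω₀)) (f (Z ω₀))
    rw [sub_add_cancel] at h2
    linarith
  have hC0 : 0 ≤ C := dist_nonneg.trans (hC (Z ω₀) (Z ω₀))
  simp only [ProbabilityMeasure.coe_mk]
  rw [integral_map hZ hfc.aestronglyMeasurable]
  simp_rw [fun n => integral_map (hX n) hfc.aestronglyMeasurable]
  -- bounded measurable functions of the variables are integrable
  have hint : ∀ {Ω₁ : Type _} [MeasurableSpace Ω₁] {Q : Measure Ω₁} [IsProbabilityMeasure Q]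
      {U : Ω₁ → E}, AEMeasurable U Q → Integrable (fun ω => f (U ω)) Q := fun hU =>
    Integrable.of_bound (hfm.comp_aemeasurable hU).aestronglyMeasurable _
      (ae_of_all _ fun ω => by rw [Real.norm_eq_abs]; exact hB _)
  have hWZ' : Tendsto (fun M => ∫ ω, f (W M ω) ∂P') atTop (𝓝 (∫ ω, f (Z ω) ∂P')) := by
    refine tendsto_integral_of_dominated_convergence (fun _ => C + |f (Z ω₀)|)
      (fun M => (hfm.comp_aemeasurable (hW M)).aestronglyMeasurable) (integrable_const _)
      (fun M => ae_of_all _ fun ω => by rw [Real.norm_eq_abs]; exact hB _) ?_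
    filter_upwards [hWZ] with ω hω
    exact (hfc.tendsto _).comp hω
  rw [Metric.tendsto_atTop]
  intro ε hε
  set V : Set (E × E) := {p | dist (f p.1) (f p.2) < ε / 8} with hV
  have hVu : V ∈ 𝓤 E := hK.uniformContinuous (Metric.dist_mem_uniformity (by positivity))
  have hη : 0 < ε / (8 * (C + 1)) := by positivity
  obtain ⟨M, hM1, hM2⟩ := ((happ V hVu _ hη).and
    ((Metric.tendsto_nhds.1 hWZ') (ε / 4) (by positivity))).exists
  obtain ⟨n₀, hn₀⟩ := eventually_atTop.1 (hM1.and ((Metric.tendsto_nhds.1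
    (hYW M f _ hfc hB)) (ε / 4) (by positivity)))
  refine ⟨n₀, fun n hn => ?_⟩
  obtain ⟨h1, h2⟩ := hn₀ n hn
  have h3 : dist (∫ ω, f (X n ω) ∂P) (∫ ω, f (Y M n ω) ∂P) ≤ ε / 4 := by
    rw [dist_eq_norm, ← integral_sub (hint (hX n)) (hint (hY M n))]
    set S : Set Ω := {ω | ε / 8 ≤ |f (X n ω) - f (Y M n ω)|} with hS
    have hSm : NullMeasurableSet S P := nullMeasurableSet_le aemeasurable_const
      ((hfm.comp_aemeasurable (hX n)).sub (hfm.comp_aemeasurable (hY M n))).abs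
    have hSV : S = {ω | (X n ω, Y M n ω) ∉ V} := by
      ext ω; simp [hS, hV, Real.dist_eq]
    have hpt : ∀ ω, ‖f (X n ω) - f (Y M n ω)‖ ≤ ε / 8 + S.indicator (fun _ => C) ω := by
      intro ω
      by_cases hω : ω ∈ S
      · rw [Set.indicator_of_mem hω, ← dist_eq_norm]
        linarith [hC (X n ω) (Y M n ω)]
      · rw [Set.indicator_of_notMem hω, add_zero]
        exact (not_le.1 hω).le
    have hind : Integrable (S.indicator fun _ => C) P :=
      (integrable_const C).indicator₀ hSm
    calc ‖∫ ω, (f (X n ω) - f (Y M n ω)) ∂P‖ ≤ ∫ ω, (ε / 8 + S.indicator (fun _ => C) ω) ∂P :=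
          norm_integral_le_of_norm_le ((integrable_const _).add hind) (ae_of_all _ hpt)
      _ = ε / 8 + P.real S * C := by
          rw [integral_add (integrable_const _) hind, integral_indicator₀ hSm]
          simp
      _ ≤ ε / 8 + ε / (8 * (C + 1)) * C := by
          rw [← hSV] at h1
          gcongr
      _ ≤ ε / 8 + ε / 8 := by
          gcongr
          rw [div_mul_eq_mul_div, div_le_div_iff₀ (by positivity) (by positivity)]
          nlinarith
      _ = ε / 4 := by ring
  calc dist (∫ ω, f (X n ω) ∂P) (∫ ω, f (Z ω) ∂P')
      ≤ dist (∫ ω, f (X n ω) ∂P) (∫ ω, f (Y M n ω) ∂P)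
        + dist (∫ ω, f (Y M n ω) ∂P) (∫ ω, f (W M ω) ∂P')
        + dist (∫ ω, f (W M ω) ∂P') (∫ ω, f (Z ω) ∂P') := dist_triangle4 _ _ _ _
    _ < ε / 4 + ε / 4 + ε / 4 := by linarith
    _ ≤ ε := by linarith

/-! ### The uniform structure of the space of entire functions -/

section Uniformity

open scoped Uniformity

instance : IsCountablyGenerated (𝓤 Entire) := by
  have : IsCountablyGenerated (𝓤 C(ℂ, ℂ)) := inferInstance
  rw [uniformity_subtype]
  infer_instance

/-- Entourages of the space of entire functions contain uniform closeness on a large disc. -/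
theorem exists_ball_of_mem_uniformity {ι : Type*} [Finite ι] {V : Set ((ι → Entire) × (ι → Entire))}
    (hV : V ∈ 𝓤 (ι → Entire)) : ∃ R : ℝ, 0 ≤ R ∧ ∃ ε : ℝ, 0 < ε ∧ ∀ f g : ι → Entire,
      (∀ i, ∀ u : ℂ, ‖u‖ ≤ R → dist ((f i).1 u) ((g i).1 u) < ε) → (f, g) ∈ V := by
  have key : ∀ V ∈ 𝓤 Entire, ∃ R : ℝ, 0 ≤ R ∧ ∃ ε : ℝ, 0 < ε ∧ ∀ f g : Entire,
      (∀ u : ℂ, ‖u‖ ≤ R → dist (f.1 u) (g.1 u) < ε) → (f, g) ∈ V := by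
    intro V hV
    rw [uniformity_subtype, mem_comap] at hV
    obtain ⟨V', hV', hVV⟩ := hV
    obtain ⟨K, W, hK, hW, hKW⟩ := ContinuousMap.mem_compactConvergence_entourage_iff V' |>.1 hV'
    obtain ⟨R, hR⟩ := hK.isBounded.subset_closedBall 0
    obtain ⟨ε, hε, hεW⟩ := Metric.mem_uniformity_dist.1 hW
    refine ⟨max R 0, le_max_right _ _, ε, hε, fun f g hfg => hVV (hKW ?_)⟩
    intro u hu
    refine hεW (hfg u ?_)
    have := hR hu
    rw [mem_closedBall_zero_iff] at this
    exact this.trans (le_max_left _ _)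
  rw [Pi.uniformity, mem_iInf_of_finite] at hV
  obtain ⟨s, hs, rfl⟩ := hV
  choose t ht hts using hs
  choose R hR0 ε hε hRε using fun i => key (t i) (ht i)
  obtain ⟨R', hR', hR'0⟩ :=
    ((eventually_all.2 fun i => eventually_ge_atTop (R i)).and (eventually_ge_atTop 0)).exists
  obtain ⟨ε', hε', hε'0⟩ := ((eventually_all.2 fun i => mem_nhdsWithin_of_mem_nhds
    (Iio_mem_nhds (hε i))).and (self_mem_nhdsWithin (s := Set.Ioi (0 : ℝ)))).exists
  refine ⟨R', hR'0, ε', hε'0, fun f g hfg => Set.mem_iInter.2 fun i => hts i ?_⟩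
  exact hRε i _ _ fun u hu => (hfg i u (hu.trans (hR' i))).trans (hε' i)

theorem continuous_entire {T : Type*} [TopologicalSpace T] {F : T → Entire}
    (h : Continuous fun p : T × ℂ => (F p.1).1 p.2) : Continuous F :=
  Continuous.subtype_mk (ContinuousMap.continuous_of_continuous_uncurry (fun t => (F t).1) h) _

end Uniformity

/-! ### Taylor expansion of the scaled polynomials -/

section Taylor

variable {b g : ℝ → ℝ} {c : ℝ}

theorem scaledPoly_apply (x : ℕ → ℂ) (n : ℕ) (θ : ℝ) (u : ℂ) :
    (scaledPoly b c x n θ).1 u = ∑ k ∈ Finset.range (n + 1),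
      arrayCoeff b c θ 0 n k * x k * Complex.exp (u * ((k : ℂ) / n)) := by
  change ((1 / √(bigL b c n) : ℝ) : ℂ) * randPoly b x n (zHat b c n θ u) = _
  rw [randPoly, Finset.mul_sum]
  refine Finset.sum_congr rfl fun k _ => ?_
  have h1 : zHat b c n θ u ^ k = Complex.exp ((tilt b c n * (k / n) / 2 : ℝ) : ℂ)
      * Complex.exp (u * ((k : ℂ) / n)) * Complex.exp (Complex.I * θ) ^ k := by
    rw [zHat, ← Complex.exp_nat_mul, ← Complex.exp_nat_mul, ← Complex.exp_add, ← Complex.exp_add,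
      tilt]
    congr 1
    push_cast
    ring
  rw [h1, arrayCoeff]
  push_cast
  ring

theorem arrayCoeff_eq_mul_pow (θ : ℝ) (r n k : ℕ) :
    arrayCoeff b c θ r n k = arrayCoeff b c θ 0 n k * ((k : ℂ) / n) ^ r := by
  simp only [arrayCoeff]
  push_cast
  ring

/-- Taylor expansion of the scaled polynomials at `u = 0`. -/
theorem hasSum_scaledPoly (x : ℕ → ℂ) (n : ℕ) (θ : ℝ) (u : ℂ) :
    HasSum (fun r : ℕ => u ^ r / r.factorial * scaledDeriv b c θ r n x)
      ((scaledPoly b c x n θ).1 u) := by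
  rw [scaledPoly_apply]
  have h1 : ∀ r : ℕ, u ^ r / r.factorial * scaledDeriv b c θ r n x
      = ∑ k ∈ Finset.range (n + 1), arrayCoeff b c θ 0 n k * x k *
        ((u * ((k : ℂ) / n)) ^ r / r.factorial) := by
    intro r
    rw [scaledDeriv, Finset.mul_sum]
    refine Finset.sum_congr rfl fun k _ => ?_
    rw [arrayCoeff_eq_mul_pow, mul_pow]
    ring
  simp_rw [h1]
  refine hasSum_sum fun k _ => HasSum.mul_left _ ?_
  rw [Complex.exp_eq_exp_ℂ]
  exact NormedSpace.expSeries_div_hasSum_exp _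

/-- The vector of polynomials of degree `< M` with prescribed derivatives at `0`. -/
noncomputable def taylorMap {ι : Type*} (M : ℕ) (a : ι × Fin M → ℂ) (i : ι) : Entire :=
  Entire.of (fun u => ∑ r : Fin M, u ^ (r : ℕ) / (r : ℕ).factorial * a (i, r)) (by fun_prop)

theorem continuous_taylorMap {ι : Type*} (M : ℕ) : Continuous (taylorMap (ι := ι) M) := by
  refine continuous_pi fun i => continuous_entire ?_
  simp only [taylorMap, Entire.of, ContinuousMap.coe_mk]
  fun_prop

theorem enorm_sub_taylorMap_le {ι : Type*} (M : ℕ) (f : Entire) (a : ι → ℕ → ℂ) (i : ι)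
    {u : ℂ} (h : HasSum (fun r : ℕ => u ^ r / r.factorial * a i r) (f.1 u)) {R : ℝ}
    (hu : ‖u‖ ≤ R) :
    ‖f.1 u - (taylorMap M (fun p : ι × Fin M => a p.1 p.2) i).1 u‖ₑ
      ≤ ∑' r : ℕ, ENNReal.ofReal (R ^ (r + M) / (r + M).factorial) * ‖a i (r + M)‖ₑ := by
  have h1 := (hasSum_nat_add_iff' M).2 h
  have h2 : (taylorMap M (fun p : ι × Fin M => a p.1 p.2) i).1 u
      = ∑ r ∈ Finset.range M, u ^ r / r.factorial * a i r := by
    rw [← Fin.sum_univ_eq_sum_range (fun r => u ^ r / r.factorial * a i r)]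
    rfl
  rw [h2, ← h1.tsum_eq]
  refine enorm_tsum_le_tsum_enorm.trans (ENNReal.tsum_le_tsum fun r => ?_)
  rw [enorm_mul]
  gcongr
  rw [← ofReal_norm, norm_div, norm_pow, Complex.norm_natCast]
  gcongr

theorem hasSum_limitFunction (p q u : ℂ) :
    HasSum (fun r : ℕ => u ^ r / r.factorial * limitDeriv p q r) ((limitFunction p q).1 u) := by
  have h1 : HasSum (fun r : ℕ => u ^ r / r.factorial * q) (Complex.exp u * q) := by
    rw [Complex.exp_eq_exp_ℂ]
    exact (NormedSpace.expSeries_div_hasSum_exp u).mul_right q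
  have h2 : HasSum (fun r : ℕ => u ^ r / r.factorial * (if r = 0 then p else 0)) p := by
    have := hasSum_ite_eq (0 : ℕ) p
    refine this.congr_fun ?_ |> fun h => h
    intro r
    split_ifs with hr
    · subst hr; simp
    · simp
  refine (h2.add h1).congr_fun fun r => ?_
  rw [limitDeriv, mul_add]

/-- The variance bound for `r = 0` holds for every order `r`, because `(k / n) ^ r ≤ 1`. -/
theorem eventually_sum_norm_arrayCoeff_sq_le_uniform (h : IsCriticalWeight b g c) (θ : ℝ) :
    ∀ᶠ n : ℕ in atTop, ∀ r, ∑ k ∈ Finset.range (n + 1), ‖arrayCoeff b c θ r n k‖ ^ 2 ≤ 3 := by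
  filter_upwards [eventually_sum_norm_arrayCoeff_sq_le h θ 0] with n hn r
  refine le_trans (Finset.sum_le_sum fun k hk => ?_) hn
  rw [arrayCoeff_eq_mul_pow, norm_mul, norm_pow, norm_div, Complex.norm_natCast,
    Complex.norm_natCast]
  have hk' : (k : ℝ) ≤ n := by exact_mod_cast Nat.lt_succ_iff.1 (Finset.mem_range.1 hk)
  have h1 : ((k : ℝ) / n) ^ r ≤ 1 := pow_le_one₀ (by positivity) (div_le_one_of_le₀ hk' (by positivity))
  gcongr
  exact mul_le_of_le_one_right (norm_nonneg _) h1

end Taylor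

/-! ### Moment bound for the Taylor coefficients -/

section Moments

variable {Ω : Type*} [MeasurableSpace Ω] {P : Measure Ω} [IsProbabilityMeasure P]
  {ξ : ℕ → Ω → ℂ} {σ₁ σ₂ : ℝ}

theorem integral_sq_re_weighted_sum_le
    (hξ_indep : iIndepFun ξ P) (hξ_ident : ∀ k, IdentDistrib (ξ k) (ξ 0) P P)
    (h_re : MemLp (fun ω => (ξ 0 ω).re) 2 P) (h_im : MemLp (fun ω => (ξ 0 ω).im) 2 P)
    (h_mean : ∫ ω, ξ 0 ω ∂P = 0)
    (hσ₁ : ∫ ω, (ξ 0 ω).re ^ 2 ∂P = σ₁ ^ 2) (hσ₂ : ∫ ω, (ξ 0 ω).im ^ 2 ∂P = σ₂ ^ 2)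
    (a : ℕ → ℂ) (s : Finset ℕ) :
    MemLp (fun ω => (∑ k ∈ s, a k * ξ k ω).re) 2 P ∧
    ∫ ω, (∑ k ∈ s, a k * ξ k ω).re ^ 2 ∂P ≤ (σ₁ ^ 2 + σ₂ ^ 2) * ∑ k ∈ s, ‖a k‖ ^ 2 := by
  set Y : ℕ → Ω → ℝ := fun k ω => (a k * ξ k ω).re with hY
  have hX : MemLp (ξ 0) 2 P := memLp_of_re_im h_re h_im
  have hid : ∀ k, IdentDistrib (Y k) (fun ω => (a k * ξ 0 ω).re) P P := fun k =>
    (hξ_ident k).comp (u := fun z => (a k * z).re) (by fun_prop)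
  have hY0 : ∀ k, MemLp (fun ω => (a k * ξ 0 ω).re) 2 P := fun k => (hX.const_mul (a k)).re
  have hYL : ∀ k, MemLp (Y k) 2 P := fun k => (hid k).memLp_iff.2 (hY0 k)
  have hYm0 : ∀ k, ∫ ω, (a k * ξ 0 ω).re ∂P = 0 := fun k => by
    have h1 : ∫ ω, (a k * ξ 0 ω).re ∂P = (∫ ω, a k * ξ 0 ω ∂P).re :=
      integral_re ((hX.integrable one_le_two).const_mul _)
    rw [h1, integral_const_mul, h_mean, mul_zero, Complex.zero_re]
  have hYm : ∀ k, ∫ ω, Y k ω ∂P = 0 := fun k => (hid k).integral_eq.trans (hYm0 k)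
  have hYi : iIndepFun Y P := hξ_indep.comp (fun k z => (a k * z).re) fun k => by fun_prop
  have hsum : (fun ω => (∑ k ∈ s, a k * ξ k ω).re) = ∑ k ∈ s, Y k := by
    ext ω
    simp only [hY, Complex.re_sum, Finset.sum_apply]
  have hL : MemLp (∑ k ∈ s, Y k) 2 P := memLp_finsetSum' _ fun k _ => hYL k
  refine ⟨hsum ▸ hL, ?_⟩
  have hm : ∫ ω, (∑ k ∈ s, Y k) ω ∂P = 0 := by
    simp only [Finset.sum_apply]
    rw [integral_finsetSum _ fun k _ => (hYL k).integrable one_le_two]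
    exact Finset.sum_eq_zero fun k _ => hYm k
  have h1 : ∫ ω, (∑ k ∈ s, a k * ξ k ω).re ^ 2 ∂P = Var[∑ k ∈ s, Y k; P] := by
    rw [variance_of_integral_eq_zero hL.aestronglyMeasurable.aemeasurable hm, ← hsum]
  rw [h1, IndepFun.variance_sum (fun k _ => hYL k) fun i _ j _ hij => hYi.indepFun hij,
    Finset.mul_sum]
  refine Finset.sum_le_sum fun k _ => ?_
  rw [(hid k).variance_eq, variance_of_integral_eq_zero
    (hY0 k).aestronglyMeasurable.aemeasurable (hYm0 k)]
  have h2 : ∀ ω, (a k * ξ 0 ω).re ^ 2 ≤ ‖a k‖ ^ 2 * ((ξ 0 ω).re ^ 2 + (ξ 0 ω).im ^ 2) := by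
    intro ω
    have h3 : |(a k * ξ 0 ω).re| ≤ ‖a k * ξ 0 ω‖ := Complex.abs_re_le_norm _
    have h4 : ‖ξ 0 ω‖ ^ 2 = (ξ 0 ω).re ^ 2 + (ξ 0 ω).im ^ 2 := by
      rw [← Complex.normSq_eq_norm_sq, Complex.normSq_apply]; ring
    rw [← h4, ← mul_pow, ← norm_mul, ← sq_abs]
    gcongr
  calc ∫ ω, (a k * ξ 0 ω).re ^ 2 ∂P
      ≤ ∫ ω, ‖a k‖ ^ 2 * ((ξ 0 ω).re ^ 2 + (ξ 0 ω).im ^ 2) ∂P :=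
        integral_mono (hY0 k).integrable_sq
          ((h_re.integrable_sq.add h_im.integrable_sq).const_mul _) h2
    _ = (σ₁ ^ 2 + σ₂ ^ 2) * ‖a k‖ ^ 2 := by
        rw [integral_const_mul, integral_add h_re.integrable_sq h_im.integrable_sq, hσ₁, hσ₂]
        ring

theorem lintegral_enorm_weighted_sum_le
    (hξ_indep : iIndepFun ξ P) (hξ_ident : ∀ k, IdentDistrib (ξ k) (ξ 0) P P)
    (h_re : MemLp (fun ω => (ξ 0 ω).re) 2 P) (h_im : MemLp (fun ω => (ξ 0 ω).im) 2 P)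
    (h_mean : ∫ ω, ξ 0 ω ∂P = 0)
    (hσ₁ : ∫ ω, (ξ 0 ω).re ^ 2 ∂P = σ₁ ^ 2) (hσ₂ : ∫ ω, (ξ 0 ω).im ^ 2 ∂P = σ₂ ^ 2)
    (a : ℕ → ℂ) (s : Finset ℕ) :
    ∫⁻ ω, ‖∑ k ∈ s, a k * ξ k ω‖ₑ ∂P
      ≤ ENNReal.ofReal (1 + 2 * ((σ₁ ^ 2 + σ₂ ^ 2) * ∑ k ∈ s, ‖a k‖ ^ 2)) := by
  obtain ⟨i1, h1⟩ := integral_sq_re_weighted_sum_le hξ_indep hξ_ident h_re h_im h_mean hσ₁ hσ₂ a s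
  obtain ⟨i2, h2⟩ := integral_sq_re_weighted_sum_le hξ_indep hξ_ident h_re h_im h_mean hσ₁ hσ₂
    (fun k => -Complex.I * a k) s
  have e : ∀ ω, (∑ k ∈ s, -Complex.I * a k * ξ k ω).re = (∑ k ∈ s, a k * ξ k ω).im := by
    intro ω
    simp_rw [mul_assoc]
    rw [← Finset.mul_sum]
    simp
  simp_rw [e] at i2 h2
  simp only [norm_mul, norm_neg, Complex.norm_I, one_mul] at h2
  set S : Ω → ℂ := fun ω => ∑ k ∈ s, a k * ξ k ω
  have hi : Integrable (fun ω => 1 + ((S ω).re ^ 2 + (S ω).im ^ 2)) P :=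
    (integrable_const 1).add (i1.integrable_sq.add i2.integrable_sq)
  calc ∫⁻ ω, ‖S ω‖ₑ ∂P ≤ ∫⁻ ω, ENNReal.ofReal (1 + ((S ω).re ^ 2 + (S ω).im ^ 2)) ∂P := by
        refine lintegral_mono fun ω => ?_
        rw [← ofReal_norm]
        apply ENNReal.ofReal_le_ofReal
        have h4 : ‖S ω‖ ^ 2 = (S ω).re ^ 2 + (S ω).im ^ 2 := by
          rw [← Complex.normSq_eq_norm_sq, Complex.normSq_apply]; ring
        rw [← h4]
        nlinarith [sq_nonneg (‖S ω‖ - 1)]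
    _ = ENNReal.ofReal (∫ ω, (1 + ((S ω).re ^ 2 + (S ω).im ^ 2)) ∂P) :=
        (ofReal_integral_eq_lintegral_ofReal hi (ae_of_all _ fun ω => by
          simp only [Pi.zero_apply]; positivity)).symm
    _ ≤ _ := by
        apply ENNReal.ofReal_le_ofReal
        have i3 : Integrable (fun ω => (S ω).re ^ 2) P := i1.integrable_sq
        have i4 : Integrable (fun ω => (S ω).im ^ 2) P := i2.integrable_sq
        rw [integral_add (integrable_const 1) (by exact i3.add i4), integral_add i3 i4]
        simp only [integral_const, probReal_univ, smul_eq_mul, one_mul]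
        linarith

end Moments

/-! ### Functional convergence -/

section Functional

theorem aemeasurable_scaledPoly {Ω : Type*} [MeasurableSpace Ω] (P : Measure Ω)
    {ξ : ℕ → Ω → ℂ} (hξ_meas : ∀ k, Measurable (ξ k)) (b : ℝ → ℝ) (c : ℝ) {ι : Type*}
    (ψ : ι → ℝ) (n : ℕ) :
    @AEMeasurable _ _ (borel (ι → Entire)) _
      (fun ω i => scaledPoly b c (fun k => ξ k ω) n (ψ i)) P := by
  let _ : MeasurableSpace (ι → Entire) := borel _
  have _ : BorelSpace (ι → Entire) := ⟨rfl⟩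
  have h1 : Continuous fun (x : ℕ → ℂ) i => scaledPoly b c x n (ψ i) := by
    refine continuous_pi fun i => continuous_entire ?_
    simp only [scaledPoly_apply]
    fun_prop
  exact (h1.measurable.comp (measurable_pi_lambda _ hξ_meas)).aemeasurable

theorem continuous_limitFunction {ι : Type*} :
    Continuous fun (p : (ι → ℂ) × (ι → ℂ)) i => limitFunction (p.1 i) (p.2 i) := by
  refine continuous_pi fun i => continuous_entire ?_
  simp only [limitFunction, Entire.of, ContinuousMap.coe_mk]
  fun_prop

theorem aemeasurable_limitFunction {Ω' : Type*} [MeasurableSpace Ω'] {P' : Measure Ω'}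
    {ι : Type*} [Countable ι] {Nhat N : Ω' → ι → ℂ} (h1 : AEMeasurable Nhat P')
    (h2 : AEMeasurable N P') :
    @AEMeasurable _ _ (borel (ι → Entire)) _
      (fun ω i => limitFunction (Nhat ω i) (N ω i)) P' := by
  let _ : MeasurableSpace (ι → Entire) := borel _
  have _ : BorelSpace (ι → Entire) := ⟨rfl⟩
  exact continuous_limitFunction.measurable.comp_aemeasurable (h1.prodMk h2)

theorem aemeasurable_taylorMap {Ω : Type*} [MeasurableSpace Ω] {P : Measure Ω} {ι : Type*}
    [Countable ι] (M : ℕ) {a : Ω → ι × Fin M → ℂ} (ha : AEMeasurable a P) :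
    @AEMeasurable _ _ (borel (ι → Entire)) _ (fun ω => taylorMap M (a ω)) P := by
  let _ : MeasurableSpace (ι → Entire) := borel _
  have _ : BorelSpace (ι → Entire) := ⟨rfl⟩
  exact (continuous_taylorMap M).measurable.comp_aemeasurable ha

/-- The tail of the exponential series at `R ≥ 0`. -/
noncomputable def expTail (R : ℝ) (M : ℕ) : ENNReal :=
  ∑' r : ℕ, ENNReal.ofReal (R ^ (r + M) / (r + M).factorial)

theorem tendsto_const_mul_expTail {R : ℝ} (hR : 0 ≤ R) {C : ENNReal} (hC : C ≠ ⊤) :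
    Tendsto (fun M => C * expTail R M) atTop (𝓝 0) := by
  have h1 : Tendsto (expTail R) atTop (𝓝 0) := by
    refine ENNReal.tendsto_sum_nat_add (fun r => ENNReal.ofReal (R ^ r / r.factorial)) ?_
    rw [← ENNReal.ofReal_tsum_of_nonneg (fun r => by positivity)
      (Real.summable_pow_div_factorial R)]
    exact ENNReal.ofReal_ne_top
  simpa using ENNReal.Tendsto.const_mul h1 (Or.inr hC)

/-- Pathwise, the Taylor polynomials of `u ↦ p + exp u * q` converge locally uniformly. -/
theorem tendsto_taylorMap_limitDeriv {m : ℕ} (p q : Fin m → ℂ) :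
    Tendsto (fun M => taylorMap M fun a : Fin m × Fin M => limitDeriv (p a.1) (q a.1) a.2) atTop
      (𝓝 fun i => limitFunction (p i) (q i)) := by
  rw [Uniform.tendsto_nhds_right, tendsto_def]
  intro V hV
  obtain ⟨R, hR, ε, hε, hRε⟩ := exists_ball_of_mem_uniformity hV
  have h1 : ∀ i, ∀ᶠ M : ℕ in atTop, (‖p i‖ₑ + ‖q i‖ₑ) * expTail R M < ENNReal.ofReal ε :=
    fun i => (tendsto_const_mul_expTail hR (by simp)).eventually
      (gt_mem_nhds (ENNReal.ofReal_pos.2 hε))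
  filter_upwards [eventually_all.2 h1] with M hM
  refine hRε _ _ fun i u hu => ?_
  have h2 := enorm_sub_taylorMap_le M (limitFunction (p i) (q i))
    (fun i => limitDeriv (p i) (q i)) i (hasSum_limitFunction (p i) (q i) u) hu
  rw [dist_eq_norm, ← ENNReal.ofReal_lt_ofReal_iff hε, ofReal_norm]
  refine (h2.trans ?_).trans_lt (hM i)
  rw [expTail, mul_comm, ← ENNReal.tsum_mul_right]
  refine ENNReal.tsum_le_tsum fun r => ?_
  gcongr
  rw [limitDeriv]
  refine (enorm_add_le _ _).trans ?_
  gcongr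
  split_ifs <;> simp

/-- Convergence in law in the space of entire functions: the Taylor coefficients converge jointly,
and the Taylor remainders are small on discs, in probability, uniformly in large `n`. -/
theorem convergesInLaw_scaledPoly {Ω : Type*} [MeasurableSpace Ω] {P : Measure Ω}
    [IsProbabilityMeasure P] {ξ : ℕ → Ω → ℂ} {σ₁ σ₂ : ℝ} {b g : ℝ → ℝ} {c : ℝ} {m : ℕ}
    {ψ : Fin m → ℝ} {Ω' : Type*} [MeasurableSpace Ω'] {P' : Measure Ω'} [IsProbabilityMeasure P']
    {Nhat N : Ω' → Fin m → ℂ} (hξ_meas : ∀ k, Measurable (ξ k))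
    (hξ_indep : iIndepFun ξ P) (hξ_ident : ∀ k, IdentDistrib (ξ k) (ξ 0) P P)
    (h_re : MemLp (fun ω => (ξ 0 ω).re) 2 P) (h_im : MemLp (fun ω => (ξ 0 ω).im) 2 P)
    (h_mean : ∫ ω, ξ 0 ω ∂P = 0)
    (hσ₁ : ∫ ω, (ξ 0 ω).re ^ 2 ∂P = σ₁ ^ 2) (hσ₂ : ∫ ω, (ξ 0 ω).im ^ 2 ∂P = σ₂ ^ 2)
    (h_cov : covariance (fun ω => (ξ 0 ω).re) (fun ω => (ξ 0 ω).im) P = 0)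
    (h : IsCriticalWeight b g c) (hψ_mono : StrictMono ψ)
    (hψ : ∀ i, ψ i ∈ Set.Ico 0 (2 * Real.pi))
    (hNhat : IsLimitVector σ₁ σ₂ ψ Nhat P')
    (hN : IsLimitVector σ₁ σ₂ ψ N P') (hind : IndepFun Nhat N P') :
    ConvergesInLaw (fun n ω (i : Fin m) => scaledPoly b c (fun k => ξ k ω) n (ψ i)) P
      (fun ω' (i : Fin m) => limitFunction (Nhat ω' i) (N ω' i)) P' := by
  -- Taylor polynomials of the scaled polynomials and of the limit
  refine convergesInLaw_of_approx
    (Y := fun M n ω => taylorMap M fun p : Fin m × Fin M =>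
      scaledDeriv b c (ψ p.1) p.2 n (fun k => ξ k ω))
    (W := fun M ω => taylorMap M fun p : Fin m × Fin M =>
      limitDeriv (Nhat ω p.1) (N ω p.1) p.2)
    (aemeasurable_scaledPoly P hξ_meas b c ψ) (fun M n => ?_) (fun M => ?_)
    (aemeasurable_limitFunction hNhat.gaussian.aemeasurable hN.gaussian.aemeasurable)
    (fun M f C hf hfC => ?_) (ae_of_all _ fun ω => ?_) (fun V hV η hη => ?_)
  · exact aemeasurable_taylorMap M (measurable_pi_lambda _ fun p =>
      measurable_scaledDeriv hξ_meas _ _ _).aemeasurable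
  · refine aemeasurable_taylorMap M (aemeasurable_pi_lambda _ fun p => ?_)
    simp only [limitDeriv]
    have h1 := (hN.gaussian.eval p.1).aemeasurable
    have h2 := (hNhat.gaussian.eval p.1).aemeasurable
    split_ifs
    · exact h2.add h1
    · simpa using h1
  · exact tendsto_integral_scaledDeriv hξ_meas hξ_indep hξ_ident h_re h_im h_mean hσ₁ hσ₂ h_cov h
      hψ_mono hψ hNhat hN hind (fun p : Fin m × Fin M => p.1) (fun p => (p.2 : ℕ))
      (F := fun a => f (taylorMap M a)) (hf.comp (continuous_taylorMap M)) fun a => hfC _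
  · exact tendsto_taylorMap_limitDeriv _ _
  · obtain ⟨R, hR, ε, hε, hRε⟩ := exists_ball_of_mem_uniformity hV
    set K : ENNReal := ENNReal.ofReal (1 + 2 * ((σ₁ ^ 2 + σ₂ ^ 2) * 3)) with hK
    have hε' : ENNReal.ofReal ε ≠ 0 := (ENNReal.ofReal_pos.2 hε).ne'
    filter_upwards [(tendsto_const_mul_expTail hR (C := m * (K / ENNReal.ofReal ε))
      (ENNReal.mul_ne_top (by simp) (ENNReal.div_ne_top ENNReal.ofReal_ne_top hε'))).eventually
      (gt_mem_nhds (ENNReal.ofReal_pos.2 hη))] with M hM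
    filter_upwards [eventually_all.2 fun i =>
      eventually_sum_norm_arrayCoeff_sq_le_uniform h (ψ i)] with n hn
    set S : Fin m → Ω → ENNReal := fun i ω => ∑' r : ℕ,
      ENNReal.ofReal (R ^ (r + M) / (r + M).factorial) *
        ‖scaledDeriv b c (ψ i) (r + M) n (fun k => ξ k ω)‖ₑ with hS
    have hSm : ∀ i r, Measurable fun ω => ENNReal.ofReal (R ^ (r + M) / (r + M).factorial) *
        ‖scaledDeriv b c (ψ i) (r + M) n (fun k => ξ k ω)‖ₑ := fun i r =>
      (measurable_scaledDeriv hξ_meas _ _ _).enorm.const_mul _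
    have hSint : ∀ i, ∫⁻ ω, S i ω ∂P ≤ K * expTail R M := by
      intro i
      rw [lintegral_tsum fun r => (hSm i r).aemeasurable, expTail, ← ENNReal.tsum_mul_left]
      refine ENNReal.tsum_le_tsum fun r => ?_
      rw [lintegral_const_mul _ (measurable_scaledDeriv hξ_meas _ _ _).enorm, mul_comm]
      gcongr
      refine (lintegral_enorm_weighted_sum_le hξ_indep hξ_ident h_re h_im h_mean hσ₁ hσ₂ _ _).trans
        (ENNReal.ofReal_le_ofReal ?_)
      have := hn i (r + M)
      gcongr
    have hsub : {ω | ((fun i => scaledPoly b c (fun k => ξ k ω) n (ψ i)),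
        taylorMap M fun p : Fin m × Fin M => scaledDeriv b c (ψ p.1) p.2 n (fun k => ξ k ω)) ∉ V}
        ⊆ ⋃ i, {ω | ENNReal.ofReal ε ≤ S i ω} := by
      intro ω hω
      by_contra hcon
      simp only [Set.mem_iUnion, Set.mem_ofPred_eq, not_exists, not_le] at hcon
      refine hω (hRε _ _ fun i u hu => ?_)
      rw [dist_eq_norm, ← ENNReal.ofReal_lt_ofReal_iff hε, ofReal_norm]
      exact (enorm_sub_taylorMap_le M _
        (fun i r => scaledDeriv b c (ψ i) r n (fun k => ξ k ω)) i
        (hasSum_scaledPoly _ n (ψ i) u) hu).trans_lt (hcon i)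
    refine ENNReal.toReal_le_of_le_ofReal hη.le (le_trans ?_ hM.le)
    calc _ ≤ P (⋃ i, {ω | ENNReal.ofReal ε ≤ S i ω}) := measure_mono hsub
      _ ≤ ∑ i, P {ω | ENNReal.ofReal ε ≤ S i ω} := measure_iUnion_fintype_le _ _
      _ ≤ ∑ _i : Fin m, K * expTail R M / ENNReal.ofReal ε := by
          refine Finset.sum_le_sum fun i _ => ?_
          refine (meas_ge_le_lintegral_div (Measurable.tsum (hSm i)).aemeasurable hε'
            ENNReal.ofReal_ne_top).trans ?_
          gcongr
          exact hSint i
      _ = m * (K / ENNReal.ofReal ε) * expTail R M := by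
          rw [Finset.sum_const, Finset.card_univ, Fintype.card_fin, nsmul_eq_mul]
          simp only [div_eq_mul_inv]
          ring

end Functional

/-! ### Counting zeros by Jensen's formula -/

section Hurwitz

theorem Entire.analyticOnNhd (f : Entire) (s : Set ℂ) : AnalyticOnNhd ℂ f.1 s :=
  fun z _ => f.2.analyticAt z

theorem zeroMeasure_apply (f : Entire) {B : Set ℂ} (hB : MeasurableSet B) {S : Finset ℂ}
    (hS : ∀ z ∈ B, analyticOrderNatAt f.1 z ≠ 0 → z ∈ S) (hSB : ∀ z ∈ S, z ∈ B) :
    zeroMeasure f.1 B = ((∑ z ∈ S, analyticOrderNatAt f.1 z : ℕ) : ENNReal) := by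
  rw [zeroMeasure, Measure.sum_apply _ hB, tsum_eq_sum (s := S)]
  · push_cast
    refine Finset.sum_congr rfl fun z hz => ?_
    simp [Measure.dirac_apply' _ hB, hSB z hz]
  · intro z hz
    by_cases hzB : z ∈ B
    · have : analyticOrderNatAt f.1 z = 0 := by
        by_contra h
        exact hz (hS z hzB h)
      simp [this]
    · simp [Measure.dirac_apply' _ hB, hzB]

theorem analyticOrderNatAt_eq_zero_of_ne (f : Entire) {z : ℂ} (h : f.1 z ≠ 0) :
    analyticOrderNatAt f.1 z = 0 := by
  by_contra h'
  exact h (apply_eq_zero_of_analyticOrderNatAt_ne_zero h')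

theorem zeroMeasure_eq_zero (f : Entire) {B : Set ℂ} (hB : MeasurableSet B)
    (h : ∀ z ∈ B, f.1 z ≠ 0) : zeroMeasure f.1 B = 0 := by
  rw [zeroMeasure_apply f hB (S := ∅)
    (fun z hz h0 => absurd (analyticOrderNatAt_eq_zero_of_ne f (h z hz)) h0) (by simp)]
  simp

theorem divisor_apply_entire (f : Entire) {U : Set ℂ} {z : ℂ} (hz : z ∈ U) :
    MeromorphicOn.divisor f.1 U z = analyticOrderNatAt f.1 z := by
  rw [MeromorphicOn.AnalyticOnNhd.divisor_apply (f.analyticOnNhd U) hz, analyticOrderNatAt]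
  cases analyticOrderAt f.1 z using ENat.recTopCoe <;> rfl

/-- Jensen's formula on two concentric circles bounding a zero-free annulus counts the zeros inside
the smaller one. -/
theorem circleAverage_log_norm_sub (f : Entire) (c : ℂ) {r R : ℝ} (hr : 0 < r) (hrR : r < R)
    (h : ∀ z, r ≤ dist z c → dist z c ≤ R → f.1 z ≠ 0) :
    Real.circleAverage (fun z => Real.log ‖f.1 z‖) c R
      - Real.circleAverage (fun z => Real.log ‖f.1 z‖) c r
      = (zeroMeasure f.1 (Metric.ball c r)).toReal * Real.log (R / r) := by
  have hR : 0 < R := hr.trans hrR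
  set S : Finset ℂ := (finite_support_order f (Metric.isBounded_ball (x := c) (r := r))).toFinset
    with hS
  have hmem : ∀ z, z ∈ S ↔ z ∈ Metric.ball c r ∧ analyticOrderNatAt f.1 z ≠ 0 := fun z => by
    simp [hS]
  rw [zeroMeasure_apply f measurableSet_ball (S := S) (fun z h1 h2 => (hmem z).2 ⟨h1, h2⟩)
    (fun z hz => ((hmem z).1 hz).1), ENNReal.toReal_natCast]
  -- Jensen's formula with the sum restricted to `S`
  have key : ∀ ρ, r ≤ ρ → ρ ≤ R → Real.circleAverage (fun z => Real.log ‖f.1 z‖) c ρ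
      = ∑ u ∈ S, (analyticOrderNatAt f.1 u : ℝ) * Real.log (ρ * ‖c - u‖⁻¹)
        + analyticOrderNatAt f.1 c * Real.log ρ
        + Real.log ‖meromorphicTrailingCoeffAt f.1 c‖ := by
    intro ρ h1 h2
    have hρ : 0 < ρ := hr.trans_le h1
    rw [MeromorphicOn.circleAverage_log_norm hρ.ne' (f.analyticOnNhd _).meromorphicOn,
      divisor_apply_entire f (Metric.mem_closedBall_self (abs_nonneg ρ)), Int.cast_natCast]
    congr 2
    rw [finsum_eq_sum_of_support_subset (s := S)]
    · refine Finset.sum_congr rfl fun u hu => ?_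
      rw [divisor_apply_entire, Int.cast_natCast]
      rw [abs_of_pos hρ]
      exact (Metric.mem_ball.1 ((hmem u).1 hu).1).le.trans h1
    · intro u hu
      by_cases hu' : u ∈ Metric.closedBall c |ρ|
      · rw [Function.mem_support, divisor_apply_entire f hu', Int.cast_natCast] at hu
        have h3 : analyticOrderNatAt f.1 u ≠ 0 := fun h0 => hu (by simp [h0])
        refine (hmem u).2 ⟨?_, h3⟩
        by_contra hcon
        rw [Metric.mem_ball, not_lt] at hcon
        rw [abs_of_pos hρ, Metric.mem_closedBall] at hu'
        exact h u hcon (hu'.trans h2) (apply_eq_zero_of_analyticOrderNatAt_ne_zero h3)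
      · exact absurd (by simp [Function.locallyFinsuppWithin.apply_eq_zero_of_notMem _ hu']) hu
  rw [key R hrR.le le_rfl, key r le_rfl hrR.le, Real.log_div hR.ne' hr.ne']
  -- the centre contributes only through the second term, since `log (ρ * 0⁻¹) = 0`
  have hsplit : ∀ u ∈ S, (analyticOrderNatAt f.1 u : ℝ) * Real.log (R * ‖c - u‖⁻¹)
      = (analyticOrderNatAt f.1 u : ℝ) * Real.log (r * ‖c - u‖⁻¹)
        + (analyticOrderNatAt f.1 u : ℝ) * (Real.log R - Real.log r)
        - (if u = c then (analyticOrderNatAt f.1 u : ℝ) * (Real.log R - Real.log r) else 0) := by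
    intro u _
    split_ifs with huc
    · simp [huc]
    · have h1 : ‖c - u‖⁻¹ ≠ 0 := inv_ne_zero (norm_ne_zero_iff.2 (sub_ne_zero.2 (Ne.symm huc)))
      rw [Real.log_mul hR.ne' h1, Real.log_mul hr.ne' h1]
      ring
  rw [Finset.sum_congr rfl hsplit, Finset.sum_sub_distrib, Finset.sum_add_distrib,
    Finset.sum_ite_eq' S c, ← Finset.sum_mul]
  have hc : (if c ∈ S then (analyticOrderNatAt f.1 c : ℝ) * (Real.log R - Real.log r) else 0)
      = (analyticOrderNatAt f.1 c : ℝ) * (Real.log R - Real.log r) := by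
    split_ifs with hcS
    · rfl
    · have : analyticOrderNatAt f.1 c = 0 := by
        by_contra h0
        exact hcS ((hmem c).2 ⟨Metric.mem_ball_self hr, h0⟩)
      simp [this]
  rw [hc]
  push_cast
  ring

theorem eventually_dist_lt (f₀ : Entire) {K : Set ℂ} (hK : IsCompact K) {ε : ℝ} (hε : 0 < ε) :
    ∀ᶠ f : Entire in 𝓝 f₀, ∀ z ∈ K, dist (f₀.1 z) (f.1 z) < ε := by
  have h1 : Tendsto (fun f : Entire => f.1) (𝓝 f₀) (𝓝 f₀.1) := continuous_subtype_val.tendsto _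
  rw [ContinuousMap.tendsto_iff_forall_isCompact_tendstoUniformlyOn] at h1
  exact Metric.tendstoUniformlyOn_iff.1 (h1 K hK) ε hε

theorem exists_pos_le_norm (f₀ : Entire) {K : Set ℂ} (hK : IsCompact K) (h : ∀ z ∈ K, f₀.1 z ≠ 0) :
    ∃ δ : ℝ, 0 < δ ∧ ∀ z ∈ K, δ ≤ ‖f₀.1 z‖ := by
  obtain ⟨δ, h1, h2⟩ := hK.exists_forall_le' (f := fun z => ‖f₀.1 z‖) (by fun_prop)
    (fun z hz => norm_pos_iff.2 (h z hz))
  exact ⟨δ, h1, h2⟩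

theorem eventually_ne_zero (f₀ : Entire) {K : Set ℂ} (hK : IsCompact K) (h : ∀ z ∈ K, f₀.1 z ≠ 0) :
    ∀ᶠ f : Entire in 𝓝 f₀, ∀ z ∈ K, f.1 z ≠ 0 := by
  obtain ⟨δ, hδ, hle⟩ := exists_pos_le_norm f₀ hK h
  filter_upwards [eventually_dist_lt f₀ hK hδ] with f hf z hz h0
  have := hf z hz
  rw [h0, dist_zero_right] at this
  exact absurd (hle z hz) (not_le.2 this)

theorem tendsto_circleAverage_log_norm (f₀ : Entire) (c : ℂ) {R : ℝ} (hR : 0 ≤ R)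
    (h : ∀ z ∈ Metric.sphere c R, f₀.1 z ≠ 0) :
    Tendsto (fun f : Entire => Real.circleAverage (fun z => Real.log ‖f.1 z‖) c R) (𝓝 f₀)
      (𝓝 (Real.circleAverage (fun z => Real.log ‖f₀.1 z‖) c R)) := by
  have hK := isCompact_sphere c R
  obtain ⟨δ, hδ, hle⟩ := exists_pos_le_norm f₀ hK h
  obtain ⟨C, hC⟩ := hK.exists_bound_of_continuousOn (f := f₀.1) (by fun_prop)
  simp only [Real.circleAverage_def]
  refine Tendsto.const_smul ?_ _
  refine intervalIntegral.tendsto_integral_filter_of_dominated_convergence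
    (fun _ => |Real.log (δ / 2)| + |Real.log (C + δ)|) (Eventually.of_forall fun f => ?_) ?_
    (by simp) (ae_of_all _ fun θ _ => ?_)
  · exact (Real.measurable_log.comp ((f.1.continuous.comp
      (continuous_circleMap c R)).norm.measurable)).aestronglyMeasurable
  · filter_upwards [eventually_dist_lt f₀ hK (half_pos hδ)] with f hf
    refine ae_of_all _ fun θ _ => ?_
    have hz := circleMap_mem_sphere c hR θ
    set z := circleMap c R θ
    have h1 := hf z hz
    have h2 := hle z hz
    have h3 := hC z hz
    rw [dist_eq_norm] at h1
    have h4 := norm_sub_norm_le (f₀.1 z) (f.1 z)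
    have h5 := norm_sub_norm_le (f.1 z) (f₀.1 z)
    rw [norm_sub_rev] at h5
    have h6 : Real.log (δ / 2) ≤ Real.log ‖f.1 z‖ :=
      Real.log_le_log (by positivity) (by linarith)
    have h7 : Real.log ‖f.1 z‖ ≤ Real.log (C + δ) :=
      Real.log_le_log (by linarith) (by linarith)
    rw [Real.norm_eq_abs, abs_le]
    constructor
    · linarith [neg_abs_le (Real.log (δ / 2)), abs_nonneg (Real.log (C + δ))]
    · linarith [le_abs_self (Real.log (C + δ)), abs_nonneg (Real.log (δ / 2))]
  · have h1 : Tendsto (fun f : Entire => f.1 (circleMap c R θ)) (𝓝 f₀)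
        (𝓝 (f₀.1 (circleMap c R θ))) :=
      ((continuous_eval_const (circleMap c R θ)).comp continuous_subtype_val).tendsto _
    exact h1.norm.log (norm_ne_zero_iff.2 (h _ (circleMap_mem_sphere c hR θ)))

/-- Hurwitz's theorem near a point: if `f₀` has no zero in the punctured disc of radius `2 r`, then
every entire function near `f₀` has as many zeros in the disc of radius `r` as `f₀`. -/
theorem eventually_zeroMeasure_ball_eq (f₀ : Entire) (c : ℂ) {r : ℝ} (hr : 0 < r)
    (h : ∀ z, z ≠ c → dist z c ≤ 2 * r → f₀.1 z ≠ 0) :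
    ∀ᶠ f : Entire in 𝓝 f₀,
      zeroMeasure f.1 (Metric.ball c r) = (analyticOrderNatAt f₀.1 c : ENNReal) := by
  have hann : ∀ z, r ≤ dist z c → dist z c ≤ 2 * r → f₀.1 z ≠ 0 := fun z h1 h2 =>
    h z (fun hz => by rw [hz, dist_self] at h1; linarith) h2
  have h₀ : zeroMeasure f₀.1 (Metric.ball c r) = (analyticOrderNatAt f₀.1 c : ENNReal) := by
    rw [zeroMeasure_apply f₀ measurableSet_ball (S := {c})]
    · simp
    · intro z hz hz0
      by_contra hzc
      rw [Finset.mem_singleton] at hzc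
      rw [Metric.mem_ball] at hz
      exact h z hzc (by linarith) (apply_eq_zero_of_analyticOrderNatAt_ne_zero hz0)
    · intro z hz
      rw [Finset.mem_singleton] at hz
      rw [hz]; exact Metric.mem_ball_self hr
  have hK : IsCompact (Metric.closedBall c (2 * r) ∩ {z | r ≤ dist z c}) :=
    (isCompact_closedBall c (2 * r)).inter_right
      (isClosed_le continuous_const (continuous_id.dist continuous_const))
  have hne := eventually_ne_zero f₀ hK fun z hz => hann z hz.2 hz.1
  have hlim := (tendsto_circleAverage_log_norm f₀ c (by positivity : 0 ≤ 2 * r) fun z hz => by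
    rw [Metric.mem_sphere] at hz
    exact hann z (by linarith) hz.le).sub
    (tendsto_circleAverage_log_norm f₀ c hr.le fun z hz => by
    rw [Metric.mem_sphere] at hz
    exact hann z hz.ge (by linarith))
  rw [circleAverage_log_norm_sub f₀ c hr (by linarith) hann, h₀] at hlim
  have hlog : 0 < Real.log (2 * r / r) := Real.log_pos (by rw [lt_div_iff₀ hr]; linarith)
  filter_upwards [hne, (Metric.tendsto_nhds.1 hlim) _ hlog] with f hf hd
  rw [circleAverage_log_norm_sub f c hr (by linarith) fun z h1 h2 => hf z ⟨h2, h1⟩] at hd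
  obtain ⟨n, hn⟩ := zeroMeasure_bounded f (Metric.ball c r) measurableSet_ball
    Metric.isBounded_ball
  rw [hn] at hd ⊢
  rw [ENNReal.toReal_natCast, ENNReal.toReal_natCast, Real.dist_eq, ← sub_mul, abs_mul,
    abs_of_pos hlog] at hd
  have h1 : |(n : ℝ) - analyticOrderNatAt f₀.1 c| < 1 := by
    by_contra hcon
    push Not at hcon
    nlinarith
  have h2 : |(n : ℤ) - analyticOrderNatAt f₀.1 c| < 1 := by exact_mod_cast h1
  have h3 : (n : ℤ) = analyticOrderNatAt f₀.1 c := by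
    have := Int.abs_lt_one_iff.1 h2
    linarith
  have h4 : n = analyticOrderNatAt f₀.1 c := by exact_mod_cast h3
  rw [h4]

end Hurwitz

/-! ### Continuity of the zeros in the vague topology -/

section Vague

instance (f : Entire) : IsFiniteMeasureOnCompacts (zeroMeasure f.1) where
  lt_top_of_isCompact K hK := by
    obtain ⟨n, hn⟩ := zeroMeasure_bounded f K hK.measurableSet hK.isBounded
    rw [hn]; exact ENNReal.natCast_lt_top n

theorem eventually_ne_zero_of_ne_zero (f : Entire) (hf : f.1 ≠ 0) (z : ℂ) :
    ∀ᶠ w in 𝓝[≠] z, f.1 w ≠ 0 := by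
  refine (f.2.analyticAt z).eventually_eq_zero_or_eventually_ne_zero.resolve_left fun h => hf ?_
  ext w
  exact (f.analyticOnNhd Set.univ).eqOn_zero_of_preconnected_of_eventuallyEq_zero
    isPreconnected_univ (Set.mem_univ z) h (Set.mem_univ w)

theorem analyticOrderNatAt_ne_zero_iff (f : Entire) (hf : f.1 ≠ 0) (z : ℂ) :
    analyticOrderNatAt f.1 z ≠ 0 ↔ f.1 z = 0 := by
  refine ⟨apply_eq_zero_of_analyticOrderNatAt_ne_zero, fun h h0 => ?_⟩
  rw [analyticOrderNatAt, ENat.toNat_eq_zero] at h0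
  rcases h0 with h0 | h0
  · exact (f.2.analyticAt z).analyticOrderAt_eq_zero.1 h0 h
  · rw [analyticOrderAt_eq_top] at h0
    obtain ⟨w, h1, h2⟩ := ((h0.filter_mono nhdsWithin_le_nhds).and
      (eventually_ne_zero_of_ne_zero f hf z)).exists
    exact h2 h1

/-- The integral of a test function against the zeros is determined, up to its oscillation, by the
zero counts in small discs. -/
theorem abs_integral_zeroMeasure_sub_le (f : Entire) (φ : CompactlySupportedContinuousMap ℂ ℝ)
    (Z : Finset ℂ) (k : ℂ → ℕ) {r ε : ℝ} (hdisj : (Z : Set ℂ).PairwiseDisjoint (Metric.ball · r))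
    (hcount : ∀ z ∈ Z, zeroMeasure f.1 (Metric.ball z r) = k z)
    (hne : ∀ w ∈ tsupport φ \ ⋃ z ∈ Z, Metric.ball z r, f.1 w ≠ 0)
    (hosc : ∀ z ∈ Z, ∀ w, dist w z < r → |φ w - φ z| ≤ ε) :
    |∫ w, φ w ∂zeroMeasure f.1 - ∑ z ∈ Z, k z * φ z| ≤ ε * ∑ z ∈ Z, (k z : ℝ) := by
  set μ := zeroMeasure f.1
  have hφ : Integrable φ μ := φ.continuous.integrable_of_hasCompactSupport φ.hasCompactSupport
  have hA : MeasurableSet (⋃ z ∈ Z, Metric.ball z r) :=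
    Finset.measurableSet_biUnion _ fun _ _ => measurableSet_ball
  have h1 : ∫ w, φ w ∂μ = ∫ w in ⋃ z ∈ Z, Metric.ball z r, φ w ∂μ := by
    refine (setIntegral_eq_integral_of_ae_compl_eq_zero ?_).symm
    have hnull : μ (tsupport φ \ ⋃ z ∈ Z, Metric.ball z r) = 0 :=
      zeroMeasure_eq_zero f ((isClosed_tsupport φ).measurableSet.diff hA) hne
    filter_upwards [measure_eq_zero_iff_ae_notMem.1 hnull] with w hw hwA
    by_contra hφw
    exact hw ⟨subset_tsupport φ hφw, hwA⟩
  rw [h1, integral_biUnion_finset Z (fun _ _ => measurableSet_ball) hdisj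
    (fun z _ => hφ.integrableOn), ← Finset.sum_sub_distrib, Finset.mul_sum]
  refine (Finset.abs_sum_le_sum_abs _ _).trans (Finset.sum_le_sum fun z hz => ?_)
  have hfin : μ (Metric.ball z r) < ⊤ := by rw [hcount z hz]; exact ENNReal.natCast_lt_top _
  have hreal : μ.real (Metric.ball z r) = k z := by
    rw [measureReal_def, hcount z hz, ENNReal.toReal_natCast]
  have h2 : ∫ w in Metric.ball z r, φ w ∂μ - k z * φ z
      = ∫ w in Metric.ball z r, (φ w - φ z) ∂μ := by
    rw [integral_sub hφ.integrableOn (integrableOn_const hfin.ne), setIntegral_const, hreal,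
      smul_eq_mul]
  rw [h2, ← Real.norm_eq_abs, ← hreal]
  exact norm_setIntegral_le_of_norm_le_const hfin fun w hw => hosc z hz w hw

/-- **Hurwitz's theorem**: the zero measure depends continuously, in the vague topology, on an
entire function that does not vanish identically. -/
theorem continuousAt_zerosOf (f₀ : Entire) (hf₀ : f₀.1 ≠ 0) : ContinuousAt zerosOf f₀ := by
  have hind : IsInducing (fun (μ : PointMeasure) (φ : CompactlySupportedContinuousMap ℂ ℝ) =>
      ∫ z, φ z ∂μ.1) := ⟨rfl⟩
  rw [hind.continuousAt_iff, continuousAt_pi]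
  intro φ
  change Tendsto (fun f : Entire => ∫ w, φ w ∂zeroMeasure f.1) (𝓝 f₀)
    (𝓝 (∫ w, φ w ∂zeroMeasure f₀.1))
  have hK : IsCompact (tsupport φ) := φ.hasCompactSupport
  set Z : Finset ℂ := (finite_support_order f₀ hK.isBounded).toFinset with hZ
  have hmem : ∀ z, z ∈ Z ↔ z ∈ tsupport φ ∧ f₀.1 z = 0 := fun z => by
    simp [hZ, ← analyticOrderNatAt_ne_zero_iff f₀ hf₀ z]
  set k : ℂ → ℕ := fun z => analyticOrderNatAt f₀.1 z with hk
  rw [Metric.tendsto_nhds]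
  intro ε hε
  set s : ℝ := ∑ z ∈ Z, (k z : ℝ) with hs
  have hs0 : 0 ≤ s := Finset.sum_nonneg fun _ _ => Nat.cast_nonneg _
  set ε' : ℝ := ε / (4 * (s + 1)) with hε'
  have hε'0 : 0 < ε' := by positivity
  obtain ⟨δ, hδ, hφδ⟩ := Metric.uniformContinuous_iff.1
    (φ.hasCompactSupport.uniformContinuous_of_continuous φ.continuous) ε' hε'0
  -- a radius isolating the zeros of `f₀` in the support of `φ`
  have hr : ∀ᶠ r : ℝ in 𝓝[>] 0, 0 < r ∧ r < δ ∧
      ∀ z ∈ Z, ∀ w, w ≠ z → dist w z ≤ 2 * r → f₀.1 w ≠ 0 := by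
    refine eventually_mem_nhdsWithin.and (Eventually.and (mem_nhdsWithin_of_mem_nhds (Iio_mem_nhds hδ))
      ((Finset.eventually_all Z).2 fun z hz => ?_))
    obtain ⟨ρ, hρ, hρz⟩ := Metric.mem_nhdsWithin_iff.1 (eventually_ne_zero_of_ne_zero f₀ hf₀ z)
    filter_upwards [mem_nhdsWithin_of_mem_nhds (Iio_mem_nhds (half_pos hρ))] with r hr w hwz hw
    rw [Set.mem_Iio] at hr
    exact hρz ⟨Metric.mem_ball.2 (by linarith), hwz⟩
  obtain ⟨r, hr0, hrδ, hiso⟩ := hr.exists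
  have hdisj : (Z : Set ℂ).PairwiseDisjoint (Metric.ball · r) := by
    intro z hz z' hz' hne
    refine Metric.ball_disjoint_ball ?_
    by_contra hcon
    push Not at hcon
    exact hiso z' hz' z hne (by linarith) ((hmem z).1 hz).2
  have hosc : ∀ z ∈ Z, ∀ w, dist w z < r → |φ w - φ z| ≤ ε' := fun z _ w hw =>
    (hφδ (hw.trans hrδ)).le
  have hcount : ∀ᶠ f : Entire in 𝓝 f₀, ∀ z ∈ Z,
      zeroMeasure f.1 (Metric.ball z r) = (k z : ENNReal) :=
    (Finset.eventually_all Z).2 fun z hz => eventually_zeroMeasure_ball_eq f₀ z hr0 (hiso z hz)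
  have hcompl : ∀ᶠ f : Entire in 𝓝 f₀,
      ∀ w ∈ tsupport φ \ ⋃ z ∈ Z, Metric.ball z r, f.1 w ≠ 0 := by
    refine eventually_ne_zero f₀ (hK.diff (isOpen_biUnion fun _ _ => Metric.isOpen_ball))
      fun w hw h0 => hw.2 ?_
    exact Set.mem_biUnion ((hmem w).2 ⟨hw.1, h0⟩) (Metric.mem_ball_self hr0)
  have hbound : ∀ᶠ f : Entire in 𝓝 f₀,
      |∫ w, φ w ∂zeroMeasure f.1 - ∑ z ∈ Z, k z * φ z| ≤ ε' * s := by
    filter_upwards [hcount, hcompl] with f h1 h2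
    exact abs_integral_zeroMeasure_sub_le f φ Z k hdisj h1 h2 hosc
  have h₀ := hbound.self_of_nhds
  have hlt : ε' * s ≤ ε / 4 := by
    rw [hε', div_mul_eq_mul_div, div_le_div_iff₀ (by positivity) (by positivity)]
    nlinarith
  filter_upwards [hbound] with f hf
  rw [Real.dist_eq]
  rw [abs_le] at hf h₀
  rw [abs_lt]
  constructor <;> linarith [hf.1, hf.2, h₀.1, h₀.2]

end Vague

/-! ### Continuous mapping for the zeros -/

section Mapping

variable {ι : Type*} [Finite ι]

omit [Finite ι] in
/-- Once the set `I` of identically vanishing components is prescribed, the zeros depend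
continuously on the functions, although they do not near the zero function. -/
theorem continuousWithinAt_zerosOf_pi (I : Set ι) (f : ι → Entire)
    (hf : ∀ i, i ∈ I ↔ (f i).1 = 0) :
    ContinuousWithinAt (fun (f : ι → Entire) i => zerosOf (f i)) {f | ∀ i, i ∈ I ↔ (f i).1 = 0}
      f := by
  refine continuousWithinAt_pi.2 fun i => ?_
  by_cases hi : i ∈ I
  · have h0 : ∀ g : ι → Entire, (∀ i, i ∈ I ↔ (g i).1 = 0) → zerosOf (g i) = zerosOf (f i) := by
      intro g hg
      rw [Subtype.ext (((hg i).1 hi).trans ((hf i).1 hi).symm)]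
    exact continuousWithinAt_const.congr (fun g hg => h0 g hg) (h0 f hf)
  · exact (ContinuousAt.comp (f := fun f : ι → Entire => f i)
      (continuousAt_zerosOf (f i) fun h => hi ((hf i).2 h))
      (continuous_apply i).continuousAt).continuousWithinAt

omit [Finite ι] in
theorem isOpen_setOf_apply_ne_zero (i : ι) : IsOpen {f : ι → Entire | (f i).1 ≠ 0} :=
  isOpen_ne.preimage (continuous_subtype_val.comp (continuous_apply i))

/-- The map `f ↦ (zeros of f_i)_i` is Borel measurable: it is continuous on each of the finitely
many locally closed pieces on which a prescribed set of components vanishes identically. -/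
theorem measurable_zerosOf_pi :
    @Measurable _ _ (borel (ι → Entire)) (borel (ι → PointMeasure))
      fun f i => zerosOf (f i) := by
  let _ : MeasurableSpace (ι → Entire) := borel _
  have _ : BorelSpace (ι → Entire) := ⟨rfl⟩
  let _ : MeasurableSpace (ι → PointMeasure) := borel _
  have _ : BorelSpace (ι → PointMeasure) := ⟨rfl⟩
  set G : Set ι → Set (ι → Entire) := fun I => {f | ∀ i, i ∈ I ↔ (f i).1 = 0} with hG
  have hGm : ∀ I, MeasurableSet (G I) := by
    intro I
    have : G I = ⋂ i, {f | i ∈ I ↔ (f i).1 = 0} := by ext f; simp [hG]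
    rw [this]
    refine MeasurableSet.iInter fun i => ?_
    have ho := isOpen_setOf_apply_ne_zero i
    by_cases hi : i ∈ I
    · simp only [hi, true_iff]
      convert ho.measurableSet.compl using 1
      ext f; simp
    · simp only [hi, false_iff]
      exact ho.measurableSet
  refine measurable_of_isOpen fun U hU => ?_
  have hun : (fun (f : ι → Entire) i => zerosOf (f i)) ⁻¹' U
      = ⋃ I : Set ι, (fun (f : ι → Entire) i => zerosOf (f i)) ⁻¹' U ∩ G I := by
    rw [← Set.inter_iUnion]
    symm
    refine Set.inter_eq_left.2 fun f _ => Set.mem_iUnion.2 ⟨{i | (f i).1 = 0}, ?_⟩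
    simp [hG]
  rw [hun]
  refine MeasurableSet.iUnion fun I => ?_
  obtain ⟨u, hu, huI⟩ := continuousOn_iff'.1
    (fun f hf => continuousWithinAt_zerosOf_pi I f hf : ContinuousOn _ (G I)) U hU
  rw [huI]
  exact hu.measurableSet.inter (hGm I)

open scoped Uniformity in
/-- Convergence in law of entire functions implies convergence in law of their zeros, when the
limit almost surely has no identically vanishing component. -/
theorem ConvergesInLaw.zerosOf {Ω Ω' : Type*} [MeasurableSpace Ω] [MeasurableSpace Ω']
    {P : Measure Ω} [IsProbabilityMeasure P] {P' : Measure Ω'} [IsProbabilityMeasure P']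
    {X : ℕ → Ω → ι → Entire} {Z : Ω' → ι → Entire} (h : ConvergesInLaw X P Z P')
    (hZ : ∀ᵐ ω ∂P', ∀ i, (Z ω i).1 ≠ 0) :
    ConvergesInLaw (fun n ω i => CrystallinePhase.zerosOf (X n ω i)) P
      (fun ω i => CrystallinePhase.zerosOf (Z ω i)) P' := by
  let _ : MeasurableSpace (ι → Entire) := borel _
  have _ : BorelSpace (ι → Entire) := ⟨rfl⟩
  let _ : MeasurableSpace (ι → PointMeasure) := borel _
  have _ : BorelSpace (ι → PointMeasure) := ⟨rfl⟩
  have hm : Measurable fun (f : ι → Entire) i => CrystallinePhase.zerosOf (f i) :=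
    measurable_zerosOf_pi
  obtain ⟨h1, h2, h3⟩ := h
  have : IsCountablyGenerated (𝓤 (ι → Entire)) := inferInstance
  let _ : PseudoMetricSpace (ι → Entire) := UniformSpace.pseudoMetricSpace _
  refine ⟨fun n => hm.comp_aemeasurable (h1 n), hm.comp_aemeasurable h2, ?_⟩
  refine tendsto_of_forall_isOpen_le_liminf' fun U hU => ?_
  simp only [ProbabilityMeasure.coe_mk]
  set G : Set (ι → Entire) := {f | ∀ i, (f i).1 ≠ 0} with hG
  have hGo : IsOpen G := by
    have : G = ⋂ i, {f | (f i).1 ≠ 0} := by ext f; simp [hG]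
    rw [this]
    exact isOpen_iInter_of_finite fun i => isOpen_setOf_apply_ne_zero i
  have hc : ContinuousOn (fun (f : ι → Entire) i => CrystallinePhase.zerosOf (f i)) G :=
    fun f hf => (continuousAt_pi.2 fun i => ContinuousAt.comp (f := fun f : ι → Entire => f i)
      (continuousAt_zerosOf (f i) (hf i)) (continuous_apply i).continuousAt).continuousWithinAt
  set V := G ∩ (fun (f : ι → Entire) i => CrystallinePhase.zerosOf (f i)) ⁻¹' U with hV
  have hVo : IsOpen V := hc.isOpen_inter_preimage hGo hU
  have key := ProbabilityMeasure.le_liminf_measure_open_of_tendsto h3 hVo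
  simp only [ProbabilityMeasure.coe_mk] at key
  have h1' : ∀ n, AEMeasurable (fun ω i => CrystallinePhase.zerosOf (X n ω i)) P := fun n =>
    hm.comp_aemeasurable (h1 n)
  have h2' : AEMeasurable (fun ω i => CrystallinePhase.zerosOf (Z ω i)) P' :=
    hm.comp_aemeasurable h2
  rw [Measure.map_apply_of_aemeasurable h2' hU.measurableSet]
  rw [Measure.map_apply_of_aemeasurable h2 hVo.measurableSet] at key
  calc P' ((fun ω i => CrystallinePhase.zerosOf (Z ω i)) ⁻¹' U) ≤ P' (Z ⁻¹' V) := by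
        refine measure_mono_ae ?_
        filter_upwards [hZ] with ω hω hU
        exact ⟨hω, hU⟩
    _ ≤ _ := key
    _ ≤ _ := by
        refine liminf_le_liminf (Eventually.of_forall fun n => ?_)
        rw [Measure.map_apply_of_aemeasurable (h1' n) hU.measurableSet,
          Measure.map_apply_of_aemeasurable (h1 n) hVo.measurableSet]
        exact measure_mono fun ω hω => hω.2

end Mapping

/-! ### The zeros of the limit -/

section Lattice

theorem add_exp_mul_eq_zero_iff {p q : ℂ} (hp : p ≠ 0) (hq : q ≠ 0) (u : ℂ) :
    p + Complex.exp u * q = 0 ↔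
      ∃ k : ℤ, Complex.log (-p / q) + 2 * Real.pi * Complex.I * k = u := by
  have h1 : p + Complex.exp u * q = 0 ↔ Complex.exp u = Complex.exp (Complex.log (-p / q)) := by
    rw [Complex.exp_log (div_ne_zero (neg_ne_zero.2 hp) hq), eq_div_iff hq,
      add_comm, add_eq_zero_iff_eq_neg]
  rw [h1, Complex.exp_eq_exp_iff_exists_int]
  refine exists_congr fun k => ?_
  rw [eq_comm, mul_comm (k : ℂ)]

theorem zeroMeasure_limitFunction {p q : ℂ} (hp : p ≠ 0) (hq : q ≠ 0) :
    zeroMeasure (limitFunction p q).1 = Measure.sum (fun k : ℤ => Measure.dirac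
      (Complex.log (-p / q) + 2 * Real.pi * Complex.I * k)) := by
  set a : ℤ → ℂ := fun k => Complex.log (-p / q) + 2 * Real.pi * Complex.I * k with ha
  have hinj : Function.Injective a := fun k l hkl => by
    have h1 := mul_left_cancel₀ Complex.two_pi_I_ne_zero (add_left_cancel hkl)
    exact_mod_cast h1
  have hord : ∀ k, analyticOrderNatAt (limitFunction p q).1 (a k) = 1 := by
    intro k
    have hz : (limitFunction p q).1 (a k) = 0 := (add_exp_mul_eq_zero_iff hp hq _).2 ⟨k, rfl⟩
    have hd : deriv (limitFunction p q).1 (a k) = Complex.exp (a k) * q :=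
      (((Complex.hasDerivAt_exp (a k)).mul_const q).const_add p).deriv
    rw [analyticOrderNatAt, ((limitFunction p q).2.analyticAt _).analyticOrderAt_eq_one_of_zero_deriv_ne_zero
      hz (by rw [hd]; exact mul_ne_zero (Complex.exp_ne_zero _) hq)]
    rfl
  ext B hB
  rw [zeroMeasure, Measure.sum_apply _ hB, Measure.sum_apply _ hB, ← hinj.tsum_eq]
  · simp only [Measure.smul_apply, hord]
    simp [ha]
  · intro z hz
    rw [Function.mem_support] at hz
    refine (add_exp_mul_eq_zero_iff hp hq z).1 (apply_eq_zero_of_analyticOrderNatAt_ne_zero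
      (f := (limitFunction p q).1) fun h0 => hz ?_)
    simp [h0]

theorem limitFunction_ne_zero {p q : ℂ} (hq : q ≠ 0) : (limitFunction p q).1 ≠ 0 := by
  intro h
  have h1 : p + Complex.exp 0 * q = 0 := congrArg (fun f : C(ℂ, ℂ) => f 0) h
  have h2 : p + Complex.exp (Real.log 2 : ℝ) * q = 0 :=
    congrArg (fun f : C(ℂ, ℂ) => f (Real.log 2 : ℝ)) h
  rw [← Complex.ofReal_exp, Real.exp_log two_pos] at h2
  rw [Complex.exp_zero] at h1
  push_cast at h2
  exact hq (by linear_combination h2 - h1)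

end Lattice

/-! ### Non-degeneracy of the limit -/

section Nondegenerate

variable {Ω : Type*} [MeasurableSpace Ω] {P : Measure Ω} [IsProbabilityMeasure P]

omit [IsProbabilityMeasure P] in
theorem ae_ne_zero_of_hasGaussianLaw_real {X : Ω → ℝ} (hX : HasGaussianLaw X P)
    (hm : ∫ ω, X ω ∂P = 0) (hv : ∫ ω, X ω ^ 2 ∂P ≠ 0) : ∀ᵐ ω ∂P, X ω ≠ 0 := by
  have h1 := hX.map_eq_gaussianReal
  rw [hm, variance_of_integral_eq_zero hX.aemeasurable hm] at h1
  have hpos : 0 < ∫ ω, X ω ^ 2 ∂P :=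
    lt_of_le_of_ne (integral_nonneg fun _ => sq_nonneg _) hv.symm
  have := nullSingletonClass_gaussianReal (μ := 0) (Real.toNNReal_pos.2 hpos).ne'
  have h2 : P.map X {0} = 0 := by rw [h1]; exact measure_singleton 0
  rw [Measure.map_apply_of_aemeasurable hX.aemeasurable (measurableSet_singleton 0)] at h2
  exact measure_eq_zero_iff_ae_notMem.1 h2

theorem ae_ne_zero_of_hasGaussianLaw {Y : Ω → ℂ} (hY : HasGaussianLaw Y P)
    (hm : ∫ ω, Y ω ∂P = 0) (hv : ∫ ω, Y ω * (starRingEnd ℂ) (Y ω) ∂P ≠ 0) :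
    ∀ᵐ ω ∂P, Y ω ≠ 0 := by
  have hre : HasGaussianLaw (fun ω => (Y ω).re) P := hY.map_fun Complex.reCLM
  have him : HasGaussianLaw (fun ω => (Y ω).im) P := hY.map_fun Complex.imCLM
  have hmre : ∫ ω, (Y ω).re ∂P = 0 := by
    have : ∫ ω, (Y ω).re ∂P = (∫ ω, Y ω ∂P).re := integral_re hY.integrable
    rw [this, hm, Complex.zero_re]
  have hmim : ∫ ω, (Y ω).im ∂P = 0 := by
    have : ∫ ω, (Y ω).im ∂P = (∫ ω, Y ω ∂P).im := integral_im hY.integrable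
    rw [this, hm, Complex.zero_im]
  by_cases h1 : ∫ ω, (Y ω).re ^ 2 ∂P = 0
  · have h2 : ∫ ω, (Y ω).im ^ 2 ∂P ≠ 0 := by
      intro h2
      apply hv
      have e : ∀ ω, Y ω * (starRingEnd ℂ) (Y ω) = (((Y ω).re ^ 2 + (Y ω).im ^ 2 : ℝ) : ℂ) := by
        intro ω
        rw [Complex.mul_conj, Complex.normSq_apply]
        push_cast; ring
      simp_rw [e]
      rw [integral_complex_ofReal, integral_add hre.memLp_two.integrable_sq
        him.memLp_two.integrable_sq, h1, h2]
      simp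
    filter_upwards [ae_ne_zero_of_hasGaussianLaw_real him hmim h2] with ω hω h0
    exact hω (by rw [h0, Complex.zero_im])
  · filter_upwards [ae_ne_zero_of_hasGaussianLaw_real hre hmre h1] with ω hω h0
    exact hω (by rw [h0, Complex.zero_re])

/-- Each coordinate has positive variance, so its real or its imaginary part is a nondegenerate
real Gaussian variable. -/
theorem IsLimitVector.ae_ne_zero {m : ℕ} {σ₁ σ₂ : ℝ} {ψ : Fin m → ℝ} {N : Ω → Fin m → ℂ}
    (h : IsLimitVector σ₁ σ₂ ψ N P) (hσ : 0 < σ₁ ^ 2 + σ₂ ^ 2) : ∀ᵐ ω ∂P, ∀ i, N ω i ≠ 0 := by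
  refine ae_all_iff.2 fun i => ae_ne_zero_of_hasGaussianLaw (h.gaussian.eval i) (h.mean i) ?_
  rw [h.cov i i, if_pos rfl]
  exact_mod_cast hσ.ne'

end Nondegenerate

end CrystallinePhase

theorem theorem3p5
    {Ω : Type*} [MeasurableSpace Ω] (P : MeasureTheory.Measure Ω)
    [MeasureTheory.IsProbabilityMeasure P]
    -- the coefficients: independent copies of a complex random variable
    (ξ : ℕ → Ω → ℂ) (hξ_meas : ∀ k, Measurable (ξ k))
    (hξ_indep : ProbabilityTheory.iIndepFun ξ P)
    (hξ_ident : ∀ k, ProbabilityTheory.IdentDistrib (ξ k) (ξ 0) P P)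
    -- moment assumptions
    (σ₁ σ₂ : ℝ)
    (h_re : MeasureTheory.MemLp (fun ω => (ξ 0 ω).re) 2 P)
    (h_im : MeasureTheory.MemLp (fun ω => (ξ 0 ω).im) 2 P)
    (h_mean : ∫ ω, ξ 0 ω ∂P = 0)
    (hσ₁ : ∫ ω, (ξ 0 ω).re ^ 2 ∂P = σ₁ ^ 2)
    (hσ₂ : ∫ ω, (ξ 0 ω).im ^ 2 ∂P = σ₂ ^ 2)
    (hσ : 0 < σ₁ ^ 2 + σ₂ ^ 2)
    (h_cov : ProbabilityTheory.covariance (fun ω => (ξ 0 ω).re) (fun ω => (ξ 0 ω).im) P = 0)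
    -- the regularly varying function of index `-1/2`, in the critical divergent case
    (b ℓ : ℝ → ℝ) (hℓ : CrystallinePhase.IsSlowlyVarying ℓ)
    (hb : ∀ x : ℝ, 0 < x → b x = x ^ (-(1 / 2) : ℝ) * ℓ x)
    (hS : CrystallinePhase.seriesS (-1) ℓ = ⊤)
    -- `L(x) = ∫_c^x b²` is well defined
    (c : ℝ) (hc : 0 ≤ c)
    (hbc : ∀ x : ℝ, c ≤ x → IntervalIntegrable (fun t => b t ^ 2) MeasureTheory.volume c x)
    -- the angles
    {m : ℕ} (ψ : Fin m → ℝ) (hψ_mono : StrictMono ψ)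
    (hψ : ∀ i, ψ i ∈ Set.Ico 0 (2 * Real.pi)) :
    -- the Gaussian law of the limit exists
    (∃ γ : MeasureTheory.Measure (Fin m → ℂ),
      CrystallinePhase.IsLimitVector σ₁ σ₂ ψ (fun x => x) γ) ∧
    ∀ {Ω' : Type*} [MeasurableSpace Ω'] (P' : MeasureTheory.Measure Ω')
      [MeasureTheory.IsProbabilityMeasure P'] (Nhat N : Ω' → Fin m → ℂ),
      CrystallinePhase.IsLimitVector σ₁ σ₂ ψ Nhat P' →
      CrystallinePhase.IsLimitVector σ₁ σ₂ ψ N P' →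
      ProbabilityTheory.IndepFun Nhat N P' →
      -- joint convergence in distribution on `𝒜(ℂ)^m`
      CrystallinePhase.ConvergesInLaw
        (fun n ω (i : Fin m) => CrystallinePhase.scaledPoly b c (fun k => ξ k ω) n (ψ i)) P
        (fun ω' (i : Fin m) => CrystallinePhase.limitFunction (Nhat ω' i) (N ω' i)) P' ∧
      -- joint convergence in distribution of the zeros on `M_p(ℂ)^m`
      CrystallinePhase.ConvergesInLaw
        (fun n ω (i : Fin m) => CrystallinePhase.zerosOf
          (CrystallinePhase.scaledPoly b c (fun k => ξ k ω) n (ψ i))) P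
        (fun ω' (i : Fin m) => CrystallinePhase.zerosOf
          (CrystallinePhase.limitFunction (Nhat ω' i) (N ω' i))) P' ∧
      -- the limiting zeros are simple and form the lattices `log (-N̂_i / N_i) + 2πiℤ`
      (∀ᵐ ω' ∂P', ∀ i : Fin m,
        {u : ℂ | Nhat ω' i + Complex.exp u * N ω' i = 0} =
          Set.range (fun k : ℤ =>
            Complex.log (-(Nhat ω' i) / N ω' i) + 2 * Real.pi * Complex.I * k) ∧
        (CrystallinePhase.zerosOf
            (CrystallinePhase.limitFunction (Nhat ω' i) (N ω' i))).1 =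
          MeasureTheory.Measure.sum (fun k : ℤ => MeasureTheory.Measure.dirac
            (Complex.log (-(Nhat ω' i) / N ω' i) + 2 * Real.pi * Complex.I * k))) := by
  have hweight : CrystallinePhase.IsCriticalWeight b (fun x => ℓ x ^ 2) c :=
    ⟨hℓ.sq, CrystallinePhase.sq_eq_div_of_eq_rpow hb, hbc,
      CrystallinePhase.tendsto_sum_sq_atTop hb hS⟩
  refine ⟨CrystallinePhase.exists_isLimitVector σ₁ σ₂ ψ hψ_mono hψ, ?_⟩
  intro Ω' _ P' _ Nhat N hNhat hN hind
  have hNne := hN.ae_ne_zero hσ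
  have hlaw := CrystallinePhase.convergesInLaw_scaledPoly hξ_meas hξ_indep hξ_ident h_re h_im h_mean
    hσ₁ hσ₂ h_cov hweight hψ_mono hψ hNhat hN hind
  refine ⟨hlaw, hlaw.zerosOf ?_, ?_⟩
  · filter_upwards [hNne] with ω hω i
    exact CrystallinePhase.limitFunction_ne_zero (hω i)
  · filter_upwards [hNhat.ae_ne_zero hσ, hNne] with ω hp hq i
    refine ⟨?_, CrystallinePhase.zeroMeasure_limitFunction (hp i) (hq i)⟩
    ext u
    exact CrystallinePhase.add_exp_mul_eq_zero_iff (hp i) (hq i) u
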